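/- **Setting.** Let $n\ge 2$, $N\ge 1$; $|\cdot|$ is the Euclidean norm on $\mathbb R^n$, $\mathbb R^N$ and $\mathbb R^{nN}$ (matrices $N\times n$); $B_\rho(x_0)$ is the open ball, $B_\rho=B_\rho(x_0)$, and $B_1=B_1(0)$ where no centre is fixed. A *Young function* is a differentiable $h:[0,\infty)\to[0,\infty)$ with $h(0)=0$, $h'$ right-continuous and non-decreasing, $h'(0)=0$, $h'(t)>0$ for $t>0$, $h'(t)\to\infty$ as $t\to\infty$. For $a>0$ the shifted function $h_a$ is given by $h_a(0)=0$, $h_a'(t)=h'(a+t)\frac{t}{a+t}$. For a non-decreasing $g$ on $[0,\infty)$ put $g^{-1}(t)=\sup\{s\ge0: g(s)\le t\}$; the complementary function $h^*$ is given by $h^*(0)=0$, $(h^*)'=(h')^{-1}$. $W^{1,\varphi}(U;\mathbb R^N)$ is the set of measurable $w$ with a weak gradient $Dw$ such that $\varphi(|w|),\varphi(|Dw|)\in L^1(U)$, and $W^{1,\varphi}_0(U;\mathbb R^N)$ is the closure in it of $C_c^\infty(U;\mathbb R^N)$. Let $\varphi,\psi$ be Young functions of class $C^1([0,\infty))\cap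 C^2(0,\infty)$, let $p_1,q_1,\gamma,\Gamma',\Gamma'',M>0$ and $1\le\beta<\frac n{n-1}$, and assume: * (H.0) $p_1\frac{h'(t)}t\le h''(t)\le q_1\frac{h'(t)}t$ for all $t>0$ and $h\in\{\varphi,\psi\}$. * (H.4) For every $a>M$ the function $\mathcal N_a=\varphi_a\circ(\psi_a')^{-1}$ is a Young function, and there is $c_a$ with $\mathcal N_a^*(t)\le c_a\,\varphi_a(t)^\beta$ for all sufficiently large $t$. For $f:\mathbb R^{nN}\to\mathbb R$ consider: * (H.1) $f\in C^2(\mathbb R^{nN})$. * (H.3) $\Gamma'\varphi(|z|)\le f(z)\le\Gamma''(1+\psi(|z|))$ for all $z$, and $|D^2f(z)|\le\Gamma''(1+\psi''(|z|))$ for all $z\neq0$. A function $g:\mathbb R^{nN}\to\mathbb R$ is called *strictly $W^{1,\varphi}$-quasiconvex at $z$ with constant $\gamma$* if $\frac{1}{|B_1|}\int_{B_1}g(z+D\phi)\,dx\ge g(z)+\gamma\frac{1}{|B_1|}\int_{B_1}\varphi_{1+|z|}(|D\phi|)\,dx$ for all $\phi\in W^{1,\varphi}_0(B_1;\mathbb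 R^N)$ for which $g(z+D\phi)$ is integrable on $B_1$. Consider * (H.2) there is a continuous $g$ with $f(z)=g(z)$ for $|z|>M$ which is strictly $W^{1,\varphi}$-quasiconvex with constant $\gamma$ at every $z$; * (H.2') $f$ is strictly $W^{1,\varphi}$-quasiconvex with constant $\gamma$ at every $z$ with $|z|>M$. A *$W^{1,\varphi}$-minimizer on $B_\rho(x_0)$* is a $u\in W^{1,\varphi}(B_\rho(x_0);\mathbb R^N)$ with $\int_{B_\rho(x_0)}f(Du)\,dx<\infty$ and $\int_{B_\rho(x_0)}f(Du)\,dx\le\int_{B_\rho(x_0)}f(Du+D\phi)\,dx$ for all $\phi\in W_0^{1,\varphi}(B_\rho(x_0);\mathbb R^N)$. **Lemma (Caccioppoli inequality of the second kind).** (i) For every $L>M$ there is a constant $c>0$, depending only on $n,N,\varphi,\psi,p_1,q_1,\beta,M,L,\gamma,\Gamma',\Gamma''$, such that for every $f$ satisfying (H.1), (H.2') and (H.3), every ball $B_\rho(x_0)\subset\mathbb R^n$, every $W^{1,\varphi}$-minimizer $u$ on $B_\rho(x_0)$, every $z\in\mathbb R^{nN}$ with $M<|z|<L+1$ and every affine $q:\mathbb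 R^n\to\mathbb R^N$ with gradient $z$, the function $v=u-q$ satisfies: $\varphi_{|z|}(|Dv|)$ and $\varphi_{|z|}(|v|/\rho)$ are integrable on $B_\rho(x_0)$, and $$\frac{1}{|B_{\rho/2}(x_0)|}\int_{B_{\rho/2}(x_0)}\varphi_{|z|}(|Dv|)\,dx\le c\frac{1}{|B_\rho(x_0)|}\int_{B_\rho(x_0)}\varphi_{|z|}\Big(\frac{|v|}\rho\Big)dx+c\left\{\frac{1}{|B_\rho(x_0)|}\int_{B_\rho(x_0)}\Big[\varphi_{|z|}(|Dv|)+\varphi_{|z|}\Big(\frac{|v|}\rho\Big)\Big]dx\right\}^\beta .$$ (ii) If $f$ satisfies (H.1), (H.2) and (H.3), then there are $M'\ge M$ and $\gamma'>0$ such that $f$ satisfies (H.2') with $M',\gamma'$ in place of $M,\gamma$ (so that (i) applies to $f$ with $M',\gamma'$). -/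

import Mathlib

open MeasureTheory Set Filter Topology
open scoped ContDiff

noncomputable section

/-- Points of `ℝ^d` with the Euclidean norm. -/
abbrev Vec (d : ℕ) : Type := EuclideanSpace ℝ (Fin d)

/-- `N × n` matrices, i.e. points of `ℝ^{nN}`, with the Euclidean (Frobenius) norm. -/
abbrev Mat (N n : ℕ) : Type := EuclideanSpace ℝ (Fin N × Fin n)

/-! ### Young functions

A function `[0,∞) → [0,∞)` is represented by a map `ℝ → ℝ`; its values at negative arguments
are never used. -/

/-- Derivative of a function defined on `[0,∞)` (one-sided at `0`). -/
def rderiv (h : ℝ → ℝ) (t : ℝ) : ℝ := derivWithin h (Ici 0) t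

/-- Young functions. -/
structure IsYoung (h : ℝ → ℝ) : Prop where
  map_zero : h 0 = 0
  differentiableOn : DifferentiableOn ℝ h (Ici 0)
  deriv_rightCont : ∀ t, 0 ≤ t → ContinuousWithinAt (rderiv h) (Ici t) t
  deriv_mono : MonotoneOn (rderiv h) (Ici 0)
  deriv_zero : rderiv h 0 = 0
  deriv_pos : ∀ t, 0 < t → 0 < rderiv h t
  deriv_tendsto : Tendsto (rderiv h) atTop atTop

/-- Young functions of class `C¹([0,∞)) ∩ C²(0,∞)`. -/
structure IsRegularYoung (h : ℝ → ℝ) : Prop extends IsYoung h where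
  deriv_continuousOn : ContinuousOn (rderiv h) (Ici 0)
  contDiffOn_two : ContDiffOn ℝ 2 h (Ioi 0)

/-- `p₁ h'(t)/t ≤ h''(t) ≤ q₁ h'(t)/t` for `t > 0`. -/
def DerivComparable (p₁ q₁ : ℝ) (h : ℝ → ℝ) : Prop :=
  ∀ t, 0 < t → p₁ * (deriv h t / t) ≤ deriv (deriv h) t ∧
    deriv (deriv h) t ≤ q₁ * (deriv h t / t)

/-- The derivative `h_a'(t) = h'(a+t) t/(a+t)` of the shifted function `h_a`. -/
def shiftDeriv (h : ℝ → ℝ) (a t : ℝ) : ℝ := rderiv h (a + t) * (t / (a + t))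

/-- The shifted function `h_a`: `h_a(0) = 0` and `h_a'(t) = h'(a+t) t/(a+t)`. -/
def shift (h : ℝ → ℝ) (a t : ℝ) : ℝ := ∫ s in (0 : ℝ)..t, shiftDeriv h a s

/-- Generalized inverse `g⁻¹(t) = sup {s ≥ 0 : g(s) ≤ t}`. -/
def genInv (g : ℝ → ℝ) (t : ℝ) : ℝ := sSup {s : ℝ | 0 ≤ s ∧ g s ≤ t}

/-- The complementary function: `h*(0) = 0` and `(h*)' = (h')⁻¹`. -/
def complementary (h : ℝ → ℝ) (t : ℝ) : ℝ := ∫ s in (0 : ℝ)..t, genInv (rderiv h) s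

/-- The function `N_a = φ_a ∘ (ψ_a')⁻¹`. -/
def anisotropyFun (φ ψ : ℝ → ℝ) (a t : ℝ) : ℝ := shift φ a (genInv (shiftDeriv ψ a) t)

/-- Range of anisotropy: for all `a > M`, `N_a` is a Young function and
`N_a*(t) ≤ c φ_a(t)^β` for all large `t`. -/
def AnisotropyRange (φ ψ : ℝ → ℝ) (M β : ℝ) : Prop :=
  ∀ a, M < a → IsYoung (anisotropyFun φ ψ a) ∧
    ∃ c : ℝ, ∀ᶠ t in atTop, complementary (anisotropyFun φ ψ a) t ≤ c * shift φ a t ^ β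

/-! ### Orlicz-Sobolev spaces -/

/-- Jacobian matrix of a differentiable map. -/
def gradMat {n N : ℕ} (w : Vec n → Vec N) (x : Vec n) : Mat N n :=
  WithLp.toLp 2 fun ij => fderiv ℝ w x (EuclideanSpace.single ij.2 1) ij.1

/-- Smooth maps with compact support in `U`. -/
def IsTestMap {n N : ℕ} (U : Set (Vec n)) (w : Vec n → Vec N) : Prop :=
  ContDiff ℝ ∞ w ∧ HasCompactSupport w ∧ tsupport w ⊆ U

/-- `Dw` is the weak gradient of `w` on the open set `U`. -/
def IsWeakGrad {n N : ℕ} (U : Set (Vec n)) (w : Vec n → Vec N) (Dw : Vec n → Mat N n) : Prop :=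
  LocallyIntegrableOn w U ∧ LocallyIntegrableOn Dw U ∧
    ∀ η : Vec n → ℝ, ContDiff ℝ ∞ η → HasCompactSupport η → tsupport η ⊆ U →
      ∀ (i : Fin N) (j : Fin n),
        ∫ x in U, w x i * fderiv ℝ η x (EuclideanSpace.single j 1) =
          -∫ x in U, Dw x (i, j) * η x

/-- The Orlicz class `L^φ(U)`. -/
def MemOrlicz {n : ℕ} {E : Type*} [NormedAddCommGroup E] (φ : ℝ → ℝ) (U : Set (Vec n))
    (w : Vec n → E) : Prop :=
  AEStronglyMeasurable w (volume.restrict U) ∧ IntegrableOn (fun x => φ ‖w x‖) U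

/-- `w ∈ W^{1,φ}(U;ℝ^N)` with weak gradient `Dw`. -/
def MemW {n N : ℕ} (φ : ℝ → ℝ) (U : Set (Vec n)) (w : Vec n → Vec N)
    (Dw : Vec n → Mat N n) : Prop :=
  IsWeakGrad U w Dw ∧ MemOrlicz φ U w ∧ MemOrlicz φ U Dw

/-- `w ∈ W₀^{1,φ}(U;ℝ^N)` with weak gradient `Dw`: the closure of the smooth maps with compact
support in `U`. Convergence in the Luxemburg norm is written as convergence to `0` of the
modular of every multiple. -/
def MemWZero {n N : ℕ} (φ : ℝ → ℝ) (U : Set (Vec n)) (w : Vec n → Vec N)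
    (Dw : Vec n → Mat N n) : Prop :=
  MemW φ U w Dw ∧ ∃ η : ℕ → Vec n → Vec N, (∀ k, IsTestMap U (η k)) ∧
    ∀ l : ℝ, 0 < l →
      Tendsto (fun k => ∫⁻ x in U, ENNReal.ofReal (φ (l * ‖η k x - w x‖))) atTop (𝓝 0) ∧
      Tendsto (fun k => ∫⁻ x in U, ENNReal.ofReal (φ (l * ‖gradMat (η k) x - Dw x‖)))
        atTop (𝓝 0)

/-! ### The integrand -/

/-- Strict `W^{1,φ}`-quasiconvexity of `g` at `z`, with constant `γ`. For `g` continuous and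
bounded below, a competitor for which `g(z + Dw)` is not integrable has infinite energy, so the
inequality is trivial for it. -/
def StrictQuasiconvexAt {n N : ℕ} (φ : ℝ → ℝ) (γ : ℝ) (g : Mat N n → ℝ) (z : Mat N n) : Prop :=
  ∀ (w : Vec n → Vec N) (Dw : Vec n → Mat N n), MemWZero φ (Metric.ball 0 1) w Dw →
    IntegrableOn (fun x => g (z + Dw x)) (Metric.ball 0 1) →
      g z + γ * (⨍ x in Metric.ball (0 : Vec n) 1, shift φ (1 + ‖z‖) ‖Dw x‖) ≤
        ⨍ x in Metric.ball (0 : Vec n) 1, g (z + Dw x)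

/-- `f` coincides for `|z| > M` with a continuous strictly `W^{1,φ}`-quasiconvex function. -/
def AsymptoticallyQuasiconvex {n N : ℕ} (φ : ℝ → ℝ) (M γ : ℝ) (f : Mat N n → ℝ) : Prop :=
  ∃ g : Mat N n → ℝ, Continuous g ∧ (∀ z, M < ‖z‖ → f z = g z) ∧
    ∀ z, StrictQuasiconvexAt φ γ g z

/-- `f` itself is strictly `W^{1,φ}`-quasiconvex at every `z` with `|z| > M`. -/
def QuasiconvexBeyond {n N : ℕ} (φ : ℝ → ℝ) (M γ : ℝ) (f : Mat N n → ℝ) : Prop :=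
  ∀ z, M < ‖z‖ → StrictQuasiconvexAt φ γ f z

/-- Growth conditions. The bound on `D²f` is required away from the origin, as `ψ''` lives on
`(0,∞)`. -/
def GrowthConditions {n N : ℕ} (φ ψ : ℝ → ℝ) (Γ₁ Γ₂ : ℝ) (f : Mat N n → ℝ) : Prop :=
  (∀ z, Γ₁ * φ ‖z‖ ≤ f z ∧ f z ≤ Γ₂ * (1 + ψ ‖z‖)) ∧
    ∀ z, z ≠ 0 → ‖iteratedFDeriv ℝ 2 f z‖ ≤ Γ₂ * (1 + deriv (deriv ψ) ‖z‖)

/-- `u`, with weak gradient `Du`, is a `W^{1,φ}`-minimizer of `∫_U f(Du)`, for `f ≥ 0`: it has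
finite energy, not larger than that of any `u + w`, `w ∈ W₀^{1,φ}(U;ℝ^N)`, of finite energy. -/
def IsMinimizer {n N : ℕ} (φ : ℝ → ℝ) (f : Mat N n → ℝ) (U : Set (Vec n)) (u : Vec n → Vec N)
    (Du : Vec n → Mat N n) : Prop :=
  MemW φ U u Du ∧ IntegrableOn (fun x => f (Du x)) U ∧
    ∀ (w : Vec n → Vec N) (Dw : Vec n → Mat N n), MemWZero φ U w Dw →
      IntegrableOn (fun x => f (Du x + Dw x)) U →
        ∫ x in U, f (Du x) ≤ ∫ x in U, f (Du x + Dw x)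

end

/-!
# A Caccioppoli inequality of the second kind under `(φ, ψ)`-growth

**Growth of the integrand.** The growth conditions control `D²f` by `ψ''`, which gives no information
on `Df` for slowly growing `ψ''`. The bound `|Df| ≤ C (1 + ψ')` comes from quasiconvexity: testing the
second variation with `k⁻¹ χ(x) sin (k ⟨b, x⟩) a` and `k⁻¹ χ(x) cos (k ⟨b, x⟩) a` yields the
Legendre-Hadamard condition at all `z` with `|z| > M`
(`StrictQuasiconvexAt.rank_one_nonneg`); hence `f` is convex along rank-one segments that avoid the
ball of radius `M`, and a nonnegative function that is convex on a segment has its slope bounded by its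
size (`exists_norm_fderiv_le`). It follows that `|Df(z + A) - Df(z)| ≤ C ψ_a'(|A|)` for
`M < |z| ≤ a`, and Young's inequality for `φ_a ∘ (ψ_a')⁻¹`, together with the bound of its
complementary function by `φ_a ^ β`, gives
`|f(z + A - B) - f(z) - f(z + A) + f(z + B)| ≤ C (φ_a(|A|) + φ_a(|B|) + φ_a(|B|) ^ β)`
(`exists_mixed_difference_le`).

**The comparison map.** By scaling it suffices to treat the unit ball and `v = u - q`, with gradient
`G`. For radii `r < s < s₀`, let `w = (1 - η) v` with a cut-off function `η`, so that `w = v` near the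
sphere `|x| = s` and `w = 0` on a neighbourhood of the closed ball of radius `r`. Let `T w(x)` be the
average of `w` over the ball about `x` whose radius `(s² - |x|²) / (8 s)` is comparable to the distance
of `x` to the sphere `|x| = s`. Then `T w` has the boundary values of `w` to first order, so
`Φ = (v - T w) 1_{B_s}` is an admissible variation, and `T w = 0` on `B_r`. Its gradient is obtained for
smooth `v` by differentiating under the integral and in general by mollification
(`isInnerVariation_comparison`). The operator `T` improves integrability: with
`α = n (1 - 1/β)`, the `L^β` norm of the averages is controlled by the `L¹` norm with weight
`(s - |x|) ^ (-α)` (`exists_lintegral_ballAvg_rpow_le`). Since `β < n / (n - 1)` means `α < 1`, the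
weight is integrable in `s`, and it can be removed by choosing a good radius
(`exists_good_radius`, `exists_annulus_estimate`).

**Conclusion.** Quasiconvexity at `z`, tested with `Φ`, and minimality, tested with `-Φ`, add up to a
bound of `∫_{B_r} φ_{1 + |z|}(|G|)` by the integral over `B_s` of a mixed difference of `f`, with
`A = G` and `B = D(T w)`; the mixed difference vanishes where `B` does, so only the annulus
`B_s \ B_r` contributes (`energy_le_of_comparison`). Filling the hole and iterating over the radii
(`exists_iteration`) gives the inequality.

For the asymptotic version, `f` and the quasiconvex function `g` differ at `z + Dw` only where
`|Dw| ≥ |z| / 2`, and this is absorbed by half of the strictness term because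
`φ_{1 + |z|}(|z| / 2) → ∞` (`AsymptoticallyQuasiconvex.exists_quasiconvexBeyond`).
-/

/-! ### Young functions and their shifts -/

section Young

theorem rderiv_eq_deriv {h : ℝ → ℝ} {t : ℝ} (ht : 0 < t) : rderiv h t = deriv h t :=
  derivWithin_of_mem_nhds (Ici_mem_nhds ht)

theorem IsYoung.rderiv_nonneg {h : ℝ → ℝ} (hh : IsYoung h) {t : ℝ} (ht : 0 ≤ t) :
    0 ≤ rderiv h t := by
  rcases ht.eq_or_lt with rfl | ht
  · exact hh.deriv_zero.ge
  · exact (hh.deriv_pos t ht).le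

theorem IsYoung.integral_rderiv {h : ℝ → ℝ} (hh : IsYoung h) {t : ℝ} (ht : 0 ≤ t) :
    ∫ s in (0 : ℝ)..t, rderiv h s = h t := by
  have h1 : ∫ s in (0 : ℝ)..t, rderiv h s = h t - h 0 := by
    refine intervalIntegral.integral_eq_sub_of_hasDeriv_right_of_le ht
      (hh.differentiableOn.continuousOn.mono Icc_subset_Ici_self) (fun s hs => ?_)
      (MonotoneOn.intervalIntegrable (hh.deriv_mono.mono ?_))
    · have := (hh.differentiableOn s hs.1.le).hasDerivWithinAt
      exact this.mono fun x hx => hs.1.le.trans (le_of_lt hx)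
    · rw [uIcc_of_le ht]
      exact Icc_subset_Ici_self
  rw [h1, hh.map_zero, sub_zero]

theorem IsYoung.le_mul_rderiv {h : ℝ → ℝ} (hh : IsYoung h) {t : ℝ}
    (ht : 0 ≤ t) : h t ≤ t * rderiv h t := by
  have := intervalIntegral.integral_mono_on ht (f := rderiv h) (μ := volume)
    (MonotoneOn.intervalIntegrable (hh.deriv_mono.mono
      (by rw [uIcc_of_le ht]; exact Icc_subset_Ici_self)))
    (g := fun _ => rderiv h t) intervalIntegrable_const
    fun s hs => hh.deriv_mono hs.1 (show 0 ≤ t from ht) hs.2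
  rw [hh.integral_rderiv ht] at this
  simpa using this

theorem IsRegularYoung.hasDerivAt_deriv {h : ℝ → ℝ} (hh : IsRegularYoung h) {t : ℝ} (ht : 0 < t) :
    HasDerivAt (deriv h) (deriv (deriv h) t) t := by
  have hC1 : ContDiffOn ℝ 1 (deriv h) (Ioi 0) :=
    ((contDiffOn_succ_iff_deriv_of_isOpen (n := 1) isOpen_Ioi).1
      (by simpa [one_add_one_eq_two] using hh.contDiffOn_two)).2.2
  exact ((hC1.differentiableOn one_ne_zero).differentiableAt (Ioi_mem_nhds ht)).hasDerivAt

/-- The derivative of a Young function is bounded by a power under dilations: the consequence of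
`h'' ≤ q h'/t`, which says that `t ^ (-q) * h'(t)` is non-increasing. -/
theorem IsRegularYoung.rderiv_mul_le {h : ℝ → ℝ} {p q : ℝ} (hh : IsRegularYoung h)
    (hd : DerivComparable p q h) {l t : ℝ} (hl : 1 ≤ l) (ht : 0 ≤ t) :
    rderiv h (l * t) ≤ l ^ q * rderiv h t := by
  rcases ht.eq_or_lt with rfl | ht
  · simp [hh.deriv_zero]
  have hl0 : 0 < l := by linarith
  rw [rderiv_eq_deriv ht, rderiv_eq_deriv (mul_pos hl0 ht)]
  have hF : ∀ s : ℝ, 0 < s → HasDerivAt (fun s => s ^ (-q) * deriv h s)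
      ((-q) * s ^ (-q - 1) * deriv h s + s ^ (-q) * deriv (deriv h) s) s := fun s hs =>
    (Real.hasDerivAt_rpow_const (Or.inl hs.ne')).mul (hh.hasDerivAt_deriv hs)
  have hanti : AntitoneOn (fun s => s ^ (-q) * deriv h s) (Ioi 0) := by
    apply antitoneOn_of_deriv_nonpos (convex_Ioi 0)
    · exact fun s hs => (hF s hs).continuousAt.continuousWithinAt
    · rw [interior_Ioi]
      exact fun s hs => (hF s hs).differentiableAt.differentiableWithinAt
    · rw [interior_Ioi]
      intro s hs
      have hs : 0 < s := hs
      rw [(hF s hs).deriv, Real.rpow_sub_one hs.ne']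
      have h1 := (hd s hs).2
      have h2 : 0 < s ^ (-q) := Real.rpow_pos_of_pos hs _
      have h3 := mul_le_mul_of_nonneg_left h1 h2.le
      have h4 : s ^ (-q) * (q * (deriv h s / s)) = q * (s ^ (-q) / s) * deriv h s := by ring
      linarith
  have h1 := hanti (show t ∈ Ioi 0 from ht) (show l * t ∈ Ioi 0 from mul_pos hl0 ht)
    (by nlinarith : t ≤ l * t)
  simp only at h1
  rw [Real.mul_rpow hl0.le ht.le, Real.rpow_neg hl0.le, Real.rpow_neg ht.le] at h1
  have h2 : 0 < t ^ q := Real.rpow_pos_of_pos ht _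
  have h3 : 0 < l ^ q := Real.rpow_pos_of_pos hl0 _
  field_simp at h1
  linarith

variable {h : ℝ → ℝ} {a p q : ℝ}

theorem shiftDeriv_zero : shiftDeriv h a 0 = 0 := by simp [shiftDeriv]

theorem IsYoung.shiftDeriv_nonneg (hh : IsYoung h) (ha : 0 < a) {t : ℝ} (ht : 0 ≤ t) :
    0 ≤ shiftDeriv h a t :=
  mul_nonneg (hh.rderiv_nonneg (by linarith)) (by positivity)

theorem IsYoung.shiftDeriv_le_rderiv (hh : IsYoung h) (ha : 0 < a) {t : ℝ} (ht : 0 ≤ t) :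
    shiftDeriv h a t ≤ rderiv h (a + t) :=
  mul_le_of_le_one_right (hh.rderiv_nonneg (by linarith)) ((div_le_one (by linarith)).2 (by linarith))

theorem IsYoung.shiftDeriv_strictMono (hh : IsYoung h) (ha : 0 < a) :
    StrictMonoOn (shiftDeriv h a) (Ici 0) := by
  intro s hs t ht hst
  have hs : 0 ≤ s := hs
  have h1 : rderiv h (a + s) ≤ rderiv h (a + t) :=
    hh.deriv_mono (show 0 ≤ a + s by linarith) (show 0 ≤ a + t by linarith) (by linarith)
  have h2 : s / (a + s) < t / (a + t) := by
    rw [div_lt_div_iff₀ (by linarith) (by linarith)]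
    nlinarith
  exact mul_lt_mul' h1 h2 (by positivity) (hh.deriv_pos _ (by linarith))

theorem IsRegularYoung.shiftDeriv_continuousOn (hh : IsRegularYoung h) (ha : 0 < a) :
    ContinuousOn (shiftDeriv h a) (Ici 0) := by
  have h1 : ContinuousOn (fun t => rderiv h (a + t)) (Ici 0) :=
    hh.deriv_continuousOn.comp (by fun_prop) fun t ht => by
      have : 0 ≤ t := ht
      show 0 ≤ a + t
      linarith
  refine h1.mul (ContinuousOn.div (by fun_prop) (by fun_prop) fun t ht => ?_)
  have : 0 ≤ t := ht
  linarith

/-- `h_a'(t) ≥ h'(a) t / (a + t)`. -/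
theorem IsYoung.le_shiftDeriv (hh : IsYoung h) (ha : 0 < a) {t : ℝ} (ht : 0 ≤ t) :
    rderiv h a * (t / (a + t)) ≤ shiftDeriv h a t :=
  mul_le_mul_of_nonneg_right
    (hh.deriv_mono (show 0 ≤ a from ha.le) (show 0 ≤ a + t by linarith) (by linarith)) (by positivity)

/-- Linear lower bound of `h_a'` near the origin. -/
theorem IsYoung.mul_le_shiftDeriv (hh : IsYoung h) (ha : 0 < a) {t T : ℝ} (ht : 0 ≤ t)
    (hT : t ≤ T) : rderiv h a / (a + T) * t ≤ shiftDeriv h a t := by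
  refine le_trans ?_ (hh.le_shiftDeriv ha ht)
  rw [div_mul_eq_mul_div, mul_div_assoc]
  have := hh.deriv_pos a ha
  gcongr

/-- Linear upper bound of `h_a'` near the origin. -/
theorem IsYoung.shiftDeriv_le_mul (hh : IsYoung h) (ha : 0 < a) {t T : ℝ} (ht : 0 ≤ t)
    (hT : t ≤ T) : shiftDeriv h a t ≤ rderiv h (a + T) / a * t := by
  rw [div_mul_eq_mul_div, mul_div_assoc]
  have h1 : rderiv h (a + t) ≤ rderiv h (a + T) :=
    hh.deriv_mono (show 0 ≤ a + t by linarith) (show 0 ≤ a + T by linarith) (by linarith)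
  unfold shiftDeriv
  have h2 := hh.rderiv_nonneg (t := a + T) (by linarith)
  gcongr
  linarith

theorem IsRegularYoung.shiftDeriv_mul_le (hh : IsRegularYoung h) (hd : DerivComparable p q h)
    (ha : 0 < a) {l t : ℝ} (hl : 1 ≤ l) (ht : 0 ≤ t) :
    shiftDeriv h a (l * t) ≤ l ^ (q + 1) * shiftDeriv h a t := by
  have hl0 : 0 < l := by linarith
  have h0 : a + l * t ≤ l * (a + t) := by nlinarith
  have h1 : rderiv h (a + l * t) ≤ l ^ q * rderiv h (a + t) :=
    (hh.deriv_mono (show 0 ≤ a + l * t by positivity) (show 0 ≤ l * (a + t) by positivity) h0).trans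
      (hh.rderiv_mul_le hd hl (by positivity))
  have h2 : l * t / (a + l * t) ≤ l * (t / (a + t)) := by
    rw [← mul_div_assoc]
    have : a + t ≤ a + l * t := by nlinarith
    gcongr
  calc shiftDeriv h a (l * t) ≤ (l ^ q * rderiv h (a + t)) * (l * (t / (a + t))) :=
        mul_le_mul h1 h2 (by positivity)
          (mul_nonneg (by positivity) (hh.rderiv_nonneg (by positivity)))
    _ = l ^ (q + 1) * shiftDeriv h a t := by
        rw [Real.rpow_add_one hl0.ne']; unfold shiftDeriv; ring

/-- Shifts by comparable amounts are comparable. -/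
theorem IsRegularYoung.shiftDeriv_le_shiftDeriv (hh : IsRegularYoung h)
    (hd : DerivComparable p q h) {m K b : ℝ} (hm : 0 < m) (ha : m ≤ a) (hb : m ≤ b)
    (haK : a ≤ K) (hbK : b ≤ K) {t : ℝ} (ht : 0 ≤ t) :
    shiftDeriv h b t ≤ (K / m) ^ (q + 1) * shiftDeriv h a t := by
  have ha0 : 0 < a := by linarith
  have hb0 : 0 < b := by linarith
  have hl : 1 ≤ K / m := (one_le_div hm).2 (by linarith)
  have hl0 : 0 < K / m := by linarith
  have e : K = K / m * m := by field_simp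
  have h0 : b + t ≤ K / m * (a + t) := by nlinarith
  have h0' : a + t ≤ K / m * (b + t) := by nlinarith
  have h1 : rderiv h (b + t) ≤ (K / m) ^ q * rderiv h (a + t) :=
    (hh.deriv_mono (show 0 ≤ b + t by positivity) (show 0 ≤ K / m * (a + t) by positivity) h0).trans
      (hh.rderiv_mul_le hd hl (by positivity))
  have h2 : t / (b + t) ≤ (K / m) * (t / (a + t)) := by
    rw [← mul_div_assoc, div_le_div_iff₀ (by positivity) (by positivity)]
    nlinarith
  calc shiftDeriv h b t ≤ ((K / m) ^ q * rderiv h (a + t)) * (K / m * (t / (a + t))) :=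
        mul_le_mul h1 h2 (by positivity)
          (mul_nonneg (by positivity) (hh.rderiv_nonneg (by positivity)))
    _ = (K / m) ^ (q + 1) * shiftDeriv h a t := by
        rw [Real.rpow_add_one hl0.ne']; unfold shiftDeriv; ring

/-- A convex non-decreasing function on `[0,∞)` vanishing at `0` and satisfying the
`Δ₂`-condition, in the form of a power bound under dilations. -/
structure IsModular (m : ℝ) (H : ℝ → ℝ) : Prop where
  map_zero : H 0 = 0
  convexOn : ConvexOn ℝ (Ici 0) H
  monotoneOn : MonotoneOn H (Ici 0)
  continuousOn : ContinuousOn H (Ici 0)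
  map_mul_le : ∀ l t, 1 ≤ l → 0 ≤ t → H (l * t) ≤ l ^ m * H t
  pos : ∀ t, 0 < t → 0 < H t

theorem isModular_id : IsModular 1 (fun t => t) where
  map_zero := rfl
  convexOn := convexOn_id (convex_Ici 0)
  monotoneOn := fun _ _ _ _ h => h
  continuousOn := continuousOn_id
  map_mul_le := fun l t _ _ => by simp
  pos := fun _ h => h

/-- The primitive of a non-decreasing function with a power bound is a modular. -/
theorem isModular_integral {g : ℝ → ℝ} {m : ℝ} (hc : ContinuousOn g (Ici 0))
    (hmono : MonotoneOn g (Ici 0)) (hpos : ∀ t, 0 < t → 0 < g t)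
    (hmul : ∀ l t, 1 ≤ l → 0 ≤ t → g (l * t) ≤ l ^ m * g t) :
    IsModular (m + 1) (fun t => ∫ s in (0 : ℝ)..t, g s) := by
  set G : ℝ → ℝ := fun t => g (max t 0)
  have hG : Continuous G := hc.comp_continuous (by fun_prop) fun t => show 0 ≤ max t 0 from le_max_right _ _
  have hGg : ∀ t, 0 ≤ t → G t = g t := fun t ht => by simp [G, ht]
  have heq : ∀ t, 0 ≤ t → ∫ s in (0 : ℝ)..t, g s = ∫ s in (0 : ℝ)..t, G s := fun t ht =>
    intervalIntegral.integral_congr fun s hs => by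
      rw [uIcc_of_le ht] at hs
      exact (hGg s hs.1).symm
  have hder : ∀ t, HasDerivAt (fun t => ∫ s in (0 : ℝ)..t, G s) (G t) t := fun t =>
    hG.integral_hasStrictDerivAt 0 t |>.hasDerivAt
  have hcont : ContinuousOn (fun t => ∫ s in (0 : ℝ)..t, g s) (Ici 0) :=
    ContinuousOn.congr (f := fun t => ∫ s in (0 : ℝ)..t, G s)
      (fun t _ => (hder t).continuousAt.continuousWithinAt) fun t ht => heq t ht
  have hder' : ∀ t, 0 < t → HasDerivAt (fun t => ∫ s in (0 : ℝ)..t, g s) (g t) t := fun t ht => by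
    rw [← hGg t ht.le]
    refine (hder t).congr_of_eventuallyEq ?_
    filter_upwards [Ioi_mem_nhds ht] with s hs using heq s (le_of_lt hs)
  have hdiff : DifferentiableOn ℝ (fun t => ∫ s in (0 : ℝ)..t, g s) (interior (Ici 0)) := by
    rw [interior_Ici]
    exact fun t ht => (hder' t ht).differentiableAt.differentiableWithinAt
  have hint : ∀ t, 0 ≤ t → IntervalIntegrable g volume 0 t := fun t ht =>
    ContinuousOn.intervalIntegrable (hc.mono (by rw [uIcc_of_le ht]; exact Icc_subset_Ici_self))
  refine ⟨by simp, ?_, ?_, hcont, ?_, ?_⟩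
  · refine MonotoneOn.convexOn_of_deriv (convex_Ici 0) hcont hdiff ?_
    rw [interior_Ici]
    intro s hs t ht hst
    rw [(hder' s hs).deriv, (hder' t ht).deriv]
    exact hmono (Ioi_subset_Ici_self hs) (Ioi_subset_Ici_self ht) hst
  · refine monotoneOn_of_deriv_nonneg (convex_Ici 0) hcont hdiff ?_
    rw [interior_Ici]
    intro t ht
    rw [(hder' t ht).deriv]
    exact (hpos t ht).le
  · intro l t hl ht
    have hl0 : 0 < l := by linarith
    have h1 : ∫ s in (0 : ℝ)..(l * t), g s = l * ∫ s in (0 : ℝ)..t, g (l * s) := by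
      rw [intervalIntegral.integral_comp_mul_left _ hl0.ne', mul_zero, smul_eq_mul,
        mul_inv_cancel_left₀ hl0.ne']
    have hcl : ContinuousOn (fun s => g (l * s)) (uIcc 0 t) := by
      rw [uIcc_of_le ht]
      exact hc.comp (by fun_prop) fun s hs => mul_nonneg hl0.le hs.1
    have h2 : ∫ s in (0 : ℝ)..t, g (l * s) ≤ ∫ s in (0 : ℝ)..t, l ^ m * g s :=
      intervalIntegral.integral_mono_on ht hcl.intervalIntegrable ((hint t ht).const_mul _)
        fun s hs => hmul l s hl hs.1
    rw [h1]
    rw [intervalIntegral.integral_const_mul] at h2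
    calc _ ≤ l * (l ^ m * ∫ s in (0 : ℝ)..t, g s) := by gcongr
      _ = _ := by rw [Real.rpow_add_one hl0.ne']; ring
  · intro t ht
    exact intervalIntegral.intervalIntegral_pos_of_pos_on (hint t ht.le) (fun s hs => hpos s hs.1) ht

theorem IsRegularYoung.isModular_shift (hh : IsRegularYoung h) (hd : DerivComparable p q h)
    (ha : 0 < a) : IsModular (q + 2) (shift h a) := by
  have := isModular_integral (hh.shiftDeriv_continuousOn ha)
    (hh.toIsYoung.shiftDeriv_strictMono ha).monotoneOn
    (fun t ht => shiftDeriv_zero.symm.le.trans_lt (hh.toIsYoung.shiftDeriv_strictMono ha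
      self_mem_Ici (show 0 ≤ t from ht.le) ht)) (fun l t hl ht => hh.shiftDeriv_mul_le hd ha hl ht)
  rw [show q + 2 = q + 1 + 1 by ring]
  exact this

theorem IsRegularYoung.isModular (hh : IsRegularYoung h) (hd : DerivComparable p q h) :
    IsModular (q + 1) h := by
  have H := isModular_integral hh.deriv_continuousOn hh.deriv_mono hh.deriv_pos
    (fun l t hl ht => hh.rderiv_mul_le hd hl ht)
  have e : ∀ t, 0 ≤ t → ∫ s in (0 : ℝ)..t, rderiv h s = h t := fun t ht => hh.integral_rderiv ht
  refine ⟨hh.map_zero, H.convexOn.congr fun t ht => e t ht,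
    H.monotoneOn.congr fun t ht => e t ht, H.continuousOn.congr fun t ht => (e t ht).symm,
    fun l t hl ht => ?_, fun t ht => ?_⟩
  · rw [← e t ht, ← e (l * t) (by positivity)]
    exact H.map_mul_le l t hl ht
  · rw [← e t ht.le]
    exact H.pos t ht

variable {m : ℝ} {H : ℝ → ℝ}

theorem IsModular.nonneg (hH : IsModular m H) {t : ℝ} (ht : 0 ≤ t) : 0 ≤ H t := by
  rw [← hH.map_zero]
  exact hH.monotoneOn self_mem_Ici (show 0 ≤ t from ht) ht

/-- The quasi-triangle inequality of a modular. -/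
theorem IsModular.map_add_le (hH : IsModular m H) {s t : ℝ} (hs : 0 ≤ s) (ht : 0 ≤ t) :
    H (s + t) ≤ 2 ^ m * (H s + H t) := by
  rcases le_total s t with hst | hst
  · have h1 : H (s + t) ≤ H (2 * t) :=
      hH.monotoneOn (show 0 ≤ s + t by positivity) (show 0 ≤ 2 * t by positivity) (by linarith)
    have h2 := hH.map_mul_le 2 t one_le_two ht
    have h3 := hH.nonneg hs
    have : (0:ℝ) ≤ 2 ^ m * H s := by positivity
    linarith
  · have h1 : H (s + t) ≤ H (2 * s) :=
      hH.monotoneOn (show 0 ≤ s + t by positivity) (show 0 ≤ 2 * s by positivity) (by linarith)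
    have h2 := hH.map_mul_le 2 s one_le_two hs
    have h3 := hH.nonneg ht
    have : (0:ℝ) ≤ 2 ^ m * H t := by positivity
    linarith

/-- A modular grows at least linearly. -/
theorem IsModular.le_mul (hH : IsModular m H) {t : ℝ} (ht : 0 ≤ t) : t ≤ 1 + (H 1)⁻¹ * H t := by
  have hp := hH.pos 1 one_pos
  rcases le_total t 1 with h | h
  · have := hH.nonneg ht
    have : 0 ≤ (H 1)⁻¹ * H t := by positivity
    linarith
  · have ht0 : 0 < t := by linarith
    have h1 := hH.convexOn.2 (self_mem_Ici : (0:ℝ) ∈ Ici 0) (show t ∈ Ici 0 from ht)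
      (show 0 ≤ 1 - t⁻¹ by rw [sub_nonneg]; exact inv_le_one_of_one_le₀ h)
      (show 0 ≤ t⁻¹ by positivity) (by ring)
    simp only [smul_eq_mul, mul_zero, zero_add, hH.map_zero, inv_mul_cancel₀ ht0.ne'] at h1
    have h2 : t ≤ (H 1)⁻¹ * H t := by
      rw [le_inv_mul_iff₀ hp]
      have := mul_le_mul_of_nonneg_left h1 ht
      rw [mul_inv_cancel_left₀ ht0.ne'] at this
      linarith
    linarith

/-- A modular composed with the norm is continuous. -/
theorem IsModular.continuous_norm (hH : IsModular m H) {E : Type*} [NormedAddCommGroup E] :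
    Continuous fun x : E => H ‖x‖ :=
  hH.continuousOn.comp_continuous _root_.continuous_norm fun x => norm_nonneg x

theorem IsRegularYoung.intervalIntegrable_shiftDeriv (hh : IsRegularYoung h) (ha : 0 < a) {t : ℝ}
    (ht : 0 ≤ t) : IntervalIntegrable (shiftDeriv h a) volume 0 t :=
  ContinuousOn.intervalIntegrable ((hh.shiftDeriv_continuousOn ha).mono
    (by rw [uIcc_of_le ht]; exact Icc_subset_Ici_self))

theorem IsRegularYoung.shift_le_shift (hh : IsRegularYoung h)
    (hd : DerivComparable p q h) {k K b : ℝ} (hk : 0 < k) (ha : k ≤ a) (hb : k ≤ b)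
    (haK : a ≤ K) (hbK : b ≤ K) {t : ℝ} (ht : 0 ≤ t) :
    shift h b t ≤ (K / k) ^ (q + 1) * shift h a t := by
  unfold shift
  rw [← intervalIntegral.integral_const_mul]
  exact intervalIntegral.integral_mono_on ht
    (hh.intervalIntegrable_shiftDeriv (hk.trans_le hb) ht)
    ((hh.intervalIntegrable_shiftDeriv (hk.trans_le ha) ht).const_mul _)
    fun s hs => hh.shiftDeriv_le_shiftDeriv hd hk ha hb haK hbK hs.1

theorem IsRegularYoung.sq_le_shift (hh : IsRegularYoung h) (ha : 0 < a) {t T : ℝ} (ht : 0 ≤ t)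
    (hT : t ≤ T) : rderiv h a / (a + T) * (t ^ 2 / 2) ≤ shift h a t := by
  have := intervalIntegral.integral_mono_on ht
    (f := fun s => rderiv h a / (a + T) * s) (Continuous.intervalIntegrable (by fun_prop) _ _)
    (hh.intervalIntegrable_shiftDeriv ha ht)
    fun s hs => hh.toIsYoung.mul_le_shiftDeriv ha hs.1 (hs.2.trans hT)
  rw [intervalIntegral.integral_const_mul, integral_id] at this
  simpa [shift] using this

/-- `h_a ≤ h (a + ·)`. -/
theorem IsRegularYoung.shift_le (hh : IsRegularYoung h) (ha : 0 < a) {t : ℝ}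
    (ht : 0 ≤ t) : shift h a t ≤ h (a + t) := by
  have hi : ∀ s r : ℝ, 0 ≤ s → 0 ≤ r → IntervalIntegrable (rderiv h) volume s r :=
    fun s r hs hr => ContinuousOn.intervalIntegrable (hh.deriv_continuousOn.mono
      fun x hx => (le_inf hs hr).trans hx.1)
  have h1 : shift h a t ≤ ∫ s in (0:ℝ)..t, rderiv h (a + s) := by
    refine intervalIntegral.integral_mono_on ht (hh.intervalIntegrable_shiftDeriv ha ht)
      ?_ fun s hs => hh.toIsYoung.shiftDeriv_le_rderiv ha hs.1
    exact ContinuousOn.intervalIntegrable (hh.deriv_continuousOn.comp (by fun_prop) fun x hx => by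
      rw [uIcc_of_le ht] at hx
      exact add_nonneg ha.le hx.1)
  rw [intervalIntegral.integral_comp_add_left, add_zero,
    ← intervalIntegral.integral_interval_sub_left (hi 0 _ le_rfl (by positivity))
      (hi 0 _ le_rfl ha.le), hh.integral_rderiv (by positivity), hh.integral_rderiv ha.le] at h1
  have : 0 ≤ h a := by
    rw [← hh.integral_rderiv ha.le]
    exact intervalIntegral.integral_nonneg ha.le fun s hs => hh.toIsYoung.rderiv_nonneg hs.1
  linarith

end Young

/-! ### Young's inequality and the range of anisotropy -/

section Complementary

theorem IsYoung.exists_rderiv_gt {h : ℝ → ℝ} (hh : IsYoung h) (t : ℝ) :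
    ∃ S, 0 < S ∧ ∀ s, S ≤ s → t < rderiv h s := by
  obtain ⟨S, hS⟩ := eventually_atTop.1 (hh.deriv_tendsto.eventually_gt_atTop t)
  exact ⟨max S 1, by positivity, fun s hs => hS s ((le_max_left _ _).trans hs)⟩

theorem IsYoung.bddAbove_genInv {h : ℝ → ℝ} (hh : IsYoung h) (t : ℝ) :
    BddAbove {s : ℝ | 0 ≤ s ∧ rderiv h s ≤ t} := by
  obtain ⟨S, -, hS⟩ := hh.exists_rderiv_gt t
  refine ⟨S, fun s hs => ?_⟩
  by_contra! h
  exact absurd hs.2 (not_le.2 (hS s h.le))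

theorem IsYoung.genInv_monotoneOn {h : ℝ → ℝ} (hh : IsYoung h) :
    MonotoneOn (genInv (rderiv h)) (Ici 0) := fun _ hs t _ hst =>
  csSup_le_csSup (hh.bddAbove_genInv t) ⟨0, le_rfl, hh.deriv_zero.le.trans hs⟩
    fun _ hx => ⟨hx.1, hx.2.trans hst⟩

theorem IsYoung.genInv_nonneg {h : ℝ → ℝ} (hh : IsYoung h) {t : ℝ} (ht : 0 ≤ t) :
    0 ≤ genInv (rderiv h) t :=
  le_csSup (hh.bddAbove_genInv t) ⟨le_rfl, hh.deriv_zero.le.trans ht⟩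

/-- Young's inequality: the rectangle `(0,s) × (0,t)` is covered by the region below the graph of
`h'` and the region to the left of the graph of its generalized inverse. -/
theorem IsYoung.mul_le_add_complementary {h : ℝ → ℝ} (hh : IsYoung h) {s t : ℝ} (hs : 0 ≤ s)
    (ht : 0 ≤ t) : s * t ≤ h s + complementary h t := by
  suffices H : ∀ ε : ℝ, 0 < ε → s * t ≤ h s + complementary h t + ε * t by
    have hlim : Tendsto (fun ε : ℝ => h s + complementary h t + ε * t) (𝓝[>] 0)
        (𝓝 (h s + complementary h t + 0 * t)) :=
      tendsto_nhdsWithin_of_tendsto_nhds (Continuous.tendsto (by fun_prop) _)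
    rw [zero_mul, add_zero] at hlim
    exact ge_of_tendsto hlim (eventually_nhdsWithin_of_forall H)
  intro ε hε
  set g := rderiv h
  set G := genInv (rderiv h)
  have hig : IntegrableOn g (Ioo 0 s) :=
    ((intervalIntegrable_iff_integrableOn_Ioo_of_le hs).1
      (MonotoneOn.intervalIntegrable (hh.deriv_mono.mono
        (by rw [uIcc_of_le hs]; exact Icc_subset_Ici_self))))
  have hiG : IntegrableOn G (Ioo 0 t) :=
    ((intervalIntegrable_iff_integrableOn_Ioo_of_le ht).1
      (MonotoneOn.intervalIntegrable (hh.genInv_monotoneOn.mono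
        (by rw [uIcc_of_le ht]; exact Icc_subset_Ici_self))))
  have hiε : IntegrableOn (fun _ => ε) (Ioo 0 t) := integrableOn_const (by simp)
  have hA := volume_regionBetween_eq_integral (f := fun _ => (0:ℝ)) (μ := volume)
    integrableOn_zero hig measurableSet_Ioo fun x hx => hh.rderiv_nonneg hx.1.le
  have hB := volume_regionBetween_eq_integral (f := fun _ => (0:ℝ)) (g := fun y => G y + ε)
    (μ := volume) integrableOn_zero (hiG.add hiε) measurableSet_Ioo
    fun x hx => add_nonneg (hh.genInv_nonneg hx.1.le) hε.le
  have hsub : Ioo 0 s ×ˢ Ioo 0 t ⊆ regionBetween (fun _ => (0:ℝ)) g (Ioo 0 s) ∪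
      (MeasurableEquiv.prodComm ⁻¹' regionBetween (fun _ => (0:ℝ)) (fun y => G y + ε) (Ioo 0 t)) := by
    rintro ⟨x, y⟩ ⟨hx, hy⟩
    by_cases hxy : y < g x
    · exact Or.inl ⟨hx, hy.1, hxy⟩
    · refine Or.inr ⟨hy, hx.1, ?_⟩
      have : x ≤ G y := le_csSup (hh.bddAbove_genInv y) ⟨hx.1.le, not_lt.1 hxy⟩
      show x < G y + ε
      linarith
  have hvol := (measure_mono hsub).trans (measure_union_le (μ := (volume : Measure ℝ).prod volume) _ _)
  have hsw : MeasurePreserving (MeasurableEquiv.prodComm : ℝ × ℝ ≃ᵐ ℝ × ℝ)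
    ((volume : Measure ℝ).prod volume) ((volume : Measure ℝ).prod volume) :=
    Measure.measurePreserving_swap
  rw [hsw.measure_preimage_equiv, hA, hB, Measure.prod_prod, Real.volume_Ioo, Real.volume_Ioo,
    sub_zero, sub_zero, ← ENNReal.ofReal_mul hs, ← ENNReal.ofReal_add] at hvol
  · have e1 : ∫ y in Ioo 0 s, (g - (fun _ : ℝ => (0:ℝ)) : ℝ → ℝ) y = h s := by
      rw [← hh.integral_rderiv hs, intervalIntegral.integral_of_le hs, integral_Ioc_eq_integral_Ioo]
      simp [g]
    have e2 : ∫ y in Ioo 0 t, ((fun y => G y + ε) - (fun _ : ℝ => (0:ℝ)) : ℝ → ℝ) y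
        = complementary h t + ε * t := by
      simp only [Pi.sub_apply, sub_zero]
      rw [integral_add hiG hiε]
      congr 1
      · rw [complementary, intervalIntegral.integral_of_le ht, integral_Ioc_eq_integral_Ioo]
      · simp [ht, mul_comm]
    rw [e1, e2] at hvol
    have hs0 : 0 ≤ h s := by
      rw [← hh.integral_rderiv hs]
      exact intervalIntegral.integral_nonneg hs fun x hx => hh.rderiv_nonneg hx.1
    have ht0 : 0 ≤ complementary h t :=
      intervalIntegral.integral_nonneg ht fun x hx => hh.genInv_nonneg hx.1
    have := (ENNReal.ofReal_le_ofReal_iff (by positivity)).1 hvol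
    linarith
  · exact setIntegral_nonneg measurableSet_Ioo fun x hx => by
      simpa using hh.rderiv_nonneg hx.1.le
  · exact setIntegral_nonneg measurableSet_Ioo fun x hx => by
      simpa using add_nonneg (hh.genInv_nonneg hx.1.le) hε.le

variable {φ ψ : ℝ → ℝ} {a p q β : ℝ}

theorem IsYoung.genInv_shiftDeriv (hψ : IsYoung ψ) (ha : 0 < a) {s : ℝ} (hs : 0 ≤ s) :
    genInv (shiftDeriv ψ a) (shiftDeriv ψ a s) = s := by
  have : {r : ℝ | 0 ≤ r ∧ shiftDeriv ψ a r ≤ shiftDeriv ψ a s} = Icc 0 s := by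
    ext r
    refine ⟨fun hr => ⟨hr.1, ?_⟩, fun hr => ⟨hr.1, ?_⟩⟩
    · exact ((hψ.shiftDeriv_strictMono ha).le_iff_le hr.1 hs).1 hr.2
    · exact ((hψ.shiftDeriv_strictMono ha).le_iff_le hr.1 hs).2 hr.2
  rw [genInv, this, csSup_Icc hs]

theorem IsRegularYoung.exists_shiftDeriv_eq (hψ : IsRegularYoung ψ) (ha : 0 < a) {σ : ℝ}
    (hσ : 0 ≤ σ) : ∃ s, 0 ≤ s ∧ shiftDeriv ψ a s = σ := by
  obtain ⟨T, hT0, hT⟩ := hψ.toIsYoung.exists_rderiv_gt (2 * σ)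
  set t := max T a
  have ht : 0 ≤ t := hT0.le.trans (le_max_left _ _)
  have hta : a ≤ t := le_max_right _ _
  have h1 : 2 * σ < rderiv ψ (a + t) := hT _ (by linarith [le_max_left T a])
  have h2 : 1 ≤ 2 * (t / (a + t)) := by
    rw [← mul_div_assoc, one_le_div (by positivity)]
    linarith
  have h3 : σ ≤ shiftDeriv ψ a t := by
    unfold shiftDeriv
    nlinarith
  obtain ⟨s, hs, hse⟩ := intermediate_value_Icc ht
    ((hψ.shiftDeriv_continuousOn ha).mono Icc_subset_Ici_self)
    (show σ ∈ Icc (shiftDeriv ψ a 0) (shiftDeriv ψ a t) from ⟨by rwa [shiftDeriv_zero], h3⟩)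
  exact ⟨s, hs.1, hse⟩

/-- The pairing `ψ_a'(s) t` is controlled by `φ_a(s)` and by `φ_a(t) + φ_a(t)^β`. For large `t` this
is Young's inequality for `N_a` and the hypothesis on `N_a*`; for bounded `t` the function `N_a*` is
quadratic, like `φ_a`. -/
theorem exists_shiftDeriv_mul_le (hφ : IsRegularYoung φ) (hψ : IsRegularYoung ψ) (ha : 0 < a)
    (hN : IsYoung (anisotropyFun φ ψ a))
    (hc : ∃ c : ℝ, ∀ᶠ t in atTop,
      complementary (anisotropyFun φ ψ a) t ≤ c * shift φ a t ^ β) :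
    ∃ C, 0 < C ∧ ∀ s t, 0 ≤ s → 0 ≤ t →
      shiftDeriv ψ a s * t ≤ shift φ a s + C * (shift φ a t + shift φ a t ^ β) := by
  obtain ⟨c, hc⟩ := hc
  obtain ⟨T₀, hT₀⟩ := eventually_atTop.1 hc
  set N := anisotropyFun φ ψ a with hNdef
  have hNψ : ∀ s, 0 ≤ s → N (shiftDeriv ψ a s) = shift φ a s := fun s hs => by
    rw [hNdef, anisotropyFun, hψ.toIsYoung.genInv_shiftDeriv ha hs]
  set T := max T₀ 1
  have hT : 0 < T := by positivity
  have hφnn : ∀ t, 0 ≤ t → 0 ≤ shift φ a t := fun t ht =>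
    intervalIntegral.integral_nonneg ht fun s hs => hφ.toIsYoung.shiftDeriv_nonneg ha hs.1
  -- `N_a'(σ) ≤ T` confines `σ = ψ_a'(s)`, hence `s`, to a bounded interval
  obtain ⟨S, hS0, hS⟩ := hN.exists_rderiv_gt T
  obtain ⟨s₁, hs₁, hs₁S⟩ := hψ.exists_shiftDeriv_eq ha hS0.le
  set A := rderiv φ a / (a + s₁) / 2 with hA
  set B := rderiv ψ (a + s₁) / a with hB
  have hA0 : 0 < A := by have := hφ.deriv_pos a ha; positivity
  have hB0 : 0 < B := by have := hψ.deriv_pos (a + s₁) (by positivity); positivity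
  have hG : ∀ t, 0 ≤ t → t ≤ T → genInv (rderiv N) t ≤ B * (B / A) * t := by
    intro t ht htT
    refine csSup_le ⟨0, le_rfl, hN.deriv_zero.le.trans ht⟩ fun σ hσ => ?_
    obtain ⟨s, hs, rfl⟩ := hψ.exists_shiftDeriv_eq ha hσ.1
    have hss : s ≤ s₁ := by
      by_contra! hlt
      have h1 := (hψ.toIsYoung.shiftDeriv_strictMono ha).monotoneOn hs₁ hs hlt.le
      rw [hs₁S] at h1
      exact absurd (hσ.2.trans htT) (not_le.2 (hS _ h1))
    have h1 : A * s ^ 2 ≤ shift φ a s := by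
      have := hφ.sq_le_shift ha hs hss
      rw [hA]; linarith
    have h2 : shiftDeriv ψ a s ≤ B * s := hψ.toIsYoung.shiftDeriv_le_mul ha hs hss
    have h3 : shift φ a s ≤ shiftDeriv ψ a s * t := by
      rw [← hNψ s hs]
      exact (hN.le_mul_rderiv hσ.1).trans (mul_le_mul_of_nonneg_left hσ.2 hσ.1)
    have h4 : A * s ≤ B * t := by
      rcases hs.eq_or_lt with rfl | hs'
      · simp; positivity
      · have : A * s * s ≤ B * t * s := by nlinarith [mul_le_mul_of_nonneg_right h2 ht]
        exact le_of_mul_le_mul_right this hs'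
    calc shiftDeriv ψ a s ≤ B * s := h2
      _ ≤ B * (B / A * t) := by
        gcongr
        rw [div_mul_eq_mul_div, le_div_iff₀ hA0]; linarith
      _ = _ := by ring
  have hsmall : ∀ t, 0 ≤ t → t ≤ T → complementary N t ≤ B * (B / A) * t ^ 2 := by
    intro t ht htT
    have := intervalIntegral.integral_mono_on ht (f := genInv (rderiv N)) (μ := volume)
      (MonotoneOn.intervalIntegrable (hN.genInv_monotoneOn.mono
        (by rw [uIcc_of_le ht]; exact Icc_subset_Ici_self)))
      (g := fun _ => B * (B / A) * t) intervalIntegrable_const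
      fun s hs => (hG s hs.1 (hs.2.trans htT)).trans
        (mul_le_mul_of_nonneg_left hs.2 (by positivity))
    rw [complementary]
    refine this.trans ?_
    rw [intervalIntegral.integral_const, smul_eq_mul]
    exact (by ring : (t - 0) * (B * (B / A) * t) = B * (B / A) * t ^ 2).le
  set E := rderiv φ a / (a + T) / 2
  have hE0 : 0 < E := by have := hφ.deriv_pos a ha; positivity
  refine ⟨B * (B / A) / E + |c|, by positivity, fun s t hs ht => ?_⟩
  have hY : shiftDeriv ψ a s * t ≤ shift φ a s + complementary N t := by
    rw [← hNψ s hs]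
    exact hN.mul_le_add_complementary (hψ.toIsYoung.shiftDeriv_nonneg ha hs) ht
  refine hY.trans (add_le_add_right ?_ _)
  have h1 := hφnn t ht
  have h2 : 0 ≤ shift φ a t ^ β := by positivity
  rcases le_total t T with htT | htT
  · have h3 : E * t ^ 2 ≤ shift φ a t := by
      have := hφ.sq_le_shift ha ht htT
      simp only [E]; linarith
    have h4 : B * (B / A) * t ^ 2 ≤ B * (B / A) / E * shift φ a t := by
      calc B * (B / A) * t ^ 2 = B * (B / A) / E * (E * t ^ 2) := by field_simp
        _ ≤ _ := by gcongr
    have h5 := hsmall t ht htT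
    have h6 : 0 ≤ B * (B / A) / E * shift φ a t ^ β := by positivity
    have h7 : 0 ≤ |c| * (shift φ a t + shift φ a t ^ β) := by positivity
    linarith
  · have h3 := hT₀ t ((le_max_left _ _).trans htT)
    have h4 : c * shift φ a t ^ β ≤ |c| * shift φ a t ^ β :=
      mul_le_mul_of_nonneg_right (le_abs_self c) h2
    have h6 : 0 ≤ B * (B / A) / E * (shift φ a t + shift φ a t ^ β) := by positivity
    have h7 : 0 ≤ |c| * shift φ a t := by positivity
    linarith

end Complementary

/-! ### Jensen's inequality and mollification in Orlicz classes -/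

section Mollify

variable {m : ℝ} {H : ℝ → ℝ} {E : Type*} [NormedAddCommGroup E]

theorem IsModular.integrable_of_integrable_comp (hH : IsModular m H) {α : Type*}
    [MeasurableSpace α] {μ : Measure α} [IsFiniteMeasure μ] {f : α → E}
    (hf : AEStronglyMeasurable f μ) (hi : Integrable (fun x => H ‖f x‖) μ) : Integrable f μ :=
  Integrable.mono' ((integrable_const (1:ℝ)).add (hi.const_mul (H 1)⁻¹)) hf
    (Eventually.of_forall fun _ => hH.le_mul (norm_nonneg _))

theorem IsModular.integrable_of_lintegral (hH : IsModular m H) {α : Type*}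
    [MeasurableSpace α] {μ : Measure α} {f : α → E}
    (hf : AEStronglyMeasurable f μ) (hi : ∫⁻ x, ENNReal.ofReal (H ‖f x‖) ∂μ ≠ ⊤) :
    Integrable (fun x => H ‖f x‖) μ :=
  (lintegral_ofReal_ne_top_iff_integrable (hH.continuous_norm.comp_aestronglyMeasurable hf)
    (Eventually.of_forall fun _ => hH.nonneg (norm_nonneg _))).1 hi

variable [NormedSpace ℝ E]

theorem IsModular.convexOn_norm (hH : IsModular m H) :
    ConvexOn ℝ univ (fun x : E => H ‖x‖) := by
  refine ⟨convex_univ, fun x _ y _ a b ha hb hab => ?_⟩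
  refine le_trans (hH.monotoneOn (norm_nonneg _)
    (show 0 ≤ a * ‖x‖ + b * ‖y‖ by positivity) ?_)
    (hH.convexOn.2 (norm_nonneg x) (norm_nonneg y) ha hb hab)
  refine (norm_add_le _ _).trans_eq ?_
  rw [norm_smul, norm_smul, Real.norm_of_nonneg ha, Real.norm_of_nonneg hb]

/-- Jensen's inequality for a modular, with values in `[0,∞]`. -/
theorem IsModular.ofReal_norm_integral_le (hH : IsModular m H) [CompleteSpace E] {α : Type*}
    [MeasurableSpace α] {μ : Measure α} [IsProbabilityMeasure μ] {f : α → E}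
    (hf : AEStronglyMeasurable f μ) :
    ENNReal.ofReal (H ‖∫ x, f x ∂μ‖) ≤ ∫⁻ x, ENNReal.ofReal (H ‖f x‖) ∂μ := by
  by_cases hi : ∫⁻ x, ENNReal.ofReal (H ‖f x‖) ∂μ = ⊤
  · rw [hi]; exact le_top
  have hi := hH.integrable_of_lintegral hf hi
  have hfi := hH.integrable_of_integrable_comp hf hi
  rw [← ofReal_integral_eq_lintegral_ofReal hi
    (Eventually.of_forall fun x => hH.nonneg (norm_nonneg _))]
  exact ENNReal.ofReal_le_ofReal (hH.convexOn_norm.map_integral_le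
    hH.continuous_norm.continuousOn isClosed_univ (by simp) hfi hi)

/-- A smooth bump function supported in the ball of radius `1/(k+1)`. -/
noncomputable def mollifierBump (n k : ℕ) : ContDiffBump (0 : Vec n) where
  rIn := 1 / (2 * ((k : ℝ) + 1))
  rOut := 1 / ((k : ℝ) + 1)
  rIn_pos := by positivity
  rIn_lt_rOut := by
    apply one_div_lt_one_div_of_lt <;> linarith [(Nat.cast_nonneg k : (0:ℝ) ≤ k)]

/-- Standard mollification at scale `1/(k+1)`. -/
noncomputable def mollify {n : ℕ} (k : ℕ) (F : Vec n → E) : Vec n → E :=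
  convolution ((mollifierBump n k).normed volume) F (ContinuousLinearMap.lsmul ℝ ℝ) volume

theorem tendsto_rOut_mollifierBump (n : ℕ) :
    Tendsto (fun k => (mollifierBump n k).rOut) atTop (𝓝 0) :=
  tendsto_one_div_add_atTop_nhds_zero_nat

variable {n : ℕ}

theorem mollify_apply (k : ℕ) (F : Vec n → E) (x : Vec n) :
    mollify k F x = ∫ t, (mollifierBump n k).normed volume t • F (x - t) := rfl

theorem contDiff_mollify (k : ℕ) {F : Vec n → E} (hF : LocallyIntegrable F) :
    ContDiff ℝ ∞ (mollify k F) :=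
  (mollifierBump n k).hasCompactSupport_normed.contDiff_convolution_left (n := ⊤) _
    (mollifierBump n k).contDiff_normed hF

theorem integrable_mollify [CompleteSpace E] (k : ℕ) {F : Vec n → E} (hF : Integrable F) :
    Integrable (mollify k F) :=
  (mollifierBump n k).integrable_normed.integrable_convolution _ hF

theorem ae_tendsto_mollify [CompleteSpace E] {F : Vec n → E} (hF : LocallyIntegrable F) :
    ∀ᵐ x, Tendsto (fun k => mollify k F x) atTop (𝓝 (F x)) := by
  refine ContDiffBump.ae_convolution_tendsto_right_of_locallyIntegrable (K := 2)
    (tendsto_rOut_mollifierBump n) (Eventually.of_forall fun k => le_of_eq ?_) hF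
  simp only [mollifierBump]
  field_simp

/-- Mollification vanishes away from the support. -/
theorem mollify_eq_zero {k : ℕ} {F : Vec n → E} {x : Vec n}
    (h : ∀ y ∈ Metric.ball x (1 / ((k : ℝ) + 1)), F y = 0) : mollify k F x = 0 := by
  rw [mollify_apply]
  refine integral_eq_zero_of_ae (Eventually.of_forall fun t => ?_)
  by_cases ht : t ∈ Metric.ball (0 : Vec n) (mollifierBump n k).rOut
  · have : F (x - t) = 0 := h _ (by simpa [mollifierBump, dist_eq_norm] using ht)
    simp [this]
  · rw [← (mollifierBump n k).support_normed_eq (μ := volume)] at ht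
    simp [Function.notMem_support.1 ht]

/-- Jensen's inequality for mollifications. -/
theorem IsModular.norm_mollify_le (hH : IsModular m H) [CompleteSpace E] (k : ℕ) {F : Vec n → E}
    (hF : AEStronglyMeasurable F) (hi : Integrable (fun x => H ‖F x‖)) (x : Vec n) :
    H ‖mollify k F x‖ ≤ mollify k (fun y => H ‖F y‖) x := by
  set κ := (mollifierBump n k).normed volume with hκ
  have hκ0 : ∀ t, 0 ≤ κ t := (mollifierBump n k).nonneg_normed
  have hκc : Continuous κ := (mollifierBump n k).continuous_normed
  set μ := (volume : Measure (Vec n)).withDensity fun t => ENNReal.ofReal (κ t)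
  have hμ : IsProbabilityMeasure μ := ⟨by
    rw [withDensity_apply _ MeasurableSet.univ, Measure.restrict_univ,
      ← ofReal_integral_eq_lintegral_ofReal (mollifierBump n k).integrable_normed
      (Eventually.of_forall hκ0), (mollifierBump n k).integral_normed, ENNReal.ofReal_one]⟩
  have hmeas : Measurable fun t => ENNReal.ofReal (κ t) := hκc.measurable.ennreal_ofReal
  have hmv : ∀ G : Vec n → E, ∫ t, G t ∂μ = ∫ t, κ t • G t := fun G => by
    rw [integral_withDensity_eq_integral_toReal_smul hmeas
      (Eventually.of_forall fun t => ENNReal.ofReal_lt_top)]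
    simp only [ENNReal.toReal_ofReal (hκ0 _)]
  have hqmp : Measure.QuasiMeasurePreserving (fun t => x - t) (volume : Measure (Vec n)) volume :=
    (Measure.measurePreserving_sub_left volume x).quasiMeasurePreserving
  have hFx : AEStronglyMeasurable (fun t => F (x - t)) volume :=
    hF.comp_quasiMeasurePreserving hqmp
  have h1 := hH.ofReal_norm_integral_le (μ := μ)
    (hFx.mono_ac (withDensity_absolutelyContinuous _ _))
  rw [hmv, lintegral_withDensity_eq_lintegral_mul₀ hmeas.aemeasurable
    ((hH.continuous_norm.comp_aestronglyMeasurable hFx).aemeasurable.ennreal_ofReal)] at h1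
  have hex : Integrable (fun t => κ t * H ‖F (x - t)‖) :=
    ((mollifierBump n k).hasCompactSupport_normed.convolutionExists_left
      (ContinuousLinearMap.lsmul ℝ ℝ) hκc hi.locallyIntegrable x)
  have h2 : ∫⁻ t, ((fun t => ENNReal.ofReal (κ t)) * fun t => ENNReal.ofReal (H ‖F (x - t)‖)) t
      = ENNReal.ofReal (mollify k (fun y => H ‖F y‖) x) := by
    rw [mollify_apply]
    simp only [smul_eq_mul, ← hκ, Pi.mul_apply]
    rw [ofReal_integral_eq_lintegral_ofReal hex
      (Eventually.of_forall fun t => mul_nonneg (hκ0 t) (hH.nonneg (norm_nonneg _)))]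
    simp only [ENNReal.ofReal_mul (hκ0 _)]
  rw [h2] at h1
  refine (ENNReal.ofReal_le_ofReal_iff ?_).1 h1
  rw [mollify_apply]
  exact integral_nonneg fun t => mul_nonneg (hκ0 t) (hH.nonneg (norm_nonneg _))

/-- Mollifications converge in the modular sense: the integrands are dominated by a multiple of
`κ_k * H(|F|) + H(|F|)`, which converges almost everywhere while its integral is constant, so
Fatou's lemma applies to the difference. -/
theorem IsModular.tendsto_mollify (hH : IsModular m H) [CompleteSpace E] {F : Vec n → E}
    (hF : LocallyIntegrable F) (hi : Integrable (fun x => H ‖F x‖)) :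
    Tendsto (fun k => ∫⁻ x, ENNReal.ofReal (H ‖mollify k F x - F x‖)) atTop (𝓝 0) := by
  have hFm := hF.aestronglyMeasurable
  set g : Vec n → ℝ := fun x => H ‖F x‖ with hg
  have hg0 : ∀ x, 0 ≤ g x := fun x => hH.nonneg (norm_nonneg _)
  set c : ℝ := 2 ^ m
  have hc : 0 < c := by positivity
  set b : ℕ → Vec n → ℝ := fun k x => c * (mollify k g x + g x)
  set a : ℕ → Vec n → ℝ := fun k x => H ‖mollify k F x - F x‖
  have hmg0 : ∀ k x, 0 ≤ mollify k g x := fun k x =>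
    (hH.nonneg (norm_nonneg _)).trans (hH.norm_mollify_le k hFm hi x)
  have ha0 : ∀ k x, 0 ≤ a k x := fun k x => hH.nonneg (norm_nonneg _)
  have hab : ∀ k x, a k x ≤ b k x := fun k x => by
    have h1 : a k x ≤ H (‖mollify k F x‖ + ‖F x‖) :=
      hH.monotoneOn (norm_nonneg _) (show 0 ≤ ‖mollify k F x‖ + ‖F x‖ by positivity)
        (norm_sub_le _ _)
    refine h1.trans ((hH.map_add_le (norm_nonneg _) (norm_nonneg _)).trans ?_)
    have := hH.norm_mollify_le k hFm hi x
    simp only [b, c, g]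
    gcongr
  have hbi : ∀ k, Integrable (b k) := fun k => ((integrable_mollify k hi).add hi).const_mul c
  have ham : ∀ k, AEStronglyMeasurable (a k) := fun k =>
    hH.continuous_norm.comp_aestronglyMeasurable
      ((contDiff_mollify k hF).continuous.aestronglyMeasurable.sub hFm)
  have hai : ∀ k, Integrable (a k) := fun k => (hbi k).mono' (ham k)
    (Eventually.of_forall fun x => by rw [Real.norm_of_nonneg (ha0 k x)]; exact hab k x)
  set B : ℝ := c * (2 * ∫ x, g x) with hB
  have hbB : ∀ k, ∫ x, b k x = B := fun k => by
    rw [integral_const_mul, integral_add (integrable_mollify k hi) hi]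
    have : ∫ x, mollify k g x = ∫ x, g x := by
      unfold mollify
      rw [integral_convolution _ (mollifierBump n k).integrable_normed hi,
        (mollifierBump n k).integral_normed]
      simp
    rw [this, hB]; ring
  have hD0 : ∀ k x, 0 ≤ b k x - a k x := fun k x => sub_nonneg.2 (hab k x)
  have hfatou := lintegral_liminf_le' (μ := (volume : Measure (Vec n))) (u := atTop)
    (f := fun k x => ENNReal.ofReal (b k x - a k x))
    fun k => ((hbi k).1.sub (ham k)).aemeasurable.ennreal_ofReal
  have hlim : ∀ᵐ x, liminf (fun k => ENNReal.ofReal (b k x - a k x)) atTop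
      = ENNReal.ofReal (c * (2 * g x)) := by
    filter_upwards [ae_tendsto_mollify hF, ae_tendsto_mollify hi.locallyIntegrable] with x hx hgx
    apply Tendsto.liminf_eq
    apply ENNReal.tendsto_ofReal
    have h1 : Tendsto (fun k => a k x) atTop (𝓝 0) := by
      have := (hH.continuous_norm (E := E)).tendsto 0
      rw [norm_zero, hH.map_zero] at this
      exact this.comp (by simpa using hx.sub_const (F x))
    have h2 : Tendsto (fun k => b k x) atTop (𝓝 (c * (g x + g x))) :=
      (hgx.add_const (g x)).const_mul c
    have := h2.sub h1
    rwa [sub_zero, ← two_mul] at this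
  rw [lintegral_congr_ae hlim, ← ofReal_integral_eq_lintegral_ofReal
    ((hi.const_mul 2).const_mul c) (Eventually.of_forall fun x => by
      have := hg0 x; positivity), integral_const_mul, integral_const_mul] at hfatou
  have hDe : ∀ k, ∫⁻ x, ENNReal.ofReal (b k x - a k x) = ENNReal.ofReal (B - ∫ x, a k x) := by
    intro k
    have h := ofReal_integral_eq_lintegral_ofReal ((hbi k).sub (hai k))
      (Eventually.of_forall (hD0 k))
    simp only [Pi.sub_apply] at h
    rw [← h, integral_sub (hbi k) (hai k), hbB]
  simp only [hDe] at hfatou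
  have hae : ∀ k, ∫⁻ x, ENNReal.ofReal (a k x) = ENNReal.ofReal (∫ x, a k x) := fun k =>
    (ofReal_integral_eq_lintegral_ofReal (hai k) (Eventually.of_forall (ha0 k))).symm
  show Tendsto (fun k => ∫⁻ x, ENNReal.ofReal (a k x)) atTop (𝓝 0)
  simp only [hae]
  rw [← ENNReal.ofReal_zero]
  apply ENNReal.tendsto_ofReal
  have ha0' : ∀ k, 0 ≤ ∫ x, a k x := fun k => integral_nonneg (ha0 k)
  rw [Metric.tendsto_atTop]
  intro ε hε
  by_cases hBpos : B ≤ 0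
  · refine ⟨0, fun k _ => ?_⟩
    have : ∫ x, a k x ≤ B := (integral_mono (hai k) (hbi k) (hab k)).trans_eq (hbB k)
    rw [Real.dist_eq, sub_zero, abs_of_nonneg (ha0' k)]
    linarith
  push Not at hBpos
  have h3 : ENNReal.ofReal (B - ε) < liminf (fun k => ENNReal.ofReal (B - ∫ x, a k x)) atTop :=
    lt_of_lt_of_le ((ENNReal.ofReal_lt_ofReal_iff hBpos).2 (by linarith)) hfatou
  obtain ⟨K, hK⟩ := eventually_atTop.1 (eventually_lt_of_lt_liminf h3)
  refine ⟨K, fun k hk => ?_⟩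
  rw [Real.dist_eq, sub_zero, abs_of_nonneg (ha0' k)]
  by_contra! hlt
  exact absurd (hK k hk) (not_lt.2 (ENNReal.ofReal_le_ofReal (by linarith)))

end Mollify

/-! ### Weak gradients -/

section WeakGradient

variable {n N : ℕ} {U V : Set (Vec n)} {w : Vec n → Vec N} {Dw : Vec n → Mat N n}

theorem gradMat_apply (w : Vec n → Vec N) (x : Vec n) (i : Fin N) (j : Fin n) :
    gradMat w x (i, j) = fderiv ℝ w x (EuclideanSpace.single j 1) i := rfl

theorem gradMat_apply_eq_fderiv {x : Vec n} (hw : DifferentiableAt ℝ w x) (i : Fin N) (j : Fin n) :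
    gradMat w x (i, j) = fderiv ℝ (fun y => w y i) x (EuclideanSpace.single j 1) := by
  have h := ((EuclideanSpace.proj (𝕜 := ℝ) i).hasFDerivAt.comp x hw.hasFDerivAt).fderiv
  have e : (⇑(EuclideanSpace.proj (𝕜 := ℝ) i) ∘ w) = fun y => w y i := rfl
  rw [e] at h
  rw [h, gradMat_apply]
  rfl

theorem continuous_gradMat (hw : ContDiff ℝ 1 w) : Continuous (gradMat w) := by
  refine (PiLp.continuous_toLp 2 _).comp (continuous_pi fun ij => ?_)
  have h : Continuous fun x => fderiv ℝ w x (EuclideanSpace.single ij.2 1) :=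
    (hw.continuous_fderiv one_ne_zero).clm_apply continuous_const
  exact (EuclideanSpace.proj (𝕜 := ℝ) ij.1).continuous.comp h

/-- The product of a locally integrable function with a test function is integrable. -/
theorem LocallyIntegrableOn.integrable_apply_mul {ι : Type*} [Fintype ι]
    {f : Vec n → EuclideanSpace ℝ ι} (hf : LocallyIntegrableOn f U) {η : Vec n → ℝ}
    (hη : Continuous η) (hc : HasCompactSupport η) (hU : tsupport η ⊆ U) (i : ι) :
    Integrable fun x => f x i * η x := by
  have h1 : IntegrableOn (fun x => f x i) (tsupport η) :=
    (EuclideanSpace.proj (𝕜 := ℝ) i).integrable_comp (hf.integrableOn_compact_subset hU hc)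
  have h2 : IntegrableOn (fun x => f x i * η x) (tsupport η) :=
    IntegrableOn.mul_continuousOn h1 hη.continuousOn hc
  rwa [integrableOn_iff_integrable_of_support_subset] at h2
  intro x hx
  exact subset_tsupport _ (fun h => hx (by simp [h]))

theorem continuous_fderiv_apply {η : Vec n → ℝ} (hη : ContDiff ℝ ∞ η) (v : Vec n) :
    Continuous (fun x => fderiv ℝ η x v) :=
  (hη.continuous_fderiv (by simp)).clm_apply continuous_const

theorem IsWeakGrad.integrable_mul_fderiv (h : IsWeakGrad U w Dw) {η : Vec n → ℝ}
    (hη : ContDiff ℝ ∞ η) (hc : HasCompactSupport η) (hU : tsupport η ⊆ U) (i : Fin N) (j : Fin n) :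
    Integrable fun x => w x i * fderiv ℝ η x (EuclideanSpace.single j 1) :=
  LocallyIntegrableOn.integrable_apply_mul h.1 (continuous_fderiv_apply hη _)
    (hc.fderiv_apply ℝ _) ((tsupport_fderiv_apply_subset ℝ _).trans hU) i

/-- Integrals of functions that vanish outside `U` may be taken over the whole space. -/
theorem setIntegral_eq_of_tsupport_subset (η : Vec n → ℝ) {f : Vec n → ℝ} (hU : tsupport η ⊆ U)
    (h : ∀ x, η x = 0 → f x = 0) : ∫ x in U, f x = ∫ x, f x :=
  setIntegral_eq_integral_of_forall_compl_eq_zero fun x hx =>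
    h x (image_eq_zero_of_notMem_tsupport fun hx' => hx (hU hx'))

theorem IsWeakGrad.mono (h : IsWeakGrad U w Dw) (hVU : V ⊆ U) : IsWeakGrad V w Dw := by
  refine ⟨h.1.mono_set hVU, h.2.1.mono_set hVU, fun η hη hc hV i j => ?_⟩
  have hj := tsupport_fderiv_apply_subset ℝ (f := η) (EuclideanSpace.single j 1)
  have := h.2.2 η hη hc (hV.trans hVU) i j
  rw [setIntegral_eq_of_tsupport_subset _ ((hj.trans hV).trans hVU) (fun x hx => by simp [hx]),
    setIntegral_eq_of_tsupport_subset η (hV.trans hVU) (fun x hx => by simp [hx])] at this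
  rwa [setIntegral_eq_of_tsupport_subset _ (hj.trans hV) (fun x hx => by simp [hx]),
    setIntegral_eq_of_tsupport_subset η hV (fun x hx => by simp [hx])]

theorem IsWeakGrad.sub {w' : Vec n → Vec N} {Dw' : Vec n → Mat N n} (h : IsWeakGrad U w Dw)
    (h' : IsWeakGrad U w' Dw') :
    IsWeakGrad U (fun x => w x - w' x) (fun x => Dw x - Dw' x) := by
  refine ⟨h.1.sub h'.1, h.2.1.sub h'.2.1, fun η hη hc hU i j => ?_⟩
  have e1 := h.2.2 η hη hc hU i j
  have e2 := h'.2.2 η hη hc hU i j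
  simp only [PiLp.sub_apply, sub_mul]
  rw [integral_sub (h.integrable_mul_fderiv hη hc hU i j).integrableOn
    (h'.integrable_mul_fderiv hη hc hU i j).integrableOn, integral_sub
    (LocallyIntegrableOn.integrable_apply_mul h.2.1 hη.continuous hc hU (i, j)).integrableOn
    (LocallyIntegrableOn.integrable_apply_mul h'.2.1 hη.continuous hc hU (i, j)).integrableOn,
    e1, e2]
  ring

/-- The classical gradient of a `C¹` map is a weak gradient. -/
theorem isWeakGrad_of_contDiff (hw : ContDiff ℝ 1 w) : IsWeakGrad U w (gradMat w) := by
  refine ⟨hw.continuous.locallyIntegrable.locallyIntegrableOn _,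
    (continuous_gradMat hw).locallyIntegrable.locallyIntegrableOn _, fun η hη hc hU i j => ?_⟩
  have hwi : ContDiff ℝ 1 (fun x => w x i) :=
    (EuclideanSpace.proj (𝕜 := ℝ) i).contDiff.comp hw
  have hd : ∀ x, DifferentiableAt ℝ w x := fun x => hw.differentiable one_ne_zero x
  have hj := tsupport_fderiv_apply_subset ℝ (f := η) (EuclideanSpace.single j 1)
  rw [setIntegral_eq_of_tsupport_subset _ (hj.trans hU) (fun x hx => by simp [hx]),
    setIntegral_eq_of_tsupport_subset η hU (fun x hx => by simp [hx])]
  simp only [fun x => gradMat_apply_eq_fderiv (hd x) i j]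
  have hη' := continuous_fderiv_apply hη (EuclideanSpace.single j 1)
  have hc' := hc.fderiv_apply ℝ (EuclideanSpace.single j 1)
  refine integral_mul_fderiv_eq_neg_fderiv_mul_of_integrable ?_ ?_ ?_
    (fun x _ => hwi.differentiable one_ne_zero x)
    (fun x _ => hη.differentiable (by simp) x)
  · exact Continuous.integrable_of_hasCompactSupport
      (((hwi.continuous_fderiv one_ne_zero).clm_apply continuous_const).mul hη.continuous)
      hc.mul_left
  · exact Continuous.integrable_of_hasCompactSupport (hwi.continuous.mul hη') hc'.mul_left
  · exact Continuous.integrable_of_hasCompactSupport (hwi.continuous.mul hη.continuous) hc.mul_left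

/-- Weak gradients pass to limits in `L¹`. -/
theorem isWeakGrad_of_tendsto {F : ℕ → Vec n → Vec N} {DF : ℕ → Vec n → Mat N n}
    (hF : ∀ᶠ k in atTop, IsWeakGrad univ (F k) (DF k)) (hw : Integrable w) (hDw : Integrable Dw)
    (h1 : Tendsto (fun k => ∫⁻ x, ENNReal.ofReal ‖F k x - w x‖) atTop (𝓝 0))
    (h2 : Tendsto (fun k => ∫⁻ x, ENNReal.ofReal ‖DF k x - Dw x‖) atTop (𝓝 0)) :
    IsWeakGrad univ w Dw := by
  -- the pairing with a bounded continuous function is continuous for convergence in `L¹`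
  have key : ∀ {ι : Type} [Fintype ι] (G : ℕ → Vec n → EuclideanSpace ℝ ι)
      (G' : Vec n → EuclideanSpace ℝ ι) (i : ι) (η : Vec n → ℝ), Continuous η →
      HasCompactSupport η → (∀ᶠ k in atTop, LocallyIntegrableOn (G k) univ) → Integrable G' →
      Tendsto (fun k => ∫⁻ x, ENNReal.ofReal ‖G k x - G' x‖) atTop (𝓝 0) →
      Tendsto (fun k => ∫ x, G k x i * η x) atTop (𝓝 (∫ x, G' x i * η x)) := by
    intro ι _ G G' i η hη hc hG hG' ht
    obtain ⟨C, hC⟩ := hη.bounded_above_of_compact_support hc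
    refine tendsto_integral_of_L1 _ (LocallyIntegrableOn.integrable_apply_mul
      (hG'.locallyIntegrable.locallyIntegrableOn univ) hη hc (subset_univ _) i).1 ?_ ?_
    · filter_upwards [hG] with k hk using
        LocallyIntegrableOn.integrable_apply_mul hk hη hc (subset_univ _) i
    · have hC' := ENNReal.Tendsto.const_mul (a := ENNReal.ofReal C) ht
        (Or.inr ENNReal.ofReal_ne_top)
      rw [mul_zero] at hC'
      refine tendsto_of_tendsto_of_tendsto_of_le_of_le tendsto_const_nhds hC' (fun _ => zero_le)
        fun k => ?_
      rw [← lintegral_const_mul' _ _ ENNReal.ofReal_ne_top]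
      refine lintegral_mono fun x => ?_
      have hC0 : 0 ≤ C := (norm_nonneg _).trans (hC x)
      rw [← ENNReal.ofReal_mul hC0, ← ofReal_norm]
      refine ENNReal.ofReal_le_ofReal ?_
      rw [← sub_mul, norm_mul, mul_comm]
      exact mul_le_mul (hC x) (PiLp.norm_apply_le (G k x - G' x) i) (norm_nonneg _) hC0
  refine ⟨hw.locallyIntegrable.locallyIntegrableOn _, hDw.locallyIntegrable.locallyIntegrableOn _,
    fun η hη hc _ i j => ?_⟩
  have l1 := key F w i (fun x => fderiv ℝ η x (EuclideanSpace.single j 1))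
    (continuous_fderiv_apply hη _) (hc.fderiv_apply ℝ _)
    (hF.mono fun k hk => hk.1) hw h1
  have l2 := key DF Dw (i, j) η hη.continuous hc (hF.mono fun k hk => hk.2.1) hDw h2
  simp only [setIntegral_univ]
  refine tendsto_nhds_unique l1 (l2.neg.congr' ?_)
  filter_upwards [hF] with k hk
  have := hk.2.2 η hη hc (subset_univ _) i j
  simp only [setIntegral_univ] at this
  exact this.symm

/-- The gradient of a mollification is the mollification of the weak gradient. -/
theorem IsWeakGrad.gradMat_mollify (hU : MeasurableSet U) (h : IsWeakGrad U w Dw)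
    (hw : IntegrableOn w U) (hDw : IntegrableOn Dw U) {k : ℕ} {x : Vec n}
    (hx : Metric.closedBall x (1 / ((k : ℝ) + 1)) ⊆ U) :
    gradMat (mollify k (U.indicator w)) x = mollify k (U.indicator Dw) x := by
  have hwU : LocallyIntegrable (U.indicator w) := (hw.integrable_indicator hU).locallyIntegrable
  have hDU : LocallyIntegrable (U.indicator Dw) := (hDw.integrable_indicator hU).locallyIntegrable
  set κ := (mollifierBump n k).normed volume with hκ
  have hκc : Continuous κ := (mollifierBump n k).continuous_normed
  have hκs : HasCompactSupport κ := (mollifierBump n k).hasCompactSupport_normed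
  have hκd : ContDiff ℝ ∞ κ := (mollifierBump n k).contDiff_normed (n := ⊤)
  -- mollification acts on components
  have comp : ∀ {ι : Type} [Fintype ι] (G : Vec n → EuclideanSpace ℝ ι) (i : ι) (y : Vec n),
      LocallyIntegrable G → mollify k G y i = ∫ t, G t i * κ (y - t) := by
    intro ι _ G i y hG
    have hex := hκs.convolutionExists_left (ContinuousLinearMap.lsmul ℝ ℝ) hκc hG y
    have e := (EuclideanSpace.proj (𝕜 := ℝ) i).integral_comp_comm hex.integrable_swap
    have e2 : mollify k G y = ∫ t, (ContinuousLinearMap.lsmul ℝ ℝ) (κ (y - t)) (G t) :=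
      convolution_eq_swap _
    rw [e2]
    refine (e.symm.trans ?_)
    refine integral_congr_ae (Eventually.of_forall fun t => ?_)
    simp [mul_comm]
  ext ⟨i, j⟩
  rw [gradMat_apply_eq_fderiv ((contDiff_mollify k hwU).differentiable (by simp) x),
    comp _ _ _ hDU]
  have e1 : (fun y => mollify k (U.indicator w) y i) =
      convolution (fun t => U.indicator w t i) κ (ContinuousLinearMap.mul ℝ ℝ) volume := by
    ext y
    rw [comp _ _ _ hwU]
    rfl
  have hloc : LocallyIntegrable fun t => U.indicator w t i :=
    ((EuclideanSpace.proj (𝕜 := ℝ) i).integrable_comp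
      (hw.integrable_indicator hU)).locallyIntegrable
  rw [e1, (hκs.hasFDerivAt_convolution_right (ContinuousLinearMap.mul ℝ ℝ) hloc
    (hκd.of_le (by simp)) x).fderiv, convolution_precompR_apply _ hloc (hκs.fderiv ℝ)
    (hκd.continuous_fderiv (by simp))]
  -- the test function `t ↦ κ (x - t)`
  set η : Vec n → ℝ := fun t => κ (x - t) with hη
  have hηd : ContDiff ℝ ∞ η := hκd.comp (contDiff_const.sub contDiff_id)
  have hηsupp : Function.support η ⊆ Metric.closedBall x (1 / ((k : ℝ) + 1)) := by
    intro t ht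
    have : x - t ∈ Function.support κ := ht
    rw [hκ, (mollifierBump n k).support_normed_eq] at this
    have := Metric.ball_subset_closedBall this
    simpa [mollifierBump, dist_eq_norm, norm_sub_rev] using this
  have hηt : tsupport η ⊆ Metric.closedBall x (1 / ((k : ℝ) + 1)) :=
    closure_minimal hηsupp Metric.isClosed_closedBall
  have hηc : HasCompactSupport η :=
    (isCompact_closedBall x _).of_isClosed_subset (isClosed_tsupport _) hηt
  have hder : ∀ t, fderiv ℝ η t (EuclideanSpace.single j 1)
      = -fderiv ℝ κ (x - t) (EuclideanSpace.single j 1) := by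
    intro t
    have h1 : HasFDerivAt (fun t : Vec n => x - t) (-ContinuousLinearMap.id ℝ (Vec n)) t := by
      simpa using (hasFDerivAt_id t).const_sub x
    have h2 := ((hκd.differentiable (by simp) (x - t)).hasFDerivAt.comp t h1).fderiv
    have e : (κ ∘ fun t => x - t) = η := rfl
    rw [e] at h2
    rw [h2]
    simp
  have hweak := h.2.2 η hηd hηc (hηt.trans hx) i j
  have e2 : ∫ t, U.indicator Dw t (i, j) * κ (x - t) = ∫ t in U, Dw t (i, j) * η t := by
    rw [← integral_indicator hU]
    congr 1 with t
    by_cases ht : t ∈ U <;> simp [ht, hη]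
  have e3 : convolution (fun t => U.indicator w t i)
      (fun a => fderiv ℝ κ a (EuclideanSpace.single j 1)) (ContinuousLinearMap.mul ℝ ℝ) volume x
      = -∫ t in U, w t i * fderiv ℝ η t (EuclideanSpace.single j 1) := by
    rw [← integral_indicator hU, ← integral_neg, convolution_def]
    congr 1 with t
    by_cases ht : t ∈ U <;> simp [ht, hder]
  rw [e2, e3, hweak, neg_neg]

end WeakGradient

/-! ### Variations supported in a smaller ball, and dilations -/

section Variation

variable {n N : ℕ} {m : ℝ} {φ : ℝ → ℝ} {F : Vec n → Vec N} {DF : Vec n → Mat N n}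

/-- A Sobolev map on the whole space, of finite modular, which vanishes together with its weak
gradient outside a closed ball strictly contained in `B_ρ(x₀)`. -/
structure IsInnerVariation (φ : ℝ → ℝ) (x₀ : Vec n) (ρ : ℝ) (F : Vec n → Vec N)
    (DF : Vec n → Mat N n) : Prop where
  isWeakGrad : IsWeakGrad univ F DF
  eq_zero : ∃ s, s < ρ ∧ ∀ x, x ∉ Metric.closedBall x₀ s → F x = 0 ∧ DF x = 0
  integrable : Integrable F
  integrable_grad : Integrable DF
  integrable_modular : Integrable fun x => φ ‖F x‖
  integrable_modular_grad : Integrable fun x => φ ‖DF x‖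

theorem IsModular.map_mul_le_max (hφ : IsModular m φ) {l t : ℝ} (ht : 0 ≤ t) (hl : 0 ≤ l) :
    φ (l * t) ≤ max l 1 ^ m * φ t :=
  (hφ.monotoneOn (show 0 ≤ l * t by positivity) (show 0 ≤ max l 1 * t by positivity)
    (by gcongr; exact le_max_left _ _)).trans (hφ.map_mul_le _ _ (le_max_right _ _) ht)

theorem IsModular.tendsto_mollify_mul (hφ : IsModular m φ) {E : Type*} [NormedAddCommGroup E]
    [NormedSpace ℝ E] [CompleteSpace E] {G : Vec n → E} (hG : LocallyIntegrable G)
    (hi : Integrable fun x => φ ‖G x‖) {l : ℝ} (hl : 0 < l) (U : Set (Vec n)) (K : ℕ) :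
    Tendsto (fun k => ∫⁻ x in U, ENNReal.ofReal (φ (l * ‖mollify (k + K) G x - G x‖)))
      atTop (𝓝 0) := by
  have h := ENNReal.Tendsto.const_mul (a := ENNReal.ofReal (max l 1 ^ m))
    ((hφ.tendsto_mollify hG hi).comp (tendsto_add_atTop_nat K)) (Or.inr ENNReal.ofReal_ne_top)
  rw [mul_zero] at h
  refine tendsto_of_tendsto_of_tendsto_of_le_of_le tendsto_const_nhds h (fun _ => zero_le)
    fun k => (setLIntegral_le_lintegral _ _).trans ?_
  simp only [Function.comp]
  rw [← lintegral_const_mul' _ _ ENNReal.ofReal_ne_top]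
  refine lintegral_mono fun x => ?_
  rw [← ENNReal.ofReal_mul (by positivity)]
  exact ENNReal.ofReal_le_ofReal (hφ.map_mul_le_max (norm_nonneg _) hl.le)

/-- Inner variations belong to `W₀^{1,φ}`: their mollifications are test maps. -/
theorem IsInnerVariation.memWZero {x₀ : Vec n} {ρ : ℝ} (hφ : IsModular m φ)
    (h : IsInnerVariation φ x₀ ρ F DF) : MemWZero φ (Metric.ball x₀ ρ) F DF := by
  obtain ⟨s, hs, hz⟩ := h.eq_zero
  obtain ⟨K, hK⟩ := exists_nat_one_div_lt (sub_pos.2 hs)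
  refine ⟨⟨h.isWeakGrad.mono (subset_univ _), ⟨h.integrable.1.restrict,
    h.integrable_modular.integrableOn⟩, ⟨h.integrable_grad.1.restrict,
    h.integrable_modular_grad.integrableOn⟩⟩, fun k => mollify (k + K) F, fun k => ?_,
    fun l hl => ⟨hφ.tendsto_mollify_mul h.integrable.locallyIntegrable h.integrable_modular hl _ K,
      ?_⟩⟩
  · have hsub : tsupport (mollify (k + K) F) ⊆ Metric.closedBall x₀ (s + 1 / ((K : ℝ) + 1)) := by
      refine closure_minimal (fun x hx => ?_) Metric.isClosed_closedBall
      by_contra hx'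
      refine hx (mollify_eq_zero fun y hy => (hz y fun hys => hx' ?_).1)
      rw [Metric.mem_ball] at hy
      rw [Metric.mem_closedBall] at hys ⊢
      have hle : 1 / (((k + K : ℕ) : ℝ) + 1) ≤ 1 / ((K : ℝ) + 1) := by
        apply one_div_le_one_div_of_le (by positivity)
        push_cast
        linarith [(Nat.cast_nonneg k : (0:ℝ) ≤ k)]
      have := dist_triangle_left x x₀ y
      linarith
    exact ⟨contDiff_mollify _ h.integrable.locallyIntegrable,
      (isCompact_closedBall x₀ _).of_isClosed_subset (isClosed_tsupport _) hsub,
      hsub.trans (Metric.closedBall_subset_ball (by linarith))⟩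
  · have e : ∀ k x, gradMat (mollify k F) x = mollify k DF x := fun k x => by
      have := h.isWeakGrad.gradMat_mollify MeasurableSet.univ h.integrable.integrableOn
        h.integrable_grad.integrableOn (k := k) (subset_univ (Metric.closedBall x _))
      simpa using this
    simp only [e]
    exact hφ.tendsto_mollify_mul h.integrable_grad.locallyIntegrable h.integrable_modular_grad
      hl _ K

/-- Smooth maps with compact support in the ball are inner variations. -/
theorem IsTestMap.isInnerVariation {x₀ : Vec n} {ρ : ℝ} (hφ : IsModular m φ)
    (h : IsTestMap (Metric.ball x₀ ρ) F) : IsInnerVariation φ x₀ ρ F (gradMat F) := by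
  obtain ⟨h1, h2, h3⟩ := h
  have hF1 : ContDiff ℝ 1 F := h1.of_le (by simp)
  have hgz : ∀ x, x ∉ tsupport F → gradMat F x = 0 := fun x hx => by
    have : fderiv ℝ F x = 0 :=
      image_eq_zero_of_notMem_tsupport fun hx' => hx (tsupport_fderiv_subset ℝ hx')
    ext ij
    simp [gradMat, this]
  have hgs : HasCompactSupport (gradMat F) :=
    HasCompactSupport.intro' h2 (isClosed_tsupport F) hgz
  have key : ∀ {E : Type} [NormedAddCommGroup E] (G : Vec n → E), Continuous G →
      HasCompactSupport G → Integrable fun x => φ ‖G x‖ := fun G hG hGc =>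
    (hφ.continuous_norm.comp hG).integrable_of_hasCompactSupport
      (hGc.comp_left (g := fun y => φ ‖y‖) (by simp [hφ.map_zero]))
  refine ⟨isWeakGrad_of_contDiff hF1, ?_, h1.continuous.integrable_of_hasCompactSupport h2,
    (continuous_gradMat hF1).integrable_of_hasCompactSupport hgs, key F h1.continuous h2,
    key _ (continuous_gradMat hF1) hgs⟩
  obtain ⟨s, hs, hsub⟩ : ∃ s, s < ρ ∧ tsupport F ⊆ Metric.closedBall x₀ s := by
    rcases (tsupport F).eq_empty_or_nonempty with he | hne
    · exact ⟨ρ - 1, by linarith, by simp [he]⟩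
    · obtain ⟨y, hy, hmax⟩ := h2.isCompact.exists_isMaxOn hne
        (f := fun y => dist y x₀) (by fun_prop)
      exact ⟨dist y x₀, h3 hy, fun x hx => hmax hx⟩
  exact ⟨s, hs, fun x hx => ⟨image_eq_zero_of_notMem_tsupport fun h => hx (hsub h),
    hgz x fun h => hx (hsub h)⟩⟩

theorem integral_comp_affine {E : Type*} [NormedAddCommGroup E] [NormedSpace ℝ E] (f : Vec n → E)
    (a : Vec n) {c : ℝ} (hc : 0 < c) : ∫ x, f (a + c • x) = (c ^ n)⁻¹ • ∫ x, f x := by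
  rw [Measure.integral_comp_smul volume (fun y => f (a + y)) c, finrank_euclideanSpace_fin,
    integral_add_left_eq_self f a, abs_of_pos (by positivity)]

theorem integrable_comp_affine {E : Type*} [NormedAddCommGroup E] {f : Vec n → E}
    (hf : Integrable f) (a : Vec n) {c : ℝ} (hc : c ≠ 0) : Integrable fun x => f (a + c • x) :=
  (hf.comp_add_left a).comp_smul hc

theorem integrableOn_comp_affine {E : Type*} [NormedAddCommGroup E] {f : Vec n → E}
    {U : Set (Vec n)} (hU : MeasurableSet U) (hf : IntegrableOn f U) (a : Vec n) {c : ℝ}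
    (hc : c ≠ 0) : IntegrableOn (fun x => f (a + c • x)) ((fun x => a + c • x) ⁻¹' U) := by
  have hm : Measurable fun x : Vec n => a + c • x := by fun_prop
  rw [← integrable_indicator_iff (hm hU)]
  exact integrable_comp_affine (hf.integrable_indicator hU) a hc

theorem setIntegral_comp_affine (f : Vec n → ℝ) {U : Set (Vec n)} (hU : MeasurableSet U)
    (a : Vec n) {c : ℝ} (hc : 0 < c) :
    ∫ x in (fun x => a + c • x) ⁻¹' U, f (a + c • x) = (c ^ n)⁻¹ * ∫ x in U, f x := by
  have hm : Measurable fun x : Vec n => a + c • x := by fun_prop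
  rw [← integral_indicator hU, ← integral_indicator (hm hU), ← smul_eq_mul,
    ← integral_comp_affine _ a hc]
  rfl

theorem preimage_affine_ball (x₀ : Vec n) {ρ : ℝ} (hρ : 0 < ρ) (r : ℝ) :
    (fun x => x₀ + ρ • x) ⁻¹' Metric.ball x₀ (ρ * r) = Metric.ball 0 r := by
  ext x
  simp [dist_eq_norm, norm_smul, abs_of_pos hρ, hρ]

theorem setAverage_comp_affine (f : Vec n → ℝ) (x₀ : Vec n) {ρ : ℝ} (hρ : 0 < ρ) (r : ℝ) :
    ⨍ x in Metric.ball 0 r, f (x₀ + ρ • x) = ⨍ x in Metric.ball x₀ (ρ * r), f x := by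
  have h1 := setIntegral_comp_affine f (Metric.isOpen_ball (x := x₀) (ε := ρ * r)).measurableSet
    x₀ hρ
  have h2 := setIntegral_comp_affine (fun _ => (1:ℝ))
    (Metric.isOpen_ball (x := x₀) (ε := ρ * r)).measurableSet x₀ hρ
  rw [preimage_affine_ball x₀ hρ r] at h1 h2
  rw [setAverage_eq, setAverage_eq, h1]
  simp only [setIntegral_const, smul_eq_mul, mul_one] at h2 ⊢
  have : (0:ℝ) < ρ ^ n := by positivity
  rw [h2]
  field_simp

/-- Weak gradients under dilations and translations of the independent variable. -/
theorem IsWeakGrad.comp_affine {U : Set (Vec n)} (hU : MeasurableSet U) {w : Vec n → Vec N}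
    {Dw : Vec n → Mat N n} (h : IsWeakGrad U w Dw) (hw : IntegrableOn w U)
    (hDw : IntegrableOn Dw U) (a : Vec n) {c : ℝ} (hc : 0 < c) :
    IsWeakGrad ((fun x => a + c • x) ⁻¹' U) (fun x => c⁻¹ • w (a + c • x))
      (fun x => Dw (a + c • x)) := by
  refine ⟨IntegrableOn.locallyIntegrableOn (Integrable.smul c⁻¹ (integrableOn_comp_affine hU hw a hc.ne')),
    (integrableOn_comp_affine hU hDw a hc.ne').locallyIntegrableOn, fun η hη hηc hηU i j => ?_⟩
  set e : Vec n ≃ₜ Vec n := (Homeomorph.smulOfNeZero c hc.ne').trans (Homeomorph.addLeft a)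
  have he : ∀ x, e x = a + c • x := fun x => rfl
  have hes : ∀ y, e.symm y = c⁻¹ • (-a + y) := fun y => by
    rw [Homeomorph.symm_apply_eq, he, smul_inv_smul₀ hc.ne', add_neg_cancel_left]
  set η' : Vec n → ℝ := η ∘ e.symm with hη'
  have hη'd : ContDiff ℝ ∞ η' := by
    have : η' = fun y => η (c⁻¹ • (-a + y)) := by ext y; simp [hη', hes]
    rw [this]
    exact hη.comp (by fun_prop)
  have hη'c : HasCompactSupport η' := hηc.comp_homeomorph e.symm
  have hη'U : tsupport η' ⊆ U := by
    have h1 := tsupport_comp_subset_preimage η e.symm.continuous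
    intro y hy
    have := hηU (h1 hy)
    rw [mem_preimage, ← he, e.apply_symm_apply] at this
    exact this
  have hη'e : ∀ x, η' (a + c • x) = η x := fun x => by
    rw [← he, hη', Function.comp_apply, e.symm_apply_apply]
  have hder : ∀ x, fderiv ℝ η x (EuclideanSpace.single j 1)
      = c * fderiv ℝ η' (a + c • x) (EuclideanSpace.single j 1) := by
    intro x
    have h1 : HasFDerivAt (fun x : Vec n => a + c • x) (c • ContinuousLinearMap.id ℝ (Vec n)) x :=
      ((hasFDerivAt_id x).const_smul c).const_add a
    have h2 := ((hη'd.differentiable (by simp) (a + c • x)).hasFDerivAt.comp x h1).fderiv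
    have e' : (η' ∘ fun x => a + c • x) = η := funext hη'e
    rw [e'] at h2
    rw [h2]
    simp
  have hweak := h.2.2 η' hη'd hη'c hη'U i j
  have hj := tsupport_fderiv_apply_subset ℝ (f := η) (EuclideanSpace.single j 1)
  have hj' := tsupport_fderiv_apply_subset ℝ (f := η') (EuclideanSpace.single j 1)
  rw [setIntegral_eq_of_tsupport_subset _ (hj'.trans hη'U) (fun x hx => by simp [hx]),
    setIntegral_eq_of_tsupport_subset η' hη'U (fun x hx => by simp [hx])] at hweak
  rw [setIntegral_eq_of_tsupport_subset _ (hj.trans hηU) (fun x hx => by simp [hx]),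
    setIntegral_eq_of_tsupport_subset η hηU (fun x hx => by simp [hx])]
  have i1 := integral_comp_affine
    (fun x => w x i * fderiv ℝ η' x (EuclideanSpace.single j 1)) a hc
  have i2 := integral_comp_affine (fun x => Dw x (i, j) * η' x) a hc
  rw [hweak, smul_neg, ← i2] at i1
  simp only [hη'e] at i1
  rw [← i1]
  congr 1 with x
  rw [hder]
  simp only [PiLp.smul_apply, smul_eq_mul]
  field_simp

/-- Dilating an inner variation of the unit ball gives an inner variation of `B_ρ(x₀)`. -/
theorem IsInnerVariation.dilate (hφ : IsModular m φ) (h : IsInnerVariation φ 0 1 F DF)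
    (x₀ : Vec n) {ρ : ℝ} (hρ : 0 < ρ) :
    IsInnerVariation φ x₀ ρ (fun x => ρ • F (ρ⁻¹ • (x - x₀))) (fun x => DF (ρ⁻¹ • (x - x₀))) := by
  have e : ∀ x : Vec n, ρ⁻¹ • (x - x₀) = (-(ρ⁻¹ • x₀)) + ρ⁻¹ • x := fun x => by
    rw [smul_sub]; abel
  simp only [e]
  have hρi := inv_pos.2 hρ
  have hint := integrable_comp_affine h.integrable (-(ρ⁻¹ • x₀)) hρi.ne'
  refine ⟨?_, ?_, hint.smul ρ, integrable_comp_affine h.integrable_grad _ hρi.ne', ?_,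
    integrable_comp_affine h.integrable_modular_grad _ hρi.ne'⟩
  · have := h.isWeakGrad.comp_affine MeasurableSet.univ h.integrable.integrableOn
      h.integrable_grad.integrableOn (-(ρ⁻¹ • x₀)) hρi
    simpa using this
  · obtain ⟨s, hs, hz⟩ := h.eq_zero
    refine ⟨ρ * s, by nlinarith, fun x hx => ?_⟩
    have hx' : (-(ρ⁻¹ • x₀)) + ρ⁻¹ • x ∉ Metric.closedBall (0 : Vec n) s := by
      rw [← e]
      intro h'
      apply hx
      rw [mem_closedBall_zero_iff, norm_smul, Real.norm_of_nonneg hρi.le, inv_mul_le_iff₀ hρ] at h'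
      rwa [Metric.mem_closedBall, dist_eq_norm]
    rw [(hz _ hx').1, (hz _ hx').2]
    simp
  · refine Integrable.mono' ((integrable_comp_affine h.integrable_modular (-(ρ⁻¹ • x₀))
      hρi.ne').const_mul (max ρ 1 ^ m)) ?_ (Eventually.of_forall fun x => ?_)
    · exact hφ.continuous_norm.comp_aestronglyMeasurable (hint.smul ρ).1
    · rw [Real.norm_of_nonneg (hφ.nonneg (norm_nonneg _)), norm_smul, Real.norm_of_nonneg hρ.le]
      exact hφ.map_mul_le_max (norm_nonneg _) hρ.le

end Variation

/-! ### Averages over balls shrinking towards a sphere -/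

section Averages

variable {n : ℕ} {s : ℝ}

/-- The radius function `θ(x) = (s² - |x|²)/(8s)`. It is smooth, vanishes on the sphere of radius
`s`, and lies between `(s - |x|)/8` and `(s - |x|)/4` inside. -/
noncomputable def avgRadius (s : ℝ) (x : Vec n) : ℝ := (s ^ 2 - ‖x‖ ^ 2) / (8 * s)

/-- The uniform probability measure on the closed unit ball. -/
noncomputable def ballProb (n : ℕ) : Measure (Vec n) :=
  (volume (Metric.closedBall (0 : Vec n) 1))⁻¹ • volume.restrict (Metric.closedBall 0 1)

theorem volume_closedBall_one_ne_zero (n : ℕ) :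
    volume (Metric.closedBall (0 : Vec n) 1) ≠ 0 :=
  (Metric.measure_closedBall_pos volume _ one_pos).ne'

theorem volume_closedBall_one_ne_top (n : ℕ) :
    volume (Metric.closedBall (0 : Vec n) 1) ≠ ⊤ :=
  measure_closedBall_lt_top.ne

instance isProbabilityMeasure_ballProb (n : ℕ) : IsProbabilityMeasure (ballProb n) := ⟨by
  simp only [ballProb, Measure.smul_apply, Measure.restrict_apply MeasurableSet.univ, univ_inter,
    smul_eq_mul]
  exact ENNReal.inv_mul_cancel (volume_closedBall_one_ne_zero n) (volume_closedBall_one_ne_top n)⟩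

theorem ae_ballProb_norm_le (n : ℕ) : ∀ᵐ y ∂(ballProb n), ‖y‖ ≤ 1 := by
  have h : ∀ᵐ y ∂(volume.restrict (Metric.closedBall (0 : Vec n) 1)), ‖y‖ ≤ 1 := by
    filter_upwards [ae_restrict_mem Metric.isClosed_closedBall.measurableSet] with y hy
    simpa using hy
  exact Measure.ae_smul_measure h _

/-- The average of `g` over the ball of radius `θ(x)` centred at `x`. -/
noncomputable def ballAvg (s : ℝ) (g : Vec n → ENNReal) (x : Vec n) : ENNReal :=
  ∫⁻ y, g (x + avgRadius s x • y) ∂(ballProb n)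

theorem continuous_avgRadius : Continuous (avgRadius s : Vec n → ℝ) := by
  unfold avgRadius; fun_prop

theorem avgRadius_le (hs : 0 < s) {x : Vec n} (hx : ‖x‖ ≤ s) : avgRadius s x ≤ (s - ‖x‖) / 4 := by
  rw [avgRadius, div_le_iff₀ (by positivity)]
  nlinarith [norm_nonneg x]

theorem le_avgRadius (hs : 0 < s) {x : Vec n} (hx : ‖x‖ ≤ s) : (s - ‖x‖) / 8 ≤ avgRadius s x := by
  rw [avgRadius, le_div_iff₀ (by positivity)]
  nlinarith [norm_nonneg x]

theorem lintegral_comp_affine (g : Vec n → ENNReal) (a : Vec n) {c : ℝ}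
    (hc : 0 < c) {U : Set (Vec n)} (hU : MeasurableSet U) :
    ∫⁻ x in (fun x => a + c • x) ⁻¹' U, g (a + c • x) = ENNReal.ofReal ((c ^ n)⁻¹) * ∫⁻ x in U, g x := by
  set e : Vec n ≃ᵐ Vec n := ((Homeomorph.smulOfNeZero c hc.ne').trans
    (Homeomorph.addLeft a)).toMeasurableEquiv
  have he : ∀ x, e x = a + c • x := fun x => rfl
  have hmap : Measure.map e volume = ENNReal.ofReal ((c ^ n)⁻¹) • volume := by
    have h1 : (⇑e) = (fun x => a + x) ∘ fun x : Vec n => c • x := rfl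
    rw [h1, ← Measure.map_map (by fun_prop) (by fun_prop), Measure.map_addHaar_smul _ hc.ne',
      Measure.map_smul, (measurePreserving_add_left volume a).map_eq, finrank_euclideanSpace_fin,
      abs_of_pos (by positivity)]
  have h2 : ∫⁻ x in U, g x ∂(Measure.map e volume) = ∫⁻ x in e ⁻¹' U, g (e x) := by
    rw [← lintegral_indicator hU, ← lintegral_indicator (e.measurable hU),
      lintegral_map_equiv]
    rfl
  rw [hmap, Measure.restrict_smul, lintegral_smul_measure] at h2
  exact h2.symm

/-- The average is bounded by the integral over a ball contained in the ball of radius `s`. -/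
theorem ballAvg_le (hs : 0 < s) (g : Vec n → ENNReal) {x : Vec n} (hx : ‖x‖ < s) :
    ballAvg s g x ≤ (volume (Metric.closedBall (0 : Vec n) 1))⁻¹ * ENNReal.ofReal (8 ^ n) *
      (ENNReal.ofReal ((s - ‖x‖) ^ (-(n : ℝ))) *
        ∫⁻ z in Metric.closedBall x ((s - ‖x‖) / 4), g z) := by
  have hd : 0 < s - ‖x‖ := by linarith
  have hθ1 := le_avgRadius hs hx.le
  have hθ2 := avgRadius_le hs hx.le
  have hθ : 0 < avgRadius s x := by linarith
  have hpre : (fun y => x + avgRadius s x • y) ⁻¹' Metric.closedBall x (avgRadius s x)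
      = Metric.closedBall 0 1 := by
    ext y
    simp [dist_eq_norm, norm_smul, abs_of_pos hθ, hθ]
  rw [ballAvg, ballProb, lintegral_smul_measure, ← hpre, lintegral_comp_affine g x hθ
    Metric.isClosed_closedBall.measurableSet, hpre, smul_eq_mul, mul_assoc]
  refine mul_le_mul' le_rfl ?_
  rw [← mul_assoc, ← ENNReal.ofReal_mul (by positivity)]
  refine mul_le_mul' (ENNReal.ofReal_le_ofReal ?_)
    (lintegral_mono_set (Metric.closedBall_subset_closedBall hθ2))
  rw [Real.rpow_neg hd.le, Real.rpow_natCast, ← div_eq_mul_inv, le_div_iff₀ (by positivity),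
    ← div_eq_inv_mul, div_le_iff₀ (by positivity), ← mul_pow]
  gcongr
  linarith

theorem measurable_ballAvg_integrand {g : Vec n → ENNReal} (hg : Measurable g) :
    Measurable fun p : Vec n × Vec n => g (p.1 + avgRadius s p.1 • p.2) :=
  hg.comp ((continuous_fst.add ((continuous_avgRadius.comp continuous_fst).smul
    continuous_snd)).measurable)

theorem measurable_ballAvg {g : Vec n → ENNReal} (hg : Measurable g) :
    Measurable (ballAvg s g) :=
  (measurable_ballAvg_integrand hg).lintegral_prod_right'

theorem measurable_dist_rpow (s a : ℝ) :
    Measurable fun x : Vec n => ENNReal.ofReal ((s - ‖x‖) ^ a) := by fun_prop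

/-- The averaging operator is bounded on `L¹` with the weight `(s - |x|)^(-α)`. -/
theorem exists_lintegral_ballAvg_le (n : ℕ) {α : ℝ} (hα : 0 ≤ α) :
    ∃ C : ENNReal, C ≠ ⊤ ∧ ∀ (s : ℝ) (g : Vec n → ENNReal), 0 < s → Measurable g →
      ∫⁻ x in Metric.ball 0 s, ENNReal.ofReal ((s - ‖x‖) ^ (-α)) * ballAvg s g x ≤
        C * ∫⁻ x in Metric.ball 0 s, ENNReal.ofReal ((s - ‖x‖) ^ (-α)) * g x := by
  set c₁ := (volume (Metric.closedBall (0 : Vec n) 1))⁻¹ * ENNReal.ofReal (8 ^ n)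
  have hc₁ : c₁ ≠ ⊤ := ENNReal.mul_ne_top
    (ENNReal.inv_ne_top.2 (volume_closedBall_one_ne_zero n)) ENNReal.ofReal_ne_top
  set c₂ := ENNReal.ofReal ((5 / 4) ^ (α + n)) * volume (Metric.closedBall (0 : Vec n) 1)
  have hc₂ : c₂ ≠ ⊤ := ENNReal.mul_ne_top ENNReal.ofReal_ne_top (volume_closedBall_one_ne_top n)
  refine ⟨c₁ * c₂, ENNReal.mul_ne_top hc₁ hc₂, fun s g hs hg => ?_⟩
  -- the set where the kernel lives
  set S : Set (Vec n × Vec n) := {p | p.1 ∈ Metric.ball 0 s ∧ dist p.2 p.1 ≤ (s - ‖p.1‖) / 4}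
  have hS : MeasurableSet S :=
    (measurable_fst Metric.isOpen_ball.measurableSet).inter
      (measurableSet_le (f := fun p : Vec n × Vec n => dist p.2 p.1) (by fun_prop) (by fun_prop))
  set k : Vec n → Vec n → ENNReal := fun x z =>
    S.indicator (fun p => ENNReal.ofReal ((s - ‖p.1‖) ^ (-α - n)) * g p.2) (x, z)
  have hk : Measurable (Function.uncurry k) := by
    refine Measurable.indicator (Measurable.mul ?_ (hg.comp measurable_snd)) hS
    exact (measurable_dist_rpow s (-α - n)).comp measurable_fst
  have h1 : ∀ x ∈ Metric.ball (0 : Vec n) s,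
      ENNReal.ofReal ((s - ‖x‖) ^ (-α)) * ballAvg s g x ≤ c₁ * ∫⁻ z, k x z := by
    intro x hx
    have hx' : ‖x‖ < s := by simpa using hx
    have hd : 0 < s - ‖x‖ := by linarith
    have e : ∫⁻ z, k x z = ENNReal.ofReal ((s - ‖x‖) ^ (-α - n)) *
        ∫⁻ z in Metric.closedBall x ((s - ‖x‖) / 4), g z := by
      rw [← lintegral_const_mul' _ _ ENNReal.ofReal_ne_top,
        ← lintegral_indicator Metric.isClosed_closedBall.measurableSet]
      congr 1 with z
      simp only [k, indicator, S, mem_ofPred_eq, hx, true_and, Metric.mem_closedBall]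
    rw [e, sub_eq_add_neg (-α), Real.rpow_add hd, ENNReal.ofReal_mul (by positivity)]
    calc _ ≤ ENNReal.ofReal ((s - ‖x‖) ^ (-α)) * (c₁ * (ENNReal.ofReal ((s - ‖x‖) ^ (-(n : ℝ))) *
          ∫⁻ z in Metric.closedBall x ((s - ‖x‖) / 4), g z)) := by
          gcongr; exact ballAvg_le hs g hx'
      _ = _ := by ring
  have h2 : ∀ z, ∫⁻ x, k x z ≤ (Metric.ball (0 : Vec n) s).indicator
      (fun z => c₂ * (ENNReal.ofReal ((s - ‖z‖) ^ (-α)) * g z)) z := by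
    intro z
    by_cases hz : z ∈ Metric.ball (0 : Vec n) s
    · rw [indicator_of_mem hz]
      have hz' : ‖z‖ < s := by simpa using hz
      have hd : 0 < s - ‖z‖ := by linarith
      have hkz : ∀ x, k x z ≤ (Metric.closedBall z (s - ‖z‖)).indicator
          (fun _ => ENNReal.ofReal ((5 / 4) ^ (α + n) * (s - ‖z‖) ^ (-α - n)) * g z) x := by
        intro x
        by_cases hxz : (x, z) ∈ S
        · have hx' : ‖x‖ < s := by simpa using hxz.1
          have hdx : 0 < s - ‖x‖ := by linarith
          have hdist : dist z x ≤ (s - ‖x‖) / 4 := hxz.2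
          rw [dist_eq_norm] at hdist
          have t1 : ‖z‖ - ‖x‖ ≤ ‖z - x‖ := norm_sub_norm_le z x
          have t2 : ‖x‖ - ‖z‖ ≤ ‖z - x‖ := by rw [norm_sub_rev]; exact norm_sub_norm_le x z
          rw [indicator_of_mem]
          · simp only [k, indicator_of_mem hxz]
            refine mul_le_mul' (ENNReal.ofReal_le_ofReal ?_) le_rfl
            have h3 : (4 / 5 : ℝ) * (s - ‖z‖) ≤ s - ‖x‖ := by linarith
            have h4 : (s - ‖x‖) ^ (-α - n) ≤ ((4 / 5 : ℝ) * (s - ‖z‖)) ^ (-α - n) :=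
              Real.rpow_le_rpow_of_nonpos (by positivity) h3
                (by have : (0:ℝ) ≤ n := Nat.cast_nonneg n; linarith)
            refine h4.trans_eq ?_
            rw [Real.mul_rpow (by norm_num) hd.le, show -α - (n:ℝ) = -(α + n) by ring,
              Real.rpow_neg (by norm_num), ← Real.inv_rpow (by norm_num)]
            norm_num
          · rw [Metric.mem_closedBall, dist_comm, dist_eq_norm]
            linarith
        · simp only [k, indicator_of_notMem hxz]
          exact zero_le
      refine (lintegral_mono hkz).trans ?_
      rw [lintegral_indicator Metric.isClosed_closedBall.measurableSet, setLIntegral_const,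
        Measure.addHaar_closedBall volume z hd.le, finrank_euclideanSpace_fin,
        ENNReal.ofReal_mul (by positivity)]
      have e2 : ENNReal.ofReal ((s - ‖z‖) ^ (-α - n)) * ENNReal.ofReal ((s - ‖z‖) ^ n)
          = ENNReal.ofReal ((s - ‖z‖) ^ (-α)) := by
        rw [← ENNReal.ofReal_mul (by positivity), ← Real.rpow_natCast, ← Real.rpow_add hd]
        ring_nf
      have e3 : volume (Metric.ball (0 : Vec n) 1) = volume (Metric.closedBall (0 : Vec n) 1) :=
        (Measure.addHaar_unitClosedBall_eq_addHaar_unitBall volume).symm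
      rw [e3, ← e2]
      simp only [c₂]
      exact le_of_eq (by ring)
    · rw [indicator_of_notMem hz]
      refine le_of_eq (lintegral_eq_zero_of_ae_eq_zero (Eventually.of_forall fun x => ?_))
      refine indicator_of_notMem (fun hxz => hz ?_) _
      have hx' : ‖x‖ < s := by simpa using hxz.1
      have hdist : dist z x ≤ (s - ‖x‖) / 4 := hxz.2
      rw [dist_eq_norm] at hdist
      have t1 : ‖z‖ - ‖x‖ ≤ ‖z - x‖ := norm_sub_norm_le z x
      rw [mem_ball_zero_iff]
      linarith
  calc _ ≤ ∫⁻ x in Metric.ball 0 s, c₁ * ∫⁻ z, k x z :=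
        setLIntegral_mono' Metric.isOpen_ball.measurableSet h1
    _ ≤ ∫⁻ x, c₁ * ∫⁻ z, k x z := setLIntegral_le_lintegral _ _
    _ = c₁ * ∫⁻ z, ∫⁻ x, k x z := by
        rw [lintegral_const_mul' _ _ hc₁, lintegral_lintegral_swap hk.aemeasurable]
    _ ≤ c₁ * ∫⁻ z, (Metric.ball (0 : Vec n) s).indicator
          (fun z => c₂ * (ENNReal.ofReal ((s - ‖z‖) ^ (-α)) * g z)) z := by
        gcongr with z; exact h2 z
    _ = _ := by
        rw [lintegral_indicator Metric.isOpen_ball.measurableSet, lintegral_const_mul' _ _ hc₂]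
        exact (mul_assoc c₁ c₂ _).symm

/-- The averaging operator is bounded on `L¹`. -/
theorem exists_lintegral_ballAvg_le' (n : ℕ) :
    ∃ C : ENNReal, C ≠ ⊤ ∧ ∀ (s : ℝ) (g : Vec n → ENNReal), 0 < s → Measurable g →
      ∫⁻ x in Metric.ball 0 s, ballAvg s g x ≤ C * ∫⁻ x in Metric.ball 0 s, g x := by
  obtain ⟨C, hC, h⟩ := exists_lintegral_ballAvg_le n le_rfl
  exact ⟨C, hC, fun s g hs hg => by simpa using h s g hs hg⟩

/-- The averages gain integrability: with `α = n (1 - 1/β)`, the weighted `L¹` norm of `g` controls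
the `L^β` norm of its averages, since `(α - n)(β - 1) = -α`. -/
theorem exists_lintegral_ballAvg_rpow_le (n : ℕ) {β : ℝ} (hβ : 1 ≤ β) :
    ∃ C : ENNReal, C ≠ ⊤ ∧ ∀ (s : ℝ) (g : Vec n → ENNReal), 0 < s → Measurable g →
      ∫⁻ x in Metric.ball 0 s, ballAvg s g x ^ β ≤
        C * (∫⁻ x in Metric.ball 0 s, ENNReal.ofReal ((s - ‖x‖) ^ (-(n * (1 - β⁻¹)))) * g x) ^ β := by
  have hβ0 : 0 < β := by linarith
  have hβ1 : 0 ≤ β - 1 := by linarith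
  set α : ℝ := n * (1 - β⁻¹) with hαdef
  have hα : 0 ≤ α := mul_nonneg (Nat.cast_nonneg n) (sub_nonneg.2 (inv_le_one_of_one_le₀ hβ))
  obtain ⟨C, hC, h⟩ := exists_lintegral_ballAvg_le n hα
  set c₁ := (volume (Metric.closedBall (0 : Vec n) 1))⁻¹ * ENNReal.ofReal (8 ^ n)
  have hc₁ : c₁ ≠ ⊤ := ENNReal.mul_ne_top
    (ENNReal.inv_ne_top.2 (volume_closedBall_one_ne_zero n)) ENNReal.ofReal_ne_top
  set c₂ := c₁ * ENNReal.ofReal ((5 / 4) ^ α)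
  have hc₂ : c₂ ≠ ⊤ := ENNReal.mul_ne_top hc₁ ENNReal.ofReal_ne_top
  refine ⟨c₂ ^ (β - 1) * C, ENNReal.mul_ne_top (ENNReal.rpow_ne_top_of_nonneg hβ1 hc₂) hC,
    fun s g hs hg => ?_⟩
  set K := ∫⁻ x in Metric.ball 0 s, ENNReal.ofReal ((s - ‖x‖) ^ (-α)) * g x with hK
  have hpt : ∀ x ∈ Metric.ball (0 : Vec n) s,
      ballAvg s g x ≤ c₂ * K * ENNReal.ofReal ((s - ‖x‖) ^ (α - n)) := by
    intro x hx
    have hx' : ‖x‖ < s := by simpa using hx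
    have hd : 0 < s - ‖x‖ := by linarith
    have hI : ∫⁻ z in Metric.closedBall x ((s - ‖x‖) / 4), g z ≤
        ENNReal.ofReal ((5 / 4) ^ α * (s - ‖x‖) ^ α) * K := by
      have hsub : Metric.closedBall x ((s - ‖x‖) / 4) ⊆ Metric.ball 0 s := by
        intro z hz
        rw [Metric.mem_closedBall, dist_eq_norm] at hz
        have t1 : ‖z‖ - ‖x‖ ≤ ‖z - x‖ := norm_sub_norm_le z x
        rw [mem_ball_zero_iff]
        linarith
      rw [hK, ← lintegral_const_mul' _ _ ENNReal.ofReal_ne_top]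
      refine le_trans ?_ (lintegral_mono_set hsub)
      refine setLIntegral_mono' Metric.isClosed_closedBall.measurableSet fun z hz => ?_
      have hz' : ‖z‖ < s := by simpa using hsub hz
      have hdz : 0 < s - ‖z‖ := by linarith
      rw [Metric.mem_closedBall, dist_eq_norm] at hz
      have t2 : ‖x‖ - ‖z‖ ≤ ‖z - x‖ := by rw [norm_sub_rev]; exact norm_sub_norm_le x z
      rw [← mul_assoc, ← ENNReal.ofReal_mul (by positivity), ← Real.mul_rpow (by norm_num) hd.le,
        Real.rpow_neg hdz.le, ← div_eq_mul_inv, ← Real.div_rpow (by positivity) hdz.le]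
      refine le_mul_of_one_le_left' (ENNReal.one_le_ofReal.2 (Real.one_le_rpow ?_ hα))
      rw [one_le_div hdz]
      linarith
    refine (ballAvg_le hs g hx').trans ?_
    calc c₁ * (ENNReal.ofReal ((s - ‖x‖) ^ (-(n : ℝ))) *
          ∫⁻ z in Metric.closedBall x ((s - ‖x‖) / 4), g z)
        ≤ c₁ * (ENNReal.ofReal ((s - ‖x‖) ^ (-(n : ℝ))) *
          (ENNReal.ofReal ((5 / 4) ^ α * (s - ‖x‖) ^ α) * K)) := by gcongr
      _ = c₂ * K * ENNReal.ofReal ((s - ‖x‖) ^ (α - n)) := by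
          rw [ENNReal.ofReal_mul (by positivity), sub_eq_add_neg α, Real.rpow_add hd,
            ENNReal.ofReal_mul (by positivity)]
          simp only [c₂]
          ring
  have hexp : (α - n) * (β - 1) = -α := by
    rw [hαdef]; field_simp; ring
  have hpt2 : ∀ x ∈ Metric.ball (0 : Vec n) s, ballAvg s g x ^ β ≤
      (c₂ * K) ^ (β - 1) * (ENNReal.ofReal ((s - ‖x‖) ^ (-α)) * ballAvg s g x) := by
    intro x hx
    have hx' : ‖x‖ < s := by simpa using hx
    have hd : 0 < s - ‖x‖ := by linarith
    calc ballAvg s g x ^ β = ballAvg s g x ^ (β - 1) * ballAvg s g x := by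
          conv_lhs => rw [show β = (β - 1) + 1 by ring, ENNReal.rpow_add_of_nonneg _ _ hβ1
            zero_le_one, ENNReal.rpow_one]
      _ ≤ (c₂ * K * ENNReal.ofReal ((s - ‖x‖) ^ (α - n))) ^ (β - 1) * ballAvg s g x := by
          gcongr
          exact hpt x hx
      _ = _ := by
          rw [ENNReal.mul_rpow_of_nonneg _ _ hβ1, ENNReal.ofReal_rpow_of_nonneg (by positivity) hβ1,
            ← Real.rpow_mul hd.le, hexp, mul_assoc]
  have hmeas : Measurable fun x : Vec n =>
      ENNReal.ofReal ((s - ‖x‖) ^ (-α)) * ballAvg s g x :=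
    (measurable_dist_rpow s (-α)).mul (measurable_ballAvg hg)
  calc _ ≤ ∫⁻ x in Metric.ball 0 s,
        (c₂ * K) ^ (β - 1) * (ENNReal.ofReal ((s - ‖x‖) ^ (-α)) * ballAvg s g x) :=
        setLIntegral_mono' Metric.isOpen_ball.measurableSet hpt2
    _ ≤ (c₂ * K) ^ (β - 1) * (C * K) := by
        rw [lintegral_const_mul _ hmeas]
        gcongr
        exact h s g hs hg
    _ = c₂ ^ (β - 1) * C * K ^ β := by
        rw [ENNReal.mul_rpow_of_nonneg _ _ hβ1]
        conv_rhs => rw [show β = (β - 1) + 1 by ring, ENNReal.rpow_add_of_nonneg _ _ hβ1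
            zero_le_one, ENNReal.rpow_one, show β - 1 + 1 - 1 = β - 1 by ring]
        ring

/-- A radius `s` for which the weighted integral is controlled by the unweighted one: the average
over `s` of `(s - |x|)^(-α)` is bounded, because `α < 1`. -/
theorem exists_good_radius {α : ℝ} (hα1 : α < 1) {a b : ℝ} (hab : a < b)
    (hb : b ≤ 1) {g : Vec n → ENNReal} (hg : Measurable g) :
    ∃ s ∈ Ioo a b, ∫⁻ x in Metric.ball 0 s, ENNReal.ofReal ((s - ‖x‖) ^ (-α)) * g x ≤
      ENNReal.ofReal (1 / (1 - α) / (b - a)) * ∫⁻ x in Metric.ball 0 b, g x := by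
  set S : Set (ℝ × Vec n) := {p | ‖p.2‖ < p.1}
  have hS : MeasurableSet S := (isOpen_lt (by fun_prop) (by fun_prop)).measurableSet
  set k : ℝ → Vec n → ENNReal := fun s x =>
    S.indicator (fun p => ENNReal.ofReal ((p.1 - ‖p.2‖) ^ (-α)) * g p.2) (s, x)
  have hk : Measurable (Function.uncurry k) := by
    refine Measurable.indicator (Measurable.mul ?_ (hg.comp measurable_snd)) hS
    fun_prop
  have e1 : ∀ s, ∫⁻ x in Metric.ball 0 s, ENNReal.ofReal ((s - ‖x‖) ^ (-α)) * g x
      = ∫⁻ x, k s x := fun s => by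
    rw [← lintegral_indicator Metric.isOpen_ball.measurableSet]
    congr 1 with x
    simp only [k, indicator, S, mem_ofPred_eq, mem_ball_zero_iff]
  have hone : ∫⁻ t in Ioo (0:ℝ) 1, ENNReal.ofReal (t ^ (-α)) = ENNReal.ofReal (1 / (1 - α)) := by
    have hint : IntegrableOn (fun t : ℝ => t ^ (-α)) (Ioo 0 1) :=
      (intervalIntegral.integrableOn_Ioo_rpow_iff one_pos).2 (by linarith)
    rw [← ofReal_integral_eq_lintegral_ofReal hint]
    · rw [← integral_Ioc_eq_integral_Ioo, ← intervalIntegral.integral_of_le zero_le_one,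
        integral_rpow (Or.inl (by linarith))]
      congr 1
      rw [Real.one_rpow, Real.zero_rpow (by linarith), sub_zero, neg_add_eq_sub]
    · filter_upwards [ae_restrict_mem measurableSet_Ioo] with t ht
      exact Real.rpow_nonneg ht.1.le _
  have h2 : ∀ x, ∫⁻ s in Ioo a b, k s x ≤
      (Metric.ball (0 : Vec n) b).indicator (fun x => ENNReal.ofReal (1 / (1 - α)) * g x) x := by
    intro x
    by_cases hx : x ∈ Metric.ball (0 : Vec n) b
    · rw [indicator_of_mem hx, ← hone, ← lintegral_mul_const _ (by fun_prop),
        ← lintegral_indicator measurableSet_Ioo, ← lintegral_indicator measurableSet_Ioo,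
        ← lintegral_sub_right_eq_self (indicator (Ioo (0:ℝ) 1) _) ‖x‖]
      refine lintegral_mono fun s => ?_
      by_cases hs : s ∈ Ioo a b
      · rw [indicator_of_mem hs]
        by_cases hxs : ‖x‖ < s
        · have hmem : s - ‖x‖ ∈ Ioo (0:ℝ) 1 :=
            ⟨by linarith, by linarith [hs.2, norm_nonneg x]⟩
          rw [indicator_of_mem hmem]
          simp only [k]
          rw [indicator_of_mem (show (s, x) ∈ S from hxs)]
        · simp only [k]
          rw [indicator_of_notMem (show (s, x) ∉ S from hxs)]
          exact zero_le
      · rw [indicator_of_notMem hs]; exact zero_le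
    · rw [indicator_of_notMem hx]
      refine le_of_eq (setLIntegral_eq_zero measurableSet_Ioo fun s hs => ?_)
      refine indicator_of_notMem (fun hxs => hx ?_) _
      rw [mem_ball_zero_iff]
      exact lt_trans hxs hs.2
  have h3 : ∫⁻ s in Ioo a b, ∫⁻ x, k s x ≤
      ENNReal.ofReal (1 / (1 - α)) * ∫⁻ x in Metric.ball 0 b, g x := by
    rw [lintegral_lintegral_swap hk.aemeasurable]
    refine (lintegral_mono h2).trans ?_
    rw [lintegral_indicator Metric.isOpen_ball.measurableSet,
      lintegral_const_mul' _ _ ENNReal.ofReal_ne_top]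
  have hvol : volume (Ioo a b) = ENNReal.ofReal (b - a) := Real.volume_Ioo
  have hpos : 0 < b - a := by linarith
  obtain ⟨s, hs, hle⟩ := exists_le_setLAverage (μ := volume) (s := Ioo a b)
    (f := fun s => ∫⁻ x, k s x) (by rw [hvol]; simpa using hpos) (by rw [hvol]; simp)
    hk.lintegral_prod_right.aemeasurable
  refine ⟨s, hs, ?_⟩
  rw [e1]
  refine hle.trans ?_
  rw [setLAverage_eq, hvol, ENNReal.ofReal_div_of_pos hpos, ENNReal.div_eq_inv_mul,
    ENNReal.div_eq_inv_mul, mul_assoc]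
  gcongr

end Averages

/-! ### The smoothing operator that preserves traces on a sphere -/

section Smoothing

variable {n N : ℕ} {s : ℝ}

/-- The matrix `G (1 + y ⊗ b)`: the gradient of `w(x + θ(x) y)` if `G = Dw` and `b = ∇θ`. -/
noncomputable def twist (G : Mat N n) (y b : Vec n) : Mat N n :=
  WithLp.toLp 2 fun ij => G ij + (∑ k, G (ij.1, k) * y k) * b ij.2

theorem twist_apply (G : Mat N n) (y b : Vec n) (i : Fin N) (j : Fin n) :
    twist G y b (i, j) = G (i, j) + (∑ k, G (i, k) * y k) * b j := rfl

theorem twist_sub (G G' : Mat N n) (y b : Vec n) :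
    twist (G - G') y b = twist G y b - twist G' y b := by
  ext ⟨i, j⟩
  simp only [twist_apply, PiLp.sub_apply, sub_mul, Finset.sum_sub_distrib]
  ring

theorem norm_twist_le (G : Mat N n) (y b : Vec n) :
    ‖twist G y b‖ ≤ (1 + ‖y‖ * ‖b‖) * ‖G‖ := by
  set R : Mat N n := WithLp.toLp 2 fun ij => (∑ k, G (ij.1, k) * y k) * b ij.2 with hR
  have e : twist G y b = G + R := by ext ⟨i, j⟩; rfl
  have hRn : ‖R‖ ≤ ‖y‖ * ‖b‖ * ‖G‖ := by
    refine abs_le_of_sq_le_sq' ?_ (by positivity) |>.2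
    rw [mul_pow, mul_pow, EuclideanSpace.real_norm_sq_eq, EuclideanSpace.real_norm_sq_eq,
      EuclideanSpace.real_norm_sq_eq, EuclideanSpace.real_norm_sq_eq, Fintype.sum_prod_type,
      Fintype.sum_prod_type]
    have h1 : ∀ i, ∑ j, R (i, j) ^ 2 ≤ (∑ k, y k ^ 2) * (∑ j, b j ^ 2) * ∑ k, G (i, k) ^ 2 := by
      intro i
      have h2 : ∀ j, R (i, j) ^ 2 = (∑ k, G (i, k) * y k) ^ 2 * b j ^ 2 := fun j => mul_pow _ _ _
      simp only [h2]
      rw [← Finset.mul_sum]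
      have := Finset.sum_mul_sq_le_sq_mul_sq Finset.univ (fun k => G (i, k)) (fun k => y k)
      calc _ ≤ ((∑ k, G (i, k) ^ 2) * ∑ k, y k ^ 2) * ∑ j, b j ^ 2 := by gcongr
        _ = _ := by ring
    calc _ ≤ ∑ i, (∑ k, y k ^ 2) * (∑ j, b j ^ 2) * ∑ k, G (i, k) ^ 2 :=
          Finset.sum_le_sum fun i _ => h1 i
      _ = _ := by rw [← Finset.mul_sum]
  rw [e]
  refine (norm_add_le _ _).trans ?_
  linarith

theorem continuous_twist :
    Continuous fun p : Mat N n × Vec n × Vec n => twist p.1 p.2.1 p.2.2 := by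
  refine (PiLp.continuous_toLp 2 _).comp (continuous_pi fun ij => ?_)
  fun_prop

/-- `T w(x)`: the average of `w` over the ball of radius `θ(x)` centred at `x`. -/
noncomputable def smoothing (s : ℝ) (w : Vec n → Vec N) (x : Vec n) : Vec N :=
  ∫ y, w (x + avgRadius s x • y) ∂(ballProb n)

/-- The gradient of `T w`, expressed through `G = Dw`; here `-(4 s)⁻¹ • x` is `∇θ(x)`. -/
noncomputable def smoothingGrad (s : ℝ) (G : Vec n → Mat N n) (x : Vec n) : Mat N n :=
  ∫ y, twist (G (x + avgRadius s x • y)) y (-(4 * s)⁻¹ • x) ∂(ballProb n)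

theorem hasFDerivAt_avgRadius (x : Vec n) :
    HasFDerivAt (avgRadius s) (innerSL ℝ (-(4 * s)⁻¹ • x)) x := by
  have h1 := ((hasStrictFDerivAt_norm_sq x).hasFDerivAt.const_sub (s ^ 2)).const_mul (8 * s)⁻¹
  refine (h1.congr_of_eventuallyEq (Eventually.of_forall fun y => ?_)).congr_fderiv ?_
  · simp only [avgRadius]; ring
  · ext v
    simp only [map_smul, smul_apply, neg_apply, innerSL_apply_apply, smul_eq_mul, nsmul_eq_mul,
      mul_inv_rev, Nat.cast_ofNat]
    ring

theorem continuous_innerSL_comp : Continuous fun x : Vec n => innerSL ℝ (-(4 * s)⁻¹ • x) :=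
  (innerSL ℝ (E := Vec n)).continuous.comp (by fun_prop)

/-- The derivative of `x ↦ w(x + θ(x) y)`. -/
noncomputable def smoothingFDeriv (s : ℝ) (w : Vec n → Vec N) (x y : Vec n) : Vec n →L[ℝ] Vec N :=
  (fderiv ℝ w (x + avgRadius s x • y)).comp
    (ContinuousLinearMap.id ℝ (Vec n) + (innerSL ℝ (-(4 * s)⁻¹ • x)).smulRight y)

theorem continuous_smoothingFDeriv {w : Vec n → Vec N} (hw : ContDiff ℝ 1 w) :
    Continuous (Function.uncurry (smoothingFDeriv s w)) := by
  have h1 : Continuous fun p : Vec n × Vec n => fderiv ℝ w (p.1 + avgRadius s p.1 • p.2) :=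
    (hw.continuous_fderiv one_ne_zero).comp (continuous_fst.add
      ((continuous_avgRadius.comp continuous_fst).smul continuous_snd))
  refine h1.clm_comp (continuous_const.add ?_)
  exact (((ContinuousLinearMap.smulRightL ℝ (Vec n) (Vec n)).continuous.comp
    (continuous_innerSL_comp.comp continuous_fst)).clm_apply continuous_snd)

theorem integrable_ballProb_of_continuous {E : Type*} [NormedAddCommGroup E] {f : Vec n → E}
    (hf : Continuous f) : Integrable f (ballProb n) :=
  Integrable.smul_measure (hf.continuousOn.integrableOn_compact (isCompact_closedBall 0 1))
    (ENNReal.inv_ne_top.2 (volume_closedBall_one_ne_zero n))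

theorem continuous_integral_ballProb {E : Type*} [NormedAddCommGroup E] [NormedSpace ℝ E]
    {f : Vec n → Vec n → E} (hf : Continuous (Function.uncurry f)) :
    Continuous fun x => ∫ y, f x y ∂(ballProb n) := by
  simp only [ballProb, integral_smul_measure]
  exact (continuous_parametric_integral_of_continuous hf (isCompact_closedBall 0 1)).const_smul _

theorem hasFDerivAt_smoothing {w : Vec n → Vec N} (hw : ContDiff ℝ 1 w) (x : Vec n) :
    HasFDerivAt (smoothing s w) (∫ y, smoothingFDeriv s w x y ∂(ballProb n)) x := by
  have hcont := continuous_smoothingFDeriv (s := s) hw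
  have hwc : Continuous fun p : Vec n × Vec n => w (p.1 + avgRadius s p.1 • p.2) :=
    hw.continuous.comp (continuous_fst.add
      ((continuous_avgRadius.comp continuous_fst).smul continuous_snd))
  obtain ⟨C, hC⟩ := ((isCompact_closedBall x 1).prod
    (isCompact_closedBall (0 : Vec n) 1)).exists_bound_of_continuousOn hcont.continuousOn
  refine hasFDerivAt_integral_of_dominated_of_fderiv_le (bound := fun _ => C)
    (Metric.ball_mem_nhds x one_pos) ?_ ?_ ?_ ?_ (integrable_const C) ?_
  · exact Eventually.of_forall fun x' => (hwc.comp (by fun_prop :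
      Continuous fun y : Vec n => (x', y))).aestronglyMeasurable
  · exact integrable_ballProb_of_continuous (hwc.comp (by fun_prop :
      Continuous fun y : Vec n => (x, y)))
  · exact (hcont.comp (by fun_prop : Continuous fun y : Vec n => (x, y))).aestronglyMeasurable
  · filter_upwards [ae_ballProb_norm_le n] with y hy x' hx'
    exact hC (x', y) ⟨Metric.ball_subset_closedBall hx', by simpa using hy⟩
  · refine Eventually.of_forall fun y x' _ => ?_
    have h1 : HasFDerivAt (fun x' => x' + avgRadius s x' • y)
        (ContinuousLinearMap.id ℝ (Vec n) + (innerSL ℝ (-(4 * s)⁻¹ • x')).smulRight y) x' :=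
      (hasFDerivAt_id x').add ((hasFDerivAt_avgRadius x').smul_const y)
    exact (hw.differentiable one_ne_zero _).hasFDerivAt.comp x' h1

theorem continuous_integral_smoothingFDeriv {w : Vec n → Vec N} (hw : ContDiff ℝ 1 w) :
    Continuous fun x => ∫ y, smoothingFDeriv s w x y ∂(ballProb n) :=
  continuous_integral_ballProb (continuous_smoothingFDeriv hw)

theorem gradMat_smoothing {w : Vec n → Vec N} (hw : ContDiff ℝ 1 w) (x : Vec n) :
    gradMat (smoothing s w) x = smoothingGrad s (gradMat w) x := by
  have hfd : Continuous fun y => smoothingFDeriv s w x y :=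
    (continuous_smoothingFDeriv (s := s) hw).comp (by fun_prop : Continuous fun y : Vec n => (x, y))
  have hg : Continuous fun y => twist (gradMat w (x + avgRadius s x • y)) y (-(4 * s)⁻¹ • x) :=
    continuous_twist.comp (((continuous_gradMat hw).comp (by fun_prop)).prodMk
      (continuous_id.prodMk continuous_const))
  ext ⟨i, j⟩
  rw [gradMat_apply, (hasFDerivAt_smoothing hw x).fderiv, smoothingGrad,
    ContinuousLinearMap.integral_apply (integrable_ballProb_of_continuous hfd)]
  have e1 := (EuclideanSpace.proj (𝕜 := ℝ) i).integral_comp_comm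
    (integrable_ballProb_of_continuous (hfd.clm_apply (continuous_const
      (y := EuclideanSpace.single j (1:ℝ)))))
  have e2 := (EuclideanSpace.proj (𝕜 := ℝ) (i, j)).integral_comp_comm
    (integrable_ballProb_of_continuous hg)
  refine e1.symm.trans (Eq.trans (integral_congr_ae (Eventually.of_forall fun y => ?_)) e2)
  simp only [PiLp.proj_apply, smoothingFDeriv, ContinuousLinearMap.comp_apply,
    add_apply, ContinuousLinearMap.id_apply, ContinuousLinearMap.smulRight_apply,
    map_add, map_smul, twist_apply, gradMat_apply, PiLp.smul_apply, smul_eq_mul]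
  set L := fderiv ℝ w (x + avgRadius s x • y)
  have hy : L y i = ∑ k, L (EuclideanSpace.single k 1) i * y k := by
    conv_lhs => rw [← (EuclideanSpace.basisFun (Fin n) ℝ).sum_repr y]
    rw [map_sum]
    simp [mul_comm]
  have hb : (-(4 * s)⁻¹ • (innerSL ℝ) x) (EuclideanSpace.single j 1) = -(4 * s)⁻¹ * x j := by
    have h := EuclideanSpace.inner_single_right (𝕜 := ℝ) j (1:ℝ) x
    simp only [smul_apply, innerSL_apply_apply, smul_eq_mul, h]
    simp
  rw [hy, hb, mul_comm (∑ k, _)]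

/-- A `C¹` function that vanishes to first order on a sphere may be extended by zero outside. -/
theorem hasFDerivAt_indicator_ball {H : Vec n → Vec N} (hH : ContDiff ℝ 1 H)
    (h0 : ∀ x, ‖x‖ = s → H x = 0) (h1 : ∀ x, ‖x‖ = s → fderiv ℝ H x = 0) (x : Vec n) :
    HasFDerivAt ((Metric.ball 0 s).indicator H) ((Metric.ball 0 s).indicator (fderiv ℝ H) x) x := by
  have hd : HasFDerivAt H (fderiv ℝ H x) x := (hH.differentiable one_ne_zero x).hasFDerivAt
  rcases lt_trichotomy ‖x‖ s with hx | hx | hx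
  · have hmem : x ∈ Metric.ball (0 : Vec n) s := by simpa using hx
    rw [indicator_of_mem hmem]
    refine hd.congr_of_eventuallyEq ?_
    filter_upwards [Metric.isOpen_ball.mem_nhds hmem] with y hy using indicator_of_mem hy _
  · have hmem : x ∉ Metric.ball (0 : Vec n) s := by simp [hx]
    rw [indicator_of_notMem hmem]
    rw [h1 x hx] at hd
    rw [hasFDerivAt_iff_isLittleO_nhds_zero] at hd ⊢
    rw [h0 x hx] at hd
    rw [indicator_of_notMem hmem]
    refine Asymptotics.IsBigO.trans_isLittleO (Asymptotics.IsBigO.of_bound 1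
      (Eventually.of_forall fun y => ?_)) hd
    simp only [sub_zero, zero_apply, one_mul]
    exact norm_indicator_le_norm_self _ _
  · have hmem : x ∉ Metric.closedBall (0 : Vec n) s := by simpa using hx
    rw [indicator_of_notMem fun h => hmem (Metric.ball_subset_closedBall h)]
    refine (hasFDerivAt_const (0 : Vec N) x).congr_of_eventuallyEq ?_
    filter_upwards [Metric.isClosed_closedBall.isOpen_compl.mem_nhds hmem] with y hy
    exact indicator_of_notMem (fun h => hy (Metric.ball_subset_closedBall h)) _

theorem contDiff_indicator_ball {H : Vec n → Vec N} (hH : ContDiff ℝ 1 H)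
    (h0 : ∀ x, ‖x‖ = s → H x = 0) (h1 : ∀ x, ‖x‖ = s → fderiv ℝ H x = 0) :
    ContDiff ℝ 1 ((Metric.ball 0 s).indicator H) ∧
      gradMat ((Metric.ball 0 s).indicator H) = (Metric.ball 0 s).indicator (gradMat H) := by
  have hd := hasFDerivAt_indicator_ball hH h0 h1
  refine ⟨contDiff_one_iff_hasFDerivAt.2 ⟨_, ?_, hd⟩, ?_⟩
  · refine (hH.continuous_fderiv one_ne_zero).indicator fun x hx => h1 x ?_
    have := Metric.frontier_ball_subset_sphere hx
    simpa using this
  · ext x ij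
    by_cases hx : x ∈ Metric.ball (0 : Vec n) s
    · simp [gradMat, (hd x).fderiv, hx]
    · simp [gradMat, (hd x).fderiv, hx]

theorem contDiff_smoothing {w : Vec n → Vec N} (hw : ContDiff ℝ 1 w) :
    ContDiff ℝ 1 (smoothing s w) :=
  contDiff_one_iff_hasFDerivAt.2 ⟨_, continuous_integral_smoothingFDeriv hw,
    hasFDerivAt_smoothing hw⟩

theorem integral_ballProb_id (n : ℕ) : ∫ y, y ∂(ballProb n) = 0 := by
  rw [ballProb, integral_smul_measure]
  have h : ∫ y in Metric.closedBall (0 : Vec n) 1, y = 0 := by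
    rw [← integral_indicator Metric.isClosed_closedBall.measurableSet]
    have h1 := integral_neg_eq_self
      ((Metric.closedBall (0 : Vec n) 1).indicator fun y => y) volume
    have h2 : ∀ y : Vec n, (Metric.closedBall (0 : Vec n) 1).indicator (fun y => y) (-y)
        = -(Metric.closedBall (0 : Vec n) 1).indicator (fun y => y) y := fun y => by
      by_cases hy : y ∈ Metric.closedBall (0 : Vec n) 1
      · have hy' : -y ∈ Metric.closedBall (0 : Vec n) 1 := by simpa using hy
        rw [indicator_of_mem hy, indicator_of_mem hy']
      · have hy' : -y ∉ Metric.closedBall (0 : Vec n) 1 := by simpa using hy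
        rw [indicator_of_notMem hy, indicator_of_notMem hy', neg_zero]
    simp only [h2, integral_neg] at h1
    set I := ∫ y, (Metric.closedBall (0 : Vec n) 1).indicator (fun y => y) y
    have h3 : (2 : ℝ) • I = 0 := by
      rw [two_smul]
      nth_rewrite 1 [← h1]
      exact neg_add_cancel I
    exact (smul_eq_zero.1 h3).resolve_left two_ne_zero
  rw [h, smul_zero]

/-- On the sphere `T w` agrees with `w` to first order: the radius vanishes there, and `∫ y = 0`. -/
theorem smoothing_eq_on_sphere (w : Vec n → Vec N) {x : Vec n} (hx : ‖x‖ = s) :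
    smoothing s w x = w x := by
  have : avgRadius s x = 0 := by simp [avgRadius, hx]
  simp [smoothing, this]

theorem fderiv_smoothing_eq_on_sphere {w : Vec n → Vec N} (hw : ContDiff ℝ 1 w) {x : Vec n}
    (hx : ‖x‖ = s) : fderiv ℝ (smoothing s w) x = fderiv ℝ w x := by
  have h0 : avgRadius s x = 0 := by simp [avgRadius, hx]
  have hfd : Continuous fun y => smoothingFDeriv s w x y :=
    (continuous_smoothingFDeriv (s := s) hw).comp (by fun_prop : Continuous fun y : Vec n => (x, y))
  rw [(hasFDerivAt_smoothing hw x).fderiv]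
  ext1 v
  rw [ContinuousLinearMap.integral_apply (integrable_ballProb_of_continuous hfd)]
  simp only [smoothingFDeriv, h0, zero_smul, add_zero, ContinuousLinearMap.comp_apply,
    add_apply, ContinuousLinearMap.id_apply, ContinuousLinearMap.smulRight_apply,
    map_add, map_smul]
  set L := fderiv ℝ w x
  have hL : Integrable (fun y => L y) (ballProb n) :=
    integrable_ballProb_of_continuous L.continuous
  set c : ℝ := (-(4 * s)⁻¹ • (innerSL ℝ) x) v
  rw [integral_add (f := fun _ => L v) (g := fun y => c • L y) (integrable_const _) (hL.smul c),
    integral_smul,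
    L.integral_comp_comm (integrable_ballProb_of_continuous (f := fun y => y) continuous_id'), integral_ballProb_id]
  simp

end Smoothing

/-! ### Cut-off functions -/

section Cutoff

variable {n N : ℕ}

/-- The matrix `a ⊗ b`. -/
noncomputable def outer (a : Vec N) (b : Vec n) : Mat N n := WithLp.toLp 2 fun ij => a ij.1 * b ij.2

theorem outer_apply (a : Vec N) (b : Vec n) (i : Fin N) (j : Fin n) :
    outer a b (i, j) = a i * b j := rfl

theorem norm_outer (a : Vec N) (b : Vec n) : ‖outer a b‖ = ‖a‖ * ‖b‖ := by
  rw [← sq_eq_sq₀ (norm_nonneg _) (by positivity), mul_pow, EuclideanSpace.real_norm_sq_eq,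
    EuclideanSpace.real_norm_sq_eq, EuclideanSpace.real_norm_sq_eq, Fintype.sum_prod_type,
    Finset.sum_mul_sum]
  simp only [outer_apply, mul_pow]

theorem continuous_outer : Continuous fun p : Vec N × Vec n => outer p.1 p.2 := by
  refine (PiLp.continuous_toLp 2 _).comp (continuous_pi fun ij => ?_)
  fun_prop

/-- The gradient of a scalar function, as a vector of partial derivatives. -/
noncomputable def gradVec (η : Vec n → ℝ) (x : Vec n) : Vec n :=
  WithLp.toLp 2 fun j => fderiv ℝ η x (EuclideanSpace.single j 1)

theorem continuous_gradVec {η : Vec n → ℝ} (hη : ContDiff ℝ 1 η) : Continuous (gradVec η) := by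
  refine (PiLp.continuous_toLp 2 _).comp (continuous_pi fun j => ?_)
  exact (hη.continuous_fderiv one_ne_zero).clm_apply continuous_const

theorem exists_abs_deriv_smoothTransition_le :
    ∃ K, 0 < K ∧ ∀ t, |deriv Real.smoothTransition t| ≤ K := by
  have hc : Continuous (deriv Real.smoothTransition) :=
    (Real.smoothTransition.contDiff (n := 1)).continuous_deriv le_rfl
  have hs : HasCompactSupport (deriv Real.smoothTransition) := by
    refine HasCompactSupport.intro (isCompact_Icc (a := (0:ℝ)) (b := 1)) fun t ht => ?_
    rw [mem_Icc, not_and_or, not_le, not_le] at ht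
    rcases ht with ht | ht
    · have : Real.smoothTransition =ᶠ[𝓝 t] fun _ => 0 := by
        filter_upwards [Iio_mem_nhds ht] with x hx using
          Real.smoothTransition.zero_of_nonpos (le_of_lt hx)
      rw [this.deriv_eq, deriv_const]
    · have : Real.smoothTransition =ᶠ[𝓝 t] fun _ => 1 := by
        filter_upwards [Ioi_mem_nhds ht] with x hx using
          Real.smoothTransition.one_of_one_le (le_of_lt hx)
      rw [this.deriv_eq, deriv_const]
  obtain ⟨K, hK⟩ := hc.bounded_above_of_compact_support hs
  exact ⟨max K 1, by positivity, fun t => (hK t).trans (le_max_left _ _)⟩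

/-- Radial cut-off functions between concentric balls. -/
theorem exists_cutoff (n : ℕ) : ∃ C, 0 < C ∧ ∀ a b : ℝ, 1 / 2 ≤ a → a < b → ∃ η : Vec n → ℝ,
    ContDiff ℝ ∞ η ∧ (∀ x, 0 ≤ η x ∧ η x ≤ 1) ∧ (∀ x, ‖x‖ ≤ a → η x = 1) ∧
      (∀ x, b ≤ ‖x‖ → η x = 0) ∧ ∀ x, ‖gradVec η x‖ ≤ C / (b - a) := by
  obtain ⟨K, hK, hKb⟩ := exists_abs_deriv_smoothTransition_le
  refine ⟨2 * K, by positivity, fun a b ha hab => ?_⟩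
  have hba : 0 < b ^ 2 - a ^ 2 := by nlinarith
  set η : Vec n → ℝ := fun x => Real.smoothTransition ((b ^ 2 - ‖x‖ ^ 2) / (b ^ 2 - a ^ 2)) with hη
  have hηz : ∀ x, b ≤ ‖x‖ → η x = 0 := fun x hx =>
    Real.smoothTransition.zero_of_nonpos (div_nonpos_of_nonpos_of_nonneg (by nlinarith) hba.le)
  have hd : ContDiff ℝ ∞ η := Real.smoothTransition.contDiff.comp
    ((contDiff_const.sub (contDiff_norm_sq ℝ)).div_const _)
  refine ⟨η, hd, fun x => ⟨Real.smoothTransition.nonneg _, Real.smoothTransition.le_one _⟩,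
    fun x hx => Real.smoothTransition.one_of_one_le ?_, hηz, fun x => ?_⟩
  · rw [one_le_div hba]
    nlinarith [norm_nonneg x]
  · have h1 := ((hasStrictFDerivAt_norm_sq x).hasFDerivAt.const_sub (b ^ 2)).const_mul
      (b ^ 2 - a ^ 2)⁻¹
    have h2 : HasFDerivAt (fun x : Vec n => (b ^ 2 - ‖x‖ ^ 2) / (b ^ 2 - a ^ 2)) _ x :=
      h1.congr_of_eventuallyEq (Eventually.of_forall fun y => by
        show (b ^ 2 - ‖y‖ ^ 2) / (b ^ 2 - a ^ 2) = (b ^ 2 - a ^ 2)⁻¹ * (b ^ 2 - ‖y‖ ^ 2)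
        ring)
    have h3 := (Real.smoothTransition.contDiff (n := 1)).differentiable one_ne_zero
      ((b ^ 2 - ‖x‖ ^ 2) / (b ^ 2 - a ^ 2)) |>.hasDerivAt.comp_hasFDerivAt x h2
    set D := deriv Real.smoothTransition ((b ^ 2 - ‖x‖ ^ 2) / (b ^ 2 - a ^ 2))
    have e : gradVec η x = (-(2 * D * (b ^ 2 - a ^ 2)⁻¹)) • x := by
      ext j
      have := h3.fderiv
      change fderiv ℝ η x = _ at this
      rw [gradVec]
      simp only [this, PiLp.smul_apply, smul_eq_mul]
      have hj := EuclideanSpace.inner_single_right (𝕜 := ℝ) j (1:ℝ) x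
      simp only [smul_apply, neg_apply, innerSL_apply_apply, smul_eq_mul, hj, nsmul_eq_mul]
      simp
      ring
    rcases le_or_gt ‖x‖ b with hx | hx
    · rw [e, norm_smul, norm_neg, norm_mul, norm_mul, Real.norm_eq_abs, Real.norm_eq_abs,
        Real.norm_eq_abs, abs_two, abs_of_pos (inv_pos.2 hba), le_div_iff₀ (by linarith)]
      have hDK := hKb ((b ^ 2 - ‖x‖ ^ 2) / (b ^ 2 - a ^ 2))
      have h5 : (b ^ 2 - a ^ 2)⁻¹ * ‖x‖ * (b - a) ≤ 1 := by
        rw [inv_mul_eq_div, div_mul_eq_mul_div, div_le_one hba]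
        nlinarith
      calc 2 * |D| * (b ^ 2 - a ^ 2)⁻¹ * ‖x‖ * (b - a)
          = 2 * |D| * ((b ^ 2 - a ^ 2)⁻¹ * ‖x‖ * (b - a)) := by ring
        _ ≤ 2 * |D| * 1 := by gcongr
        _ ≤ 2 * K := by linarith
    · have : η =ᶠ[𝓝 x] fun _ => 0 := by
        have ho : IsOpen {y : Vec n | b < ‖y‖} := isOpen_lt continuous_const continuous_norm
        filter_upwards [ho.mem_nhds hx] with y hy using hηz y (le_of_lt hy)
      have h0 : gradVec η x = 0 := by
        ext j
        simp [gradVec, this.fderiv_eq]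
      rw [h0, norm_zero]
      have : 0 < b - a := by linarith
      positivity

/-- The product `(1 - η) v`. -/
noncomputable def cutoffMap (η : Vec n → ℝ) (v : Vec n → Vec N) (x : Vec n) : Vec N :=
  (1 - η x) • v x

/-- The gradient of `(1 - η) v`, if `G` is the gradient of `v`. -/
noncomputable def cutoffGrad (η : Vec n → ℝ) (v : Vec n → Vec N) (G : Vec n → Mat N n)
    (x : Vec n) : Mat N n :=
  (1 - η x) • G x - outer (v x) (gradVec η x)

theorem gradMat_cutoffMap {η : Vec n → ℝ} (hη : ContDiff ℝ 1 η) {v : Vec n → Vec N}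
    (hv : ContDiff ℝ 1 v) : gradMat (cutoffMap η v) = cutoffGrad η v (gradMat v) := by
  ext x ⟨i, j⟩
  have h1 := ((hη.differentiable one_ne_zero x).hasFDerivAt.const_sub 1).smul
    (hv.differentiable one_ne_zero x).hasFDerivAt
  rw [gradMat_apply]
  have e : fderiv ℝ (cutoffMap η v) x = _ := h1.fderiv
  rw [e]
  simp [cutoffGrad, outer_apply, gradMat_apply, gradVec]
  ring

theorem contDiff_cutoffMap {η : Vec n → ℝ} (hη : ContDiff ℝ 1 η) {v : Vec n → Vec N}
    (hv : ContDiff ℝ 1 v) : ContDiff ℝ 1 (cutoffMap η v) :=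
  (contDiff_const.sub hη).smul hv

theorem norm_cutoffMap_le {η : Vec n → ℝ} {v : Vec n → Vec N} {x : Vec n}
    (h : 0 ≤ η x ∧ η x ≤ 1) : ‖cutoffMap η v x‖ ≤ ‖v x‖ := by
  rw [cutoffMap, norm_smul, Real.norm_of_nonneg (by linarith [h.2])]
  exact mul_le_of_le_one_left (norm_nonneg _) (by linarith [h.1])

theorem norm_cutoffGrad_le {η : Vec n → ℝ} {v : Vec n → Vec N} {G : Vec n → Mat N n} {x : Vec n}
    {C : ℝ} (h : 0 ≤ η x ∧ η x ≤ 1) (hC : ‖gradVec η x‖ ≤ C) :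
    ‖cutoffGrad η v G x‖ ≤ ‖G x‖ + C * ‖v x‖ := by
  refine (norm_sub_le _ _).trans ?_
  rw [norm_smul, norm_outer, Real.norm_of_nonneg (by linarith [h.2]), mul_comm ‖v x‖]
  gcongr
  exact mul_le_of_le_one_left (norm_nonneg _) (by linarith [h.1])

theorem cutoffMap_sub (η : Vec n → ℝ) (v v' : Vec n → Vec N) (x : Vec n) :
    cutoffMap η (fun x => v x - v' x) x = cutoffMap η v x - cutoffMap η v' x := by
  simp [cutoffMap, smul_sub]

theorem cutoffGrad_sub (η : Vec n → ℝ) (v v' : Vec n → Vec N) (G G' : Vec n → Mat N n) (x : Vec n) :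
    cutoffGrad η (fun x => v x - v' x) (fun x => G x - G' x) x
      = cutoffGrad η v G x - cutoffGrad η v' G' x := by
  ext ⟨i, j⟩
  simp only [cutoffGrad, PiLp.sub_apply, PiLp.smul_apply, smul_eq_mul, outer_apply]
  ring

theorem stronglyMeasurable_cutoffMap {η : Vec n → ℝ} (hη : ContDiff ℝ 1 η) {v : Vec n → Vec N}
    (hv : StronglyMeasurable v) : StronglyMeasurable (cutoffMap η v) :=
  (continuous_const.sub hη.continuous).stronglyMeasurable.smul hv

theorem stronglyMeasurable_cutoffGrad {η : Vec n → ℝ} (hη : ContDiff ℝ 1 η) {v : Vec n → Vec N}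
    {G : Vec n → Mat N n} (hv : StronglyMeasurable v) (hG : StronglyMeasurable G) :
    StronglyMeasurable (cutoffGrad η v G) :=
  ((continuous_const.sub hη.continuous).stronglyMeasurable.smul hG).sub
    (continuous_outer.comp_stronglyMeasurable
      (hv.prodMk (continuous_gradVec hη).stronglyMeasurable))

end Cutoff

/-! ### The comparison map -/

section Comparison

variable {n N : ℕ} {s m : ℝ} {H : ℝ → ℝ}

theorem stronglyMeasurable_comp_avg {E : Type*} [NormedAddCommGroup E] {f : Vec n → E}
    (hf : StronglyMeasurable f) :
    StronglyMeasurable fun p : Vec n × Vec n => f (p.1 + avgRadius s p.1 • p.2) :=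
  hf.comp_measurable ((continuous_fst.add ((continuous_avgRadius.comp continuous_fst).smul
    continuous_snd)).measurable)

theorem stronglyMeasurable_smoothing {w : Vec n → Vec N} (hw : StronglyMeasurable w) :
    StronglyMeasurable (smoothing s w) :=
  (stronglyMeasurable_comp_avg hw).integral_prod_right'

theorem stronglyMeasurable_twist_comp {G : Vec n → Mat N n} (hG : StronglyMeasurable G) :
    StronglyMeasurable fun p : Vec n × Vec n =>
      twist (G (p.1 + avgRadius s p.1 • p.2)) p.2 (-(4 * s)⁻¹ • p.1) :=
  continuous_twist.comp_stronglyMeasurable ((stronglyMeasurable_comp_avg hG).prodMk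
    (StronglyMeasurable.prodMk (continuous_snd.stronglyMeasurable)
      (Continuous.stronglyMeasurable (by fun_prop))))

theorem stronglyMeasurable_smoothingGrad {G : Vec n → Mat N n} (hG : StronglyMeasurable G) :
    StronglyMeasurable (smoothingGrad s G) :=
  (stronglyMeasurable_twist_comp hG).integral_prod_right'

theorem add_avgRadius_smul_mem {x y : Vec n} (hs : 0 < s) (hx : ‖x‖ < s) (hy : ‖y‖ ≤ 1) :
    ‖x + avgRadius s x • y‖ ≤ (3 * ‖x‖ + s) / 4 := by
  have h1 := avgRadius_le hs hx.le
  have h2 := le_avgRadius hs hx.le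
  have h3 : 0 ≤ avgRadius s x := by linarith
  calc ‖x + avgRadius s x • y‖ ≤ ‖x‖ + avgRadius s x * ‖y‖ := by
        refine (norm_add_le _ _).trans ?_
        rw [norm_smul, Real.norm_of_nonneg h3]
    _ ≤ ‖x‖ + avgRadius s x * 1 := by gcongr
    _ ≤ _ := by linarith

theorem IsModular.ofReal_smoothing_le (hH : IsModular m H) {w : Vec n → Vec N}
    (hw : StronglyMeasurable w) (x : Vec n) :
    ENNReal.ofReal (H ‖smoothing s w x‖) ≤ ballAvg s (fun z => ENNReal.ofReal (H ‖w z‖)) x :=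
  hH.ofReal_norm_integral_le
    ((stronglyMeasurable_comp_avg hw).comp_measurable
      (measurable_const.prodMk measurable_id)).aestronglyMeasurable

theorem IsModular.ofReal_smoothingGrad_le (hH : IsModular m H) {G : Vec n → Mat N n}
    (hG : StronglyMeasurable G) (hs : 0 < s) {x : Vec n} (hx : ‖x‖ < s) :
    ENNReal.ofReal (H ‖smoothingGrad s G x‖) ≤
      ENNReal.ofReal (2 ^ m) * ballAvg s (fun z => ENNReal.ofReal (H ‖G z‖)) x := by
  refine (hH.ofReal_norm_integral_le
    ((stronglyMeasurable_twist_comp hG).comp_measurable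
      (measurable_const.prodMk measurable_id)).aestronglyMeasurable).trans ?_
  rw [ballAvg, ← lintegral_const_mul' _ _ ENNReal.ofReal_ne_top]
  refine lintegral_mono_ae ?_
  filter_upwards [ae_ballProb_norm_le n] with y hy
  rw [← ENNReal.ofReal_mul (by positivity)]
  refine ENNReal.ofReal_le_ofReal (le_trans (hH.monotoneOn (norm_nonneg _)
    (show 0 ≤ 2 * ‖G (x + avgRadius s x • y)‖ by positivity) ?_)
    (hH.map_mul_le 2 _ one_le_two (norm_nonneg _)))
  refine (norm_twist_le _ _ _).trans ?_
  have hb : ‖-(4 * s)⁻¹ • x‖ ≤ 1 := by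
    rw [norm_smul, norm_neg, norm_inv, Real.norm_of_nonneg (by positivity), inv_mul_le_iff₀
      (by positivity)]
    linarith
  have : ‖y‖ * ‖-(4 * s)⁻¹ • x‖ ≤ 1 := mul_le_one₀ hy (norm_nonneg _) hb
  have h2 : 1 + ‖y‖ * ‖-(4 * s)⁻¹ • x‖ ≤ 2 := by linarith
  exact mul_le_mul_of_nonneg_right h2 (norm_nonneg _)

theorem IsModular.measurable_ofReal (hH : IsModular m H) {E : Type*} [NormedAddCommGroup E]
    {f : Vec n → E} (hf : StronglyMeasurable f) :
    Measurable fun z => ENNReal.ofReal (H ‖f z‖) :=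
  (hH.continuous_norm.comp_stronglyMeasurable hf).measurable.ennreal_ofReal

theorem IsModular.ofReal_sub_le (hH : IsModular m H) {E : Type*} [NormedAddCommGroup E] (a b : E) :
    ENNReal.ofReal (H ‖a - b‖) ≤
      ENNReal.ofReal (2 ^ m) * (ENNReal.ofReal (H ‖a‖) + ENNReal.ofReal (H ‖b‖)) := by
  rw [← ENNReal.ofReal_add (hH.nonneg (norm_nonneg _)) (hH.nonneg (norm_nonneg _)),
    ← ENNReal.ofReal_mul (by positivity)]
  exact ENNReal.ofReal_le_ofReal ((hH.monotoneOn (norm_nonneg _)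
    (show 0 ≤ ‖a‖ + ‖b‖ by positivity) (norm_sub_le _ _)).trans
    (hH.map_add_le (norm_nonneg _) (norm_nonneg _)))

/-- Modular bound of a map minus a function dominated by averages of another map. -/
theorem IsModular.lintegral_sub_le (hH : IsModular m H) {E E' : Type*} [NormedAddCommGroup E]
    [NormedAddCommGroup E'] {C₀ C : ENNReal} {a S : Vec n → E} {g : Vec n → E'}
    (ha : StronglyMeasurable a) (hC₀ : C₀ ≠ ⊤)
    (hS : ∀ x, ‖x‖ < s → ENNReal.ofReal (H ‖S x‖) ≤
      C₀ * ballAvg s (fun z => ENNReal.ofReal (H ‖g z‖)) x)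
    (hC : ∫⁻ x in Metric.ball 0 s, ballAvg s (fun z => ENNReal.ofReal (H ‖g z‖)) x ≤
      C * ∫⁻ x in Metric.ball 0 s, ENNReal.ofReal (H ‖g x‖)) :
    ∫⁻ x in Metric.ball 0 s, ENNReal.ofReal (H ‖a x - S x‖) ≤
      ENNReal.ofReal (2 ^ m) * ((∫⁻ x in Metric.ball 0 s, ENNReal.ofReal (H ‖a x‖)) +
        C₀ * (C * ∫⁻ x in Metric.ball 0 s, ENNReal.ofReal (H ‖g x‖))) := by
  calc _ ≤ ∫⁻ x in Metric.ball 0 s, ENNReal.ofReal (2 ^ m) * (ENNReal.ofReal (H ‖a x‖) +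
          C₀ * ballAvg s (fun z => ENNReal.ofReal (H ‖g z‖)) x) := by
        refine setLIntegral_mono' Metric.isOpen_ball.measurableSet fun x hx => ?_
        refine (hH.ofReal_sub_le _ _).trans ?_
        gcongr
        exact hS x (by simpa using hx)
    _ ≤ _ := by
        rw [lintegral_const_mul' _ _ ENNReal.ofReal_ne_top,
          lintegral_add_left (hH.measurable_ofReal ha), lintegral_const_mul' _ _ hC₀]
        gcongr

/-- For integrable `f`, the averages defining the smoothing operators converge. -/
theorem integrable_comp_avg {E : Type*} [NormedAddCommGroup E] {f : Vec n → E}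
    (hf : StronglyMeasurable f) (hi : IntegrableOn f (Metric.ball 0 s)) (hs : 0 < s) {x : Vec n}
    (hx : ‖x‖ < s) : Integrable (fun y => f (x + avgRadius s x • y)) (ballProb n) := by
  refine ⟨((stronglyMeasurable_comp_avg hf).comp_measurable
      (measurable_const.prodMk measurable_id)).aestronglyMeasurable, ?_⟩
  have hd : 0 < s - ‖x‖ := by linarith
  have h := ballAvg_le hs (fun z => ‖f z‖ₑ) hx
  refine lt_of_le_of_lt h ?_
  have hsub : Metric.closedBall x ((s - ‖x‖) / 4) ⊆ Metric.ball 0 s := by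
    intro z hz
    rw [Metric.mem_closedBall, dist_eq_norm] at hz
    have t1 : ‖z‖ - ‖x‖ ≤ ‖z - x‖ := norm_sub_norm_le z x
    rw [mem_ball_zero_iff]
    linarith
  refine ENNReal.mul_lt_top (ENNReal.mul_lt_top (ENNReal.inv_lt_top.2
    (pos_iff_ne_zero.2 (volume_closedBall_one_ne_zero n))) ENNReal.ofReal_lt_top)
    (ENNReal.mul_lt_top ENNReal.ofReal_lt_top (lt_of_le_of_lt (lintegral_mono_set hsub) hi.2))

theorem smoothing_sub {w w' : Vec n → Vec N} (hw : StronglyMeasurable w)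
    (hw' : StronglyMeasurable w') (hi : IntegrableOn w (Metric.ball 0 s))
    (hi' : IntegrableOn w' (Metric.ball 0 s)) (hs : 0 < s) {x : Vec n} (hx : ‖x‖ < s) :
    smoothing s (fun x => w x - w' x) x = smoothing s w x - smoothing s w' x :=
  integral_sub (integrable_comp_avg hw hi hs hx) (integrable_comp_avg hw' hi' hs hx)

theorem integrable_twist_comp {G : Vec n → Mat N n} (hG : StronglyMeasurable G)
    (hi : IntegrableOn G (Metric.ball 0 s)) (hs : 0 < s) {x : Vec n} (hx : ‖x‖ < s) :
    Integrable (fun y => twist (G (x + avgRadius s x • y)) y (-(4 * s)⁻¹ • x)) (ballProb n) := by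
  refine Integrable.mono' ((integrable_comp_avg hG hi hs hx).norm.const_mul
    (1 + 1 * ‖-(4 * s)⁻¹ • x‖)) ((stronglyMeasurable_twist_comp hG).comp_measurable
      (measurable_const.prodMk measurable_id)).aestronglyMeasurable ?_
  filter_upwards [ae_ballProb_norm_le n] with y hy
  refine (norm_twist_le _ _ _).trans ?_
  gcongr

theorem smoothingGrad_sub {G G' : Vec n → Mat N n} (hG : StronglyMeasurable G)
    (hG' : StronglyMeasurable G') (hi : IntegrableOn G (Metric.ball 0 s))
    (hi' : IntegrableOn G' (Metric.ball 0 s)) (hs : 0 < s) {x : Vec n} (hx : ‖x‖ < s) :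
    smoothingGrad s (fun x => G x - G' x) x = smoothingGrad s G x - smoothingGrad s G' x := by
  simp only [smoothingGrad, twist_sub]
  exact integral_sub (integrable_twist_comp hG hi hs hx) (integrable_twist_comp hG' hi' hs hx)

theorem smoothingGrad_congr {G G' : Vec n → Mat N n} (h : ∀ z, ‖z‖ < s → G z = G' z) (hs : 0 < s)
    {x : Vec n} (hx : ‖x‖ < s) : smoothingGrad s G x = smoothingGrad s G' x := by
  refine integral_congr_ae ?_
  filter_upwards [ae_ballProb_norm_le n] with y hy
  rw [h _ ((add_avgRadius_smul_mem hs hx hy).trans_lt (by linarith))]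

/-- The map `v - T((1 - η) v)` on `B_s`, extended by zero: it equals `v` near the centre and has
the boundary values zero. -/
noncomputable def comparison (s : ℝ) (η : Vec n → ℝ) (v : Vec n → Vec N) : Vec n → Vec N :=
  (Metric.ball 0 s).indicator fun x => v x - smoothing s (cutoffMap η v) x

/-- The weak gradient of the comparison map, if `G` is that of `v`. -/
noncomputable def comparisonGrad (s : ℝ) (η : Vec n → ℝ) (v : Vec n → Vec N) (G : Vec n → Mat N n) :
    Vec n → Mat N n :=
  (Metric.ball 0 s).indicator fun x => G x - smoothingGrad s (cutoffGrad η v G) x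

theorem isWeakGrad_comparison_of_contDiff {η : Vec n → ℝ} (hη : ContDiff ℝ 1 η) {b : ℝ}
    (hbs : b < s) (hηb : ∀ x, b ≤ ‖x‖ → η x = 0) {v : Vec n → Vec N} (hv : ContDiff ℝ 1 v) :
    IsWeakGrad univ (comparison s η v) (comparisonGrad s η v (gradMat v)) := by
  have hw := contDiff_cutoffMap hη hv
  set Hf : Vec n → Vec N := fun x => v x - smoothing s (cutoffMap η v) x with hHf
  have hH : ContDiff ℝ 1 Hf := hv.sub (contDiff_smoothing hw)
  -- near the sphere the cut-off is inactive
  have hnear : ∀ x : Vec n, ‖x‖ = s → cutoffMap η v =ᶠ[𝓝 x] v := fun x hx => by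
    have ho : IsOpen {y : Vec n | b < ‖y‖} := isOpen_lt continuous_const continuous_norm
    filter_upwards [ho.mem_nhds (show b < ‖x‖ by rw [hx]; exact hbs)] with y hy
    simp [cutoffMap, hηb y (le_of_lt hy)]
  have hfd : ∀ x, fderiv ℝ Hf x = fderiv ℝ v x - fderiv ℝ (smoothing s (cutoffMap η v)) x :=
    fun x => fderiv_fun_sub (hv.differentiable one_ne_zero x)
      ((contDiff_smoothing hw).differentiable one_ne_zero x)
  have h := contDiff_indicator_ball (s := s) hH
    (fun x hx => by
      rw [hHf]; simp only
      rw [smoothing_eq_on_sphere _ hx, (hnear x hx).eq_of_nhds, sub_self])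
    (fun x hx => by
      rw [hfd, fderiv_smoothing_eq_on_sphere hw hx, (hnear x hx).fderiv_eq, sub_self])
  have hg : gradMat Hf = fun x => gradMat v x - smoothingGrad s (cutoffGrad η v (gradMat v)) x := by
    ext x ij
    rw [← gradMat_cutoffMap hη hv, ← gradMat_smoothing hw]
    simp only [gradMat, hfd]
    rfl
  have h2 := isWeakGrad_of_contDiff (U := univ) h.1
  rw [h.2, hg] at h2
  exact h2

/-- Modular bounds of the comparison map and of its gradient. -/
theorem exists_lintegral_comparison_le (n N : ℕ) (m C : ℝ) :
    ∃ K : ENNReal, K ≠ ⊤ ∧ ∀ (H : ℝ → ℝ), IsModular m H → ∀ (s : ℝ), 0 < s →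
      ∀ (η : Vec n → ℝ), ContDiff ℝ 1 η → (∀ x, 0 ≤ η x ∧ η x ≤ 1) → (∀ x, ‖gradVec η x‖ ≤ C) →
      ∀ (v : Vec n → Vec N) (G : Vec n → Mat N n), StronglyMeasurable v → StronglyMeasurable G →
      (∫⁻ x in Metric.ball 0 s, ENNReal.ofReal (H ‖v x - smoothing s (cutoffMap η v) x‖) ≤
        K * ((∫⁻ x in Metric.ball 0 s, ENNReal.ofReal (H ‖v x‖)) +
          ∫⁻ x in Metric.ball 0 s, ENNReal.ofReal (H ‖G x‖))) ∧
      ∫⁻ x in Metric.ball 0 s, ENNReal.ofReal (H ‖G x - smoothingGrad s (cutoffGrad η v G) x‖) ≤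
        K * ((∫⁻ x in Metric.ball 0 s, ENNReal.ofReal (H ‖v x‖)) +
          ∫⁻ x in Metric.ball 0 s, ENNReal.ofReal (H ‖G x‖)) := by
  obtain ⟨C₁, hC₁, hA⟩ := exists_lintegral_ballAvg_le' n
  set c₂ : ENNReal := ENNReal.ofReal (2 ^ m)
  set c₃ : ENNReal := ENNReal.ofReal (max C 1 ^ m)
  have h2 : c₂ ≠ ⊤ := ENNReal.ofReal_ne_top
  have h3 : c₃ ≠ ⊤ := ENNReal.ofReal_ne_top
  refine ⟨c₂ * (1 + C₁) + c₂ * (1 + c₂ * (C₁ * (c₂ * (1 + c₃)))), by finiteness,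
    fun H hH s hs η hη hη01 hC v G hv hG => ?_⟩
  set Iv := ∫⁻ x in Metric.ball 0 s, ENNReal.ofReal (H ‖v x‖)
  set IG := ∫⁻ x in Metric.ball 0 s, ENNReal.ofReal (H ‖G x‖)
  have hwm := stronglyMeasurable_cutoffMap hη hv
  have hgm := stronglyMeasurable_cutoffGrad hη hv hG
  have hC0 : 0 ≤ C := (norm_nonneg _).trans (hC 0)
  constructor
  · refine (hH.lintegral_sub_le (C₀ := 1) hv ENNReal.one_ne_top
      (fun x _ => (hH.ofReal_smoothing_le hwm x).trans_eq (one_mul _).symm)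
      (hA s _ hs (hH.measurable_ofReal hwm))).trans ?_
    have hw : ∫⁻ x in Metric.ball 0 s, ENNReal.ofReal (H ‖cutoffMap η v x‖) ≤ Iv :=
      lintegral_mono fun x => ENNReal.ofReal_le_ofReal (hH.monotoneOn (norm_nonneg _)
        (norm_nonneg _) (norm_cutoffMap_le (hη01 x)))
    calc _ ≤ c₂ * (Iv + 1 * (C₁ * Iv)) := by gcongr
      _ = c₂ * (1 + C₁) * Iv := by ring
      _ ≤ _ := mul_le_mul' le_self_add le_self_add
  · refine (hH.lintegral_sub_le hG ENNReal.ofReal_ne_top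
      (fun x hx => hH.ofReal_smoothingGrad_le hgm hs hx)
      (hA s _ hs (hH.measurable_ofReal hgm))).trans ?_
    have hb : ∀ x, ENNReal.ofReal (H ‖cutoffGrad η v G x‖) ≤ c₂ *
        (ENNReal.ofReal (H ‖G x‖) + c₃ * ENNReal.ofReal (H ‖v x‖)) := by
      intro x
      have n1 := hH.nonneg (norm_nonneg (G x))
      have n2 := hH.nonneg (norm_nonneg (v x))
      rw [← ENNReal.ofReal_mul (by positivity), ← ENNReal.ofReal_add n1 (by positivity),
        ← ENNReal.ofReal_mul (by positivity)]
      refine ENNReal.ofReal_le_ofReal ((hH.monotoneOn (norm_nonneg _)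
        (show 0 ≤ ‖G x‖ + C * ‖v x‖ by positivity) (norm_cutoffGrad_le (hη01 x) (hC x))).trans
        ((hH.map_add_le (norm_nonneg _) (by positivity)).trans ?_))
      gcongr
      exact hH.map_mul_le_max (norm_nonneg _) hC0
    have hI : ∫⁻ x in Metric.ball 0 s, ENNReal.ofReal (H ‖cutoffGrad η v G x‖) ≤
        c₂ * (IG + c₃ * Iv) := by
      refine (lintegral_mono hb).trans_eq ?_
      rw [lintegral_const_mul' _ _ h2, lintegral_add_left (hH.measurable_ofReal hG),
        lintegral_const_mul' _ _ h3]
    calc _ ≤ c₂ * (IG + c₂ * (C₁ * (c₂ * (IG + c₃ * Iv)))) := by gcongr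
      _ ≤ c₂ * ((Iv + IG) + c₂ * (C₁ * (c₂ * ((Iv + IG) + c₃ * (Iv + IG))))) := by
        gcongr
        · exact le_add_self
        · exact le_add_self
        · exact le_self_add
      _ = c₂ * (1 + c₂ * (C₁ * (c₂ * (1 + c₃)))) * (Iv + IG) := by ring
      _ ≤ _ := mul_le_mul' le_add_self le_rfl

theorem lintegral_indicator_norm {E : Type*} [NormedAddCommGroup E] (hm : IsModular m H)
    (f : Vec n → E) :
    ∫⁻ x, ENNReal.ofReal (H ‖(Metric.ball 0 s).indicator f x‖) =
      ∫⁻ x in Metric.ball 0 s, ENNReal.ofReal (H ‖f x‖) := by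
  rw [← lintegral_indicator Metric.isOpen_ball.measurableSet]
  congr 1 with x
  by_cases hx : x ∈ Metric.ball (0 : Vec n) s <;> simp [hx, hm.map_zero]

theorem IsModular.lintegral_lt_top_of_integrableOn (hH : IsModular m H) {E : Type*}
    [NormedAddCommGroup E] {f : Vec n → E} {U : Set (Vec n)}
    (hi : IntegrableOn (fun x => H ‖f x‖) U) :
    ∫⁻ x in U, ENNReal.ofReal (H ‖f x‖) < ⊤ := by
  rw [← ofReal_integral_eq_lintegral_ofReal hi
    (Eventually.of_forall fun _ => hH.nonneg (norm_nonneg _))]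
  exact ENNReal.ofReal_lt_top

/-- The comparison map of a Sobolev map is an inner variation. The gradient formula is inherited
from smooth maps through mollification. -/
theorem isInnerVariation_comparison {φ : ℝ → ℝ} (hφ : IsModular m φ) {η : Vec n → ℝ}
    (hη : ContDiff ℝ 1 η) (hη01 : ∀ x, 0 ≤ η x ∧ η x ≤ 1) {C : ℝ} (hC : ∀ x, ‖gradVec η x‖ ≤ C)
    {b : ℝ} (hbs : b < s) (hηb : ∀ x, b ≤ ‖x‖ → η x = 0) (hs : 0 < s) (hs1 : s < 1)
    {v : Vec n → Vec N} {G : Vec n → Mat N n} (hv : StronglyMeasurable v)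
    (hG : StronglyMeasurable G) (hweak : IsWeakGrad (Metric.ball 0 1) v G)
    (hiv : IntegrableOn (fun x => φ ‖v x‖) (Metric.ball 0 1))
    (hiG : IntegrableOn (fun x => φ ‖G x‖) (Metric.ball 0 1)) :
    IsInnerVariation φ 0 1 (comparison s η v) (comparisonGrad s η v G) := by
  set B : Set (Vec n) := Metric.ball 0 1 with hBdef
  have hBm : MeasurableSet B := Metric.isOpen_ball.measurableSet
  have hfin : IsFiniteMeasure (volume.restrict B) :=
    isFiniteMeasure_restrict.2 measure_ball_lt_top.ne
  have hsB : Metric.ball (0 : Vec n) s ⊆ B := Metric.ball_subset_ball hs1.le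
  have hv1 : IntegrableOn v B := hφ.integrable_of_integrable_comp hv.aestronglyMeasurable hiv
  have hG1 : IntegrableOn G B := hφ.integrable_of_integrable_comp hG.aestronglyMeasurable hiG
  have hwm := stronglyMeasurable_cutoffMap hη hv
  have hgm := stronglyMeasurable_cutoffGrad hη hv hG
  have hFm : StronglyMeasurable (comparison s η v) :=
    (hv.sub (stronglyMeasurable_smoothing hwm)).indicator Metric.isOpen_ball.measurableSet
  have hDFm : StronglyMeasurable (comparisonGrad s η v G) :=
    (hG.sub (stronglyMeasurable_smoothingGrad hgm)).indicator Metric.isOpen_ball.measurableSet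
  -- both maps have finite modular, for every modular for which `v` and `G` do
  have key : ∀ (m' : ℝ) (H : ℝ → ℝ), IsModular m' H → IntegrableOn (fun x => H ‖v x‖) B →
      IntegrableOn (fun x => H ‖G x‖) B →
      Integrable (fun x => H ‖comparison s η v x‖) ∧
      Integrable (fun x => H ‖comparisonGrad s η v G x‖) := by
    intro m' H hH h1 h2
    obtain ⟨K, hK, h⟩ := exists_lintegral_comparison_le n N m' C
    obtain ⟨e1, e2⟩ := h H hH s hs η hη hη01 hC v G hv hG
    have hlt : K * ((∫⁻ x in Metric.ball 0 s, ENNReal.ofReal (H ‖v x‖)) +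
          ∫⁻ x in Metric.ball 0 s, ENNReal.ofReal (H ‖G x‖)) < ⊤ :=
      ENNReal.mul_lt_top hK.lt_top (ENNReal.add_lt_top.2
        ⟨hH.lintegral_lt_top_of_integrableOn (h1.mono_set hsB),
          hH.lintegral_lt_top_of_integrableOn (h2.mono_set hsB)⟩)
    refine ⟨hH.integrable_of_lintegral hFm.aestronglyMeasurable ?_,
      hH.integrable_of_lintegral hDFm.aestronglyMeasurable ?_⟩
    · rw [comparison, lintegral_indicator_norm hH]
      exact (e1.trans_lt hlt).ne
    · rw [comparisonGrad, lintegral_indicator_norm hH]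
      exact (e2.trans_lt hlt).ne
  obtain ⟨k1, k2⟩ := key m φ hφ hiv hiG
  obtain ⟨k3, k4⟩ := key 1 _ isModular_id hv1.norm hG1.norm
  have k3 : Integrable (comparison s η v) := (integrable_norm_iff hFm.aestronglyMeasurable).1 k3
  have k4 : Integrable (comparisonGrad s η v G) :=
    (integrable_norm_iff hDFm.aestronglyMeasurable).1 k4
  refine ⟨?_, ⟨s, hs1, fun x hx => ?_⟩, k3, k4, k1, k2⟩
  swap
  · have hx' : x ∉ Metric.ball (0 : Vec n) s := fun h => hx (Metric.ball_subset_closedBall h)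
    exact ⟨indicator_of_notMem hx' _, indicator_of_notMem hx' _⟩
  -- approximation by mollification
  set V : ℕ → Vec n → Vec N := fun k => mollify k (B.indicator v)
  set Γ : ℕ → Vec n → Mat N n := fun k => mollify k (B.indicator G)
  have hvi : Integrable (B.indicator v) := hv1.integrable_indicator hBm
  have hGi : Integrable (B.indicator G) := hG1.integrable_indicator hBm
  have hVs : ∀ k, ContDiff ℝ 1 (V k) := fun k =>
    (contDiff_mollify k hvi.locallyIntegrable).of_le (by simp)
  have hΓs : ∀ k, Continuous (Γ k) := fun k =>
    (contDiff_mollify k hGi.locallyIntegrable).continuous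
  have hgrad : ∀ᶠ k : ℕ in atTop, ∀ x, ‖x‖ < s → gradMat (V k) x = Γ k x := by
    obtain ⟨k₀, hk₀⟩ := exists_nat_one_div_lt (sub_pos.2 hs1)
    filter_upwards [eventually_ge_atTop k₀] with k hk x hx
    refine hweak.gradMat_mollify hBm hv1 hG1 fun y hy => ?_
    have hle : 1 / ((k : ℝ) + 1) ≤ 1 / ((k₀ : ℝ) + 1) :=
      one_div_le_one_div_of_le (by positivity) (by gcongr)
    rw [Metric.mem_closedBall, dist_eq_norm] at hy
    have := norm_sub_norm_le y x
    rw [hBdef, mem_ball_zero_iff]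
    linarith
  have hcontV : ∀ k, IntegrableOn (V k) (Metric.ball 0 s) := fun k =>
    (integrable_mollify k hvi).integrableOn
  have hcontΓ : ∀ k, IntegrableOn (Γ k) (Metric.ball 0 s) := fun k =>
    (integrable_mollify k hGi).integrableOn
  -- the error is controlled by the error of the mollification
  set δ : ℕ → ENNReal := fun k =>
    (∫⁻ x in Metric.ball 0 s, ENNReal.ofReal ‖V k x - v x‖) +
      ∫⁻ x in Metric.ball 0 s, ENNReal.ofReal ‖Γ k x - G x‖ with hδ
  have hδ0 : Tendsto δ atTop (𝓝 0) := by
    have t1 := isModular_id.tendsto_mollify_mul hvi.locallyIntegrable hvi.norm one_pos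
      (Metric.ball 0 s) 0
    have t2 := isModular_id.tendsto_mollify_mul hGi.locallyIntegrable hGi.norm one_pos
      (Metric.ball 0 s) 0
    have t3 := t1.add t2
    rw [add_zero] at t3
    refine t3.congr fun k => ?_
    simp only [hδ, one_mul, add_zero]
    congr 1
    · refine setLIntegral_congr_fun Metric.isOpen_ball.measurableSet fun x hx => ?_
      simp only [V, indicator_of_mem (hsB hx)]
    · refine setLIntegral_congr_fun Metric.isOpen_ball.measurableSet fun x hx => ?_
      simp only [Γ, indicator_of_mem (hsB hx)]
  obtain ⟨K, hK, h⟩ := exists_lintegral_comparison_le n N 1 C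
  have hKδ : Tendsto (fun k => K * δ k) atTop (𝓝 0) := by
    have := ENNReal.Tendsto.const_mul (a := K) hδ0 (Or.inr hK)
    rwa [mul_zero] at this
  have hbound := fun k => h _ isModular_id s hs η hη hη01 hC (fun x => V k x - v x)
    (fun x => Γ k x - G x) ((hVs k).continuous.stronglyMeasurable.sub hv)
    ((hΓs k).stronglyMeasurable.sub hG)
  have hvs := hv1.mono_set hsB
  have hGs := hG1.mono_set hsB
  -- integrability of the cut-off maps
  have hcm : ∀ {u : Vec n → Vec N}, StronglyMeasurable u → IntegrableOn u (Metric.ball 0 s) →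
      IntegrableOn (cutoffMap η u) (Metric.ball 0 s) := fun hu hui =>
    hui.norm.mono' (stronglyMeasurable_cutoffMap hη hu).aestronglyMeasurable
      (Eventually.of_forall fun x => norm_cutoffMap_le (hη01 x))
  have hcg : ∀ {u : Vec n → Vec N} {D : Vec n → Mat N n}, StronglyMeasurable u →
      StronglyMeasurable D → IntegrableOn u (Metric.ball 0 s) → IntegrableOn D (Metric.ball 0 s) →
      IntegrableOn (cutoffGrad η u D) (Metric.ball 0 s) := fun hu hD hui hDi =>
    (hDi.norm.add (hui.norm.const_mul C)).mono'
      (stronglyMeasurable_cutoffGrad hη hu hD).aestronglyMeasurable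
      (Eventually.of_forall fun x => norm_cutoffGrad_le (hη01 x) (hC x))
  refine isWeakGrad_of_tendsto (F := fun k => comparison s η (V k))
    (DF := fun k => comparisonGrad s η (V k) (gradMat (V k)))
    (Eventually.of_forall fun k => isWeakGrad_comparison_of_contDiff hη hbs hηb (hVs k)) k3 k4
    (tendsto_of_tendsto_of_tendsto_of_le_of_le tendsto_const_nhds hKδ (fun _ => zero_le)
      fun k => ?_)
    (tendsto_of_tendsto_of_tendsto_of_le_of_le' tendsto_const_nhds hKδ
      (Eventually.of_forall fun _ => zero_le) ?_)
  · refine le_trans (le_of_eq ?_) (hbound k).1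
    rw [← lintegral_indicator_norm isModular_id]
    congr 1 with x
    by_cases hx : x ∈ Metric.ball (0 : Vec n) s
    · have hx' : ‖x‖ < s := by simpa using hx
      simp only [comparison, indicator_of_mem hx]
      have e1 : smoothing s (cutoffMap η fun x => V k x - v x) x
          = smoothing s (cutoffMap η (V k)) x - smoothing s (cutoffMap η v) x := by
        rw [← smoothing_sub (stronglyMeasurable_cutoffMap hη (hVs k).continuous.stronglyMeasurable)
          hwm (hcm (hVs k).continuous.stronglyMeasurable (hcontV k)) (hcm hv hvs) hs hx']
        congr 1
        ext1 z
        exact cutoffMap_sub η _ _ z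
      rw [e1]
      congr 2
      abel
    · simp [comparison, indicator_of_notMem hx]
  · filter_upwards [hgrad] with k hk
    refine le_trans (le_of_eq ?_) (hbound k).2
    rw [← lintegral_indicator_norm isModular_id]
    congr 1 with x
    by_cases hx : x ∈ Metric.ball (0 : Vec n) s
    · have hx' : ‖x‖ < s := by simpa using hx
      simp only [comparisonGrad, indicator_of_mem hx]
      have e0 : smoothingGrad s (cutoffGrad η (V k) (gradMat (V k))) x
          = smoothingGrad s (cutoffGrad η (V k) (Γ k)) x :=
        smoothingGrad_congr (fun z hz => by simp only [cutoffGrad, hk z hz]) hs hx'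
      have hVm := (hVs k).continuous.stronglyMeasurable
      have hΓm := (hΓs k).stronglyMeasurable
      have e1 : smoothingGrad s (cutoffGrad η (fun x => V k x - v x) fun x => Γ k x - G x) x
          = smoothingGrad s (cutoffGrad η (V k) (Γ k)) x - smoothingGrad s (cutoffGrad η v G) x := by
        rw [← smoothingGrad_sub (stronglyMeasurable_cutoffGrad hη hVm hΓm)
          hgm (hcg hVm hΓm (hcontV k) (hcontΓ k)) (hcg hv hG hvs hGs) hs hx']
        congr 1
        ext1 z
        exact cutoffGrad_sub η _ _ _ _ z
      rw [e1, e0, hk x hx']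
      congr 2
      abel
    · simp [comparisonGrad, indicator_of_notMem hx]

end Comparison

/-! ### The Legendre-Hadamard condition -/

section LegendreHadamard

variable {n N : ℕ} {m γ : ℝ} {φ : ℝ → ℝ}

theorem exists_second_difference_le {E : Type*} [NormedAddCommGroup E] [NormedSpace ℝ E]
    {f : E → ℝ} (hf : ContDiff ℝ 2 f) (y : E) {η : ℝ} (hη : 0 < η) :
    ∃ r, 0 < r ∧ ∀ A, ‖A‖ < r →
      f (y + A) + f (y - A) - 2 * f y ≤ fderiv ℝ (fderiv ℝ f) y A A + η * ‖A‖ ^ 2 := by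
  have hf1 : ContDiff ℝ 1 (fderiv ℝ f) := hf.fderiv_right (by norm_num)
  have hdf : Differentiable ℝ f := hf.differentiable (by norm_num)
  have hddf : Differentiable ℝ (fderiv ℝ f) := hf1.differentiable one_ne_zero
  have hc := (hf1.continuous_fderiv one_ne_zero).continuousAt (x := y)
  obtain ⟨r, hr, hb⟩ := Metric.continuousAt_iff.1 hc η hη
  refine ⟨r, hr, fun A hA => ?_⟩
  set Q := fderiv ℝ (fderiv ℝ f) y
  -- `B ↦ Df(y + B) - D²f(y) B` is Lipschitz with constant `η` near the origin
  have hlip : ∀ B ∈ Metric.ball (0 : E) r, ∀ B' ∈ Metric.ball (0 : E) r,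
      ‖(fderiv ℝ f (y + B) - Q B) - (fderiv ℝ f (y + B') - Q B')‖ ≤ η * ‖B - B'‖ := by
    intro B hB B' hB'
    refine (convex_ball (0 : E) r).norm_image_sub_le_of_norm_hasFDerivWithin_le
      (f := fun B => fderiv ℝ f (y + B) - Q B)
      (f' := fun B => fderiv ℝ (fderiv ℝ f) (y + B) - Q) (fun x _ => ?_) (fun x hx => ?_) hB' hB
    · exact (((hasFDerivAt_comp_add_left y).2 (hddf (y + x)).hasFDerivAt).sub
        Q.hasFDerivAt).hasFDerivWithinAt
    · have := hb (x := y + x) (by simpa [dist_eq_norm] using hx)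
      rw [dist_eq_norm] at this
      exact this.le
  set k : ℝ → ℝ := fun t => f (y + t • A) + f (y - t • A) - t ^ 2 * Q A A - η * t ^ 2 * ‖A‖ ^ 2
  have hk : ∀ t, HasDerivAt k (fderiv ℝ f (y + t • A) A - fderiv ℝ f (y - t • A) A -
      2 * t * Q A A - η * (2 * t) * ‖A‖ ^ 2) t := by
    intro t
    have hl : HasDerivAt (fun t : ℝ => t • A) A t := by
      simpa using (hasDerivAt_id t).smul_const A
    have h1 := (hdf (y + t • A)).hasFDerivAt.comp_hasDerivAt t (hl.const_add y)
    have h2 := (hdf (y - t • A)).hasFDerivAt.comp_hasDerivAt t (hl.const_sub y)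
    have h3 : HasDerivAt (fun t : ℝ => t ^ 2) (2 * t) t := by simpa using hasDerivAt_pow 2 t
    have := ((h1.add h2).sub (h3.mul_const (Q A A))).sub ((h3.const_mul η).mul_const (‖A‖ ^ 2))
    refine this.congr_deriv ?_
    rw [map_neg]
    ring
  have hanti : AntitoneOn k (Icc 0 1) := by
    refine antitoneOn_of_deriv_nonpos (convex_Icc 0 1)
      (fun t _ => (hk t).continuousAt.continuousWithinAt)
      (fun t _ => (hk t).differentiableAt.differentiableWithinAt) fun t ht => ?_
    rw [interior_Icc] at ht
    rw [(hk t).deriv]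
    have hmem : t • A ∈ Metric.ball (0 : E) r := by
      rw [mem_ball_zero_iff, norm_smul, Real.norm_of_nonneg ht.1.le]
      exact (mul_le_of_le_one_left (norm_nonneg _) ht.2.le).trans_lt hA
    have h1 := hlip _ hmem (-(t • A)) (by simpa using hmem)
    have h2 := (le_abs_self _).trans ((ContinuousLinearMap.le_opNorm _ A).trans
      (mul_le_mul_of_nonneg_right h1 (norm_nonneg A)))
    have e : ‖t • A - -(t • A)‖ = 2 * t * ‖A‖ := by
      rw [sub_neg_eq_add, ← two_smul ℝ, norm_smul, norm_smul, Real.norm_of_nonneg ht.1.le,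
        Real.norm_two]
      ring
    rw [e] at h2
    simp only [sub_apply, map_neg, map_smul, smul_apply, smul_eq_mul,
      neg_apply, ← sub_eq_add_neg] at h2
    linarith
  have := hanti (left_mem_Icc.2 zero_le_one) (right_mem_Icc.2 zero_le_one) zero_le_one
  simp only [k, one_smul, zero_smul, add_zero, sub_zero] at this
  linarith

theorem gradMat_const_smul {w : Vec n → Vec N} (hw : Differentiable ℝ w) (c : ℝ) (x : Vec n) :
    gradMat (fun x => c • w x) x = c • gradMat w x := by
  ext ⟨i, j⟩
  simp [gradMat_apply, fderiv_fun_const_smul (hw x)]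

theorem IsTestMap.const_smul {U : Set (Vec n)} {w : Vec n → Vec N} (hw : IsTestMap U w) (c : ℝ) :
    IsTestMap U fun x => c • w x :=
  ⟨hw.1.const_smul c, hw.2.1.smul_left (f := fun _ => c),
    (tsupport_smul_subset_right (fun _ => c) w).trans hw.2.2⟩

theorem IsTestMap.exists_norm_gradMat_le {U : Set (Vec n)} {w : Vec n → Vec N}
    (hw : IsTestMap U w) : ∃ R, 0 < R ∧ ∀ x, ‖gradMat w x‖ ≤ R := by
  have hc : HasCompactSupport (gradMat w) := by
    refine HasCompactSupport.intro' hw.2.1 (isClosed_tsupport w) fun x hx => ?_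
    have : fderiv ℝ w x = 0 :=
      image_eq_zero_of_notMem_tsupport fun hx' => hx (tsupport_fderiv_subset ℝ hx')
    ext ij
    simp [gradMat, this]
  obtain ⟨R, hR⟩ := (continuous_gradMat (hw.1.of_le (by simp))).bounded_above_of_compact_support hc
  exact ⟨max R 1, by positivity, fun x => (hR x).trans (le_max_left _ _)⟩

/-- Quasiconvexity, tested with smooth maps and stated without averages. -/
theorem StrictQuasiconvexAt.mul_le_integral (hφ : IsModular m φ) {f : Mat N n → ℝ} {y : Mat N n}
    (hf : Continuous f) (hγ : 0 ≤ γ) (hH : ∀ t, 0 ≤ t → 0 ≤ shift φ (1 + ‖y‖) t)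
    (hq : StrictQuasiconvexAt φ γ f y) {w : Vec n → Vec N} (hw : IsTestMap (Metric.ball 0 1) w) :
    IntegrableOn (fun x => f (y + gradMat w x)) (Metric.ball 0 1) ∧
      volume.real (Metric.ball (0 : Vec n) 1) * f y ≤
        ∫ x in Metric.ball (0 : Vec n) 1, f (y + gradMat w x) := by
  have hint : IntegrableOn (fun x => f (y + gradMat w x)) (Metric.ball 0 1) :=
    ((hf.comp (continuous_const.add (continuous_gradMat (hw.1.of_le (by simp))))).continuousOn
      |>.integrableOn_compact (isCompact_closedBall 0 1)).mono_set Metric.ball_subset_closedBall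
  refine ⟨hint, ?_⟩
  have h := hq w _ ((hw.isInnerVariation hφ).memWZero hφ) hint
  have hv : 0 < volume.real (Metric.ball (0 : Vec n) 1) :=
    ENNReal.toReal_pos (Metric.measure_ball_pos _ _ one_pos).ne' measure_ball_lt_top.ne
  have h0 : 0 ≤ ⨍ x in Metric.ball (0 : Vec n) 1, shift φ (1 + ‖y‖) ‖gradMat w x‖ := by
    rw [setAverage_eq]
    exact smul_nonneg (by positivity) (integral_nonneg fun x => hH _ (norm_nonneg _))
  rw [setAverage_eq (f := fun x => f (y + gradMat w x)), smul_eq_mul] at h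
  have h1 : f y ≤ (volume.real (Metric.ball (0 : Vec n) 1))⁻¹ *
      ∫ x in Metric.ball (0 : Vec n) 1, f (y + gradMat w x) := by
    have := mul_nonneg hγ h0
    linarith
  rwa [le_inv_mul_iff₀ hv] at h1

/-- The second variation of a quasiconvex integrand is nonnegative. -/
theorem StrictQuasiconvexAt.integral_second_variation_nonneg (hφ : IsModular m φ)
    {f : Mat N n → ℝ} {y : Mat N n} (hf : ContDiff ℝ 2 f) (hγ : 0 ≤ γ)
    (hH : ∀ t, 0 ≤ t → 0 ≤ shift φ (1 + ‖y‖) t) (hq : StrictQuasiconvexAt φ γ f y)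
    {w : Vec n → Vec N} (hw : IsTestMap (Metric.ball 0 1) w) :
    0 ≤ ∫ x in Metric.ball (0 : Vec n) 1,
      fderiv ℝ (fderiv ℝ f) y (gradMat w x) (gradMat w x) := by
  obtain ⟨R, hR, hwR⟩ := hw.exists_norm_gradMat_le
  set B := Metric.ball (0 : Vec n) 1
  set Q := fderiv ℝ (fderiv ℝ f) y
  have hBfin : volume B ≠ ⊤ := measure_ball_lt_top.ne
  have : IsFiniteMeasure (volume.restrict B) := isFiniteMeasure_restrict.2 hBfin
  have hgc : Continuous (gradMat w) := continuous_gradMat (hw.1.of_le (by simp))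
  have hwd : Differentiable ℝ w := hw.1.differentiable (by simp)
  have hQi : IntegrableOn (fun x => Q (gradMat w x) (gradMat w x)) B :=
    (((Q.continuous.comp hgc).clm_apply hgc).continuousOn.integrableOn_compact
      (isCompact_closedBall 0 1)).mono_set Metric.ball_subset_closedBall
  by_contra! hneg
  set I := ∫ x in B, Q (gradMat w x) (gradMat w x)
  have hv : 0 < volume.real B :=
    ENNReal.toReal_pos (Metric.measure_ball_pos _ _ one_pos).ne' hBfin
  set η := -I / (2 * R ^ 2 * volume.real B)
  have hη : 0 < η := by
    have : 0 < -I := by linarith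
    positivity
  obtain ⟨r, hr, h⟩ := exists_second_difference_le hf y hη
  set ε := r / (2 * R)
  have hε : 0 < ε := by positivity
  obtain ⟨i1, k1⟩ := hq.mul_le_integral hφ hf.continuous hγ hH (hw.const_smul ε)
  obtain ⟨i2, k2⟩ := hq.mul_le_integral hφ hf.continuous hγ hH (hw.const_smul (-ε))
  simp only [gradMat_const_smul hwd] at i1 k1 i2 k2
  have hle : ∀ x, f (y + ε • gradMat w x) + f (y + -ε • gradMat w x) ≤
      (2 * f y + η * ε ^ 2 * R ^ 2) + ε ^ 2 * Q (gradMat w x) (gradMat w x) := by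
    intro x
    have hn : ‖ε • gradMat w x‖ ≤ ε * R := by
      rw [norm_smul, Real.norm_of_nonneg hε.le]
      gcongr
      exact hwR x
    have hεR : ε * R = r / 2 := by
      simp only [ε]
      field_simp
    have h1 := h (ε • gradMat w x) (by linarith)
    simp only [map_smul, smul_apply, smul_eq_mul] at h1
    have h2 : η * ‖ε • gradMat w x‖ ^ 2 ≤ η * (ε * R) ^ 2 := by gcongr
    rw [neg_smul, ← sub_eq_add_neg]
    nlinarith
  have := integral_mono (i1.add i2)
    ((integrable_const (2 * f y + η * ε ^ 2 * R ^ 2)).add (hQi.const_mul (ε ^ 2))) hle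
  have e1 : ∫ x in B, ((2 * f y + η * ε ^ 2 * R ^ 2) + ε ^ 2 * Q (gradMat w x) (gradMat w x)) =
      volume.real B * (2 * f y) + (ε ^ 2 * I + volume.real B * (η * ε ^ 2 * R ^ 2)) := by
    rw [integral_add (integrable_const _) (hQi.const_mul _), integral_const_mul]
    simp only [integral_const, measureReal_restrict_apply_univ, smul_eq_mul]
    ring
  have e2 := integral_add i1 i2
  simp only [Pi.add_apply] at this
  rw [e2, e1] at this
  have e3 : volume.real B * (η * ε ^ 2 * R ^ 2) = -I * ε ^ 2 / 2 := by
    simp only [η]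
    field_simp
  rw [e3] at this
  have : ε ^ 2 * I < 0 := mul_neg_of_pos_of_neg (by positivity) hneg
  linarith

theorem gradMat_smul_const {h : Vec n → ℝ} (hh : Differentiable ℝ h) (a : Vec N) (x : Vec n) :
    gradMat (fun x => h x • a) x = outer a (gradVec h x) := by
  ext ⟨i, j⟩
  have e : fderiv ℝ (fun x => h x • a) x = _ := ((hh x).hasFDerivAt.smul_const a).fderiv
  rw [gradMat_apply, e, outer_apply]
  simp [gradVec, mul_comm]

theorem gradVec_mul_comp_inner {χ : Vec n → ℝ} (hχ : Differentiable ℝ χ) {S S' : ℝ → ℝ}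
    (hS : ∀ t, HasDerivAt S (S' t) t) {k : ℝ} (hk : k ≠ 0) (b x : Vec n) :
    gradVec (fun x => k⁻¹ * (χ x * S (k * inner ℝ b x))) x =
      (χ x * S' (k * inner ℝ b x)) • b + (k⁻¹ * S (k * inner ℝ b x)) • gradVec χ x := by
  have h1 : HasFDerivAt (fun x : Vec n => k * inner ℝ b x) (k • innerSL ℝ b) x :=
    ((innerSL ℝ b).hasFDerivAt (x := x)).const_mul k
  have h2 := ((hχ x).hasFDerivAt.mul ((hS _).comp_hasFDerivAt x h1)).const_mul k⁻¹
  have e : fderiv ℝ (fun x => k⁻¹ * (χ x * S (k * inner ℝ b x))) x = _ := h2.fderiv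
  ext j
  simp only [gradVec, e]
  have hj := EuclideanSpace.inner_single_right (𝕜 := ℝ) j (1 : ℝ) b
  simp only [smul_apply, add_apply, innerSL_apply_apply, smul_eq_mul, hj, PiLp.add_apply,
    PiLp.smul_apply, Function.comp_apply]
  simp only [one_mul, conj_trivial]
  field_simp

theorem outer_add_smul (a : Vec N) (b g : Vec n) (c d : ℝ) :
    outer a (c • b + d • g) = c • outer a b + d • outer a g := by
  ext ⟨i, j⟩
  simp only [outer_apply, PiLp.add_apply, PiLp.smul_apply, smul_eq_mul]
  ring

/-- The Legendre-Hadamard condition. The second variation is tested with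
`k⁻¹ χ(x) sin (k ⟨b, x⟩) a` and `k⁻¹ χ(x) cos (k ⟨b, x⟩) a`: in the sum of the two, the mixed
terms cancel and the principal term no longer oscillates. -/
theorem StrictQuasiconvexAt.rank_one_nonneg (hφ : IsModular m φ)
    {f : Mat N n → ℝ} {y : Mat N n} (hf : ContDiff ℝ 2 f) (hγ : 0 ≤ γ)
    (hH : ∀ t, 0 ≤ t → 0 ≤ shift φ (1 + ‖y‖) t) (hq : StrictQuasiconvexAt φ γ f y)
    (a : Vec N) (b : Vec n) :
    0 ≤ fderiv ℝ (fderiv ℝ f) y (outer a b) (outer a b) := by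
  set Q := fderiv ℝ (fderiv ℝ f) y
  obtain ⟨_, _, hcut⟩ := exists_cutoff n
  obtain ⟨χ, hχ, -, hχ1, hχ0, -⟩ := hcut (1 / 2) (3 / 4) le_rfl (by norm_num)
  have hχd : Differentiable ℝ χ := hχ.differentiable (by simp)
  have htest : ∀ (S : ℝ → ℝ) (k : ℝ), ContDiff ℝ ∞ S →
      IsTestMap (Metric.ball (0 : Vec n) 1) fun x => (k⁻¹ * (χ x * S (k * inner ℝ b x))) • a := by
    intro S k hS
    have hsub : tsupport (fun x => (k⁻¹ * (χ x * S (k * inner ℝ b x))) • a) ⊆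
        Metric.closedBall 0 (3 / 4) := by
      refine closure_minimal (fun x hx => ?_) Metric.isClosed_closedBall
      by_contra hx'
      rw [mem_closedBall_zero_iff, not_le] at hx'
      exact hx (by simp [hχ0 x hx'.le])
    refine ⟨?_, HasCompactSupport.of_support_subset_isCompact (isCompact_closedBall 0 (3 / 4))
      (subset_closure.trans hsub), hsub.trans (Metric.closedBall_subset_ball (by norm_num))⟩
    exact (contDiff_const.mul (hχ.mul (hS.comp (contDiff_const.mul
      (innerSL ℝ b).contDiff)))).smul contDiff_const
  set g := gradVec χ
  have hgc : Continuous fun x => outer a (g x) :=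
    continuous_outer.comp (continuous_const.prodMk (continuous_gradVec (hχ.of_le (by simp))))
  set B := Metric.ball (0 : Vec n) 1
  have hint : ∀ {h : Vec n → ℝ}, Continuous h → IntegrableOn h B := fun hh =>
    (hh.continuousOn.integrableOn_compact (isCompact_closedBall 0 1)).mono_set
      Metric.ball_subset_closedBall
  have hQc : ∀ {D : Vec n → Mat N n}, Continuous D → Continuous fun x => Q (D x) (D x) :=
    fun hD => (Q.continuous.comp hD).clm_apply hD
  have hPi := hQc hgc
  set I₁ := ∫ x in B, χ x ^ 2
  set I₂ := ∫ x in B, Q (outer a (g x)) (outer a (g x))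
  -- the sum of the two second variations
  have hk : ∀ k : ℝ, 0 < k → 0 ≤ Q (outer a b) (outer a b) * I₁ + (k ^ 2)⁻¹ * I₂ := by
    intro k hk
    have h1 := hq.integral_second_variation_nonneg hφ hf hγ hH (htest _ k Real.contDiff_sin)
    have h2 := hq.integral_second_variation_nonneg hφ hf hγ hH (htest _ k Real.contDiff_cos)
    have c1 := continuous_gradMat ((htest _ k Real.contDiff_sin).1.of_le (n := ∞) (m := 1) (by simp))
    have c2 := continuous_gradMat ((htest _ k Real.contDiff_cos).1.of_le (n := ∞) (m := 1) (by simp))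
    have h3 := add_nonneg h1 h2
    rw [← integral_add (hint (hQc c1)) (hint (hQc c2))] at h3
    refine h3.trans_eq ?_
    rw [← integral_const_mul, ← integral_const_mul,
      ← integral_add (f := fun x => Q (outer a b) (outer a b) * χ x ^ 2)
        (g := fun x => (k ^ 2)⁻¹ * Q (outer a (g x)) (outer a (g x)))
        (hint (continuous_const.mul (hχ.continuous.pow 2))) (hint (continuous_const.mul hPi))]
    congr 1 with x
    have d1 : Differentiable ℝ fun x => k⁻¹ * (χ x * Real.sin (k * inner ℝ b x)) :=
      ((hχd.mul (Real.differentiable_sin.comp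
        ((innerSL ℝ b).differentiable.const_mul k))).const_mul _)
    have d2 : Differentiable ℝ fun x => k⁻¹ * (χ x * Real.cos (k * inner ℝ b x)) :=
      ((hχd.mul (Real.differentiable_cos.comp
        ((innerSL ℝ b).differentiable.const_mul k))).const_mul _)
    rw [gradMat_smul_const d1, gradMat_smul_const d2,
      gradVec_mul_comp_inner hχd Real.hasDerivAt_sin hk.ne',
      gradVec_mul_comp_inner hχd Real.hasDerivAt_cos hk.ne', outer_add_smul, outer_add_smul]
    have hsc := Real.sin_sq_add_cos_sq (k * inner ℝ b x)
    simp only [map_add, map_smul, add_apply, smul_apply, smul_eq_mul]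
    set s := Real.sin (k * inner ℝ b x)
    set c := Real.cos (k * inner ℝ b x)
    linear_combination (χ x ^ 2 * Q (outer a b) (outer a b) +
      (k ^ 2)⁻¹ * Q (outer a (g x)) (outer a (g x))) * hsc
  have hI₁ : 0 < I₁ := by
    have hc : Continuous fun x => χ x ^ 2 := hχ.continuous.pow 2
    refine (integral_pos_iff_support_of_nonneg (fun x => sq_nonneg _) (hint hc)).2 ?_
    refine lt_of_lt_of_le (Metric.measure_ball_pos volume (0 : Vec n) (r := 1 / 2) (by norm_num))
      ?_
    rw [Measure.restrict_apply' Metric.isOpen_ball.measurableSet]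
    refine measure_mono fun x hx => ⟨?_, Metric.ball_subset_ball (by norm_num) hx⟩
    rw [Function.mem_support, hχ1 x (mem_ball_zero_iff.1 hx).le]
    norm_num
  have hlim : Tendsto (fun k : ℝ => Q (outer a b) (outer a b) * I₁ + (k ^ 2)⁻¹ * I₂) atTop
      (𝓝 (Q (outer a b) (outer a b) * I₁ + 0 * I₂)) :=
    tendsto_const_nhds.add ((tendsto_inv_atTop_zero.comp
      (tendsto_pow_atTop two_ne_zero)).mul_const _)
  have := ge_of_tendsto hlim (by filter_upwards [eventually_gt_atTop 0] with k hk' using hk k hk')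
  rw [zero_mul, add_zero] at this
  exact nonneg_of_mul_nonneg_left this hI₁

end LegendreHadamard

/-! ### Bounds for the derivative of the integrand -/

section DerivativeBounds

variable {n N : ℕ} {M Γ₂ p q : ℝ} {ψ : ℝ → ℝ}

theorem norm_fderiv_fderiv {E : Type*} [NormedAddCommGroup E] [NormedSpace ℝ E] (f : E → ℝ) (z : E) :
    ‖fderiv ℝ (fderiv ℝ f) z‖ = ‖iteratedFDeriv ℝ 2 f z‖ := by
  rw [← norm_iteratedFDeriv_one, norm_iteratedFDeriv_fderiv]

/-- One-sided bound of the slope of a nonnegative function which is convex along a segment. -/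
theorem mul_fderiv_le_of_convex {E : Type*} [NormedAddCommGroup E] [NormedSpace ℝ E] {f : E → ℝ}
    (hf : ContDiff ℝ 2 f) {y e : E} {r : ℝ} (hr : 0 < r)
    (hconv : ∀ t ∈ Ioo 0 r, 0 ≤ fderiv ℝ (fderiv ℝ f) (y + t • e) e e) (h0 : 0 ≤ f y) :
    r * fderiv ℝ f y e ≤ f (y + r • e) := by
  have hf1 : ContDiff ℝ 1 (fderiv ℝ f) := hf.fderiv_right (by norm_num)
  have hl : ∀ t, HasDerivAt (fun t : ℝ => y + t • e) e t := fun t => by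
    simpa using ((hasDerivAt_id t).smul_const e).const_add y
  have d1 : ∀ t, HasDerivAt (fun t : ℝ => f (y + t • e)) (fderiv ℝ f (y + t • e) e) t := fun t =>
    (hf.differentiable (by norm_num) _).hasFDerivAt.comp_hasDerivAt t (hl t)
  have d2 : ∀ t, HasDerivAt (fun t : ℝ => fderiv ℝ f (y + t • e) e)
      (fderiv ℝ (fderiv ℝ f) (y + t • e) e e) t := fun t => by
    have := ((hf1.differentiable one_ne_zero _).hasFDerivAt.comp_hasDerivAt t (hl t)).clm_apply
      (hasDerivAt_const t e)
    simpa using this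
  have m1 : MonotoneOn (fun t : ℝ => fderiv ℝ f (y + t • e) e) (Icc 0 r) := by
    refine monotoneOn_of_deriv_nonneg (convex_Icc 0 r)
      (fun t _ => (d2 t).continuousAt.continuousWithinAt)
      (fun t _ => (d2 t).differentiableAt.differentiableWithinAt) fun t ht => ?_
    rw [interior_Icc] at ht
    rw [(d2 t).deriv]
    exact hconv t ht
  have d3 : ∀ t, HasDerivAt (fun t : ℝ => f (y + t • e) - t * fderiv ℝ f y e)
      (fderiv ℝ f (y + t • e) e - fderiv ℝ f y e) t := fun t => by
    exact ((d1 t).sub ((hasDerivAt_id t).mul_const (fderiv ℝ f y e))).congr_deriv (by simp)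
  have m2 : MonotoneOn (fun t : ℝ => f (y + t • e) - t * fderiv ℝ f y e) (Icc 0 r) := by
    refine monotoneOn_of_deriv_nonneg (convex_Icc 0 r)
      (fun t _ => (d3 t).continuousAt.continuousWithinAt)
      (fun t _ => (d3 t).differentiableAt.differentiableWithinAt) fun t ht => ?_
    rw [interior_Icc] at ht
    rw [(d3 t).deriv, sub_nonneg]
    simpa using m1 (left_mem_Icc.2 hr.le) (Ioo_subset_Icc_self ht) ht.1.le
  have := m2 (left_mem_Icc.2 hr.le) (right_mem_Icc.2 hr.le) hr.le
  simp only [zero_smul, add_zero, zero_mul, sub_zero] at this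
  linarith

theorem norm_le_of_single_le (T : Mat N n →L[ℝ] ℝ) {K : ℝ}
    (hT : ∀ i j, |T (EuclideanSpace.single (i, j) 1)| ≤ K) : ‖T‖ ≤ N * n * K := by
  have key : ∀ A : Mat N n, T A = ∑ ij, A ij * T (EuclideanSpace.single ij 1) := fun A => by
    conv_lhs => rw [← (EuclideanSpace.basisFun (Fin N × Fin n) ℝ).sum_repr A]
    simp [map_sum]
  have hKs : 0 ≤ N * n * K := by
    rcases Nat.eq_zero_or_pos N with h | h
    · simp [h]
    rcases Nat.eq_zero_or_pos n with h' | h'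
    · simp [h']
    have := (abs_nonneg _).trans (hT ⟨0, h⟩ ⟨0, h'⟩)
    positivity
  refine T.opNorm_le_bound hKs fun A => ?_
  rw [key]
  refine (Finset.abs_sum_le_sum_abs _ _).trans ?_
  calc ∑ ij, |A ij * T (EuclideanSpace.single ij 1)| ≤ ∑ _ij : Fin N × Fin n, ‖A‖ * K := by
        refine Finset.sum_le_sum fun ij _ => ?_
        rw [abs_mul]
        exact mul_le_mul (PiLp.norm_apply_le A ij) (hT ij.1 ij.2) (abs_nonneg _) (norm_nonneg _)
    _ = N * n * K * ‖A‖ := by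
        simp
        ring

/-- `f` is of class `C²`, between `0` and `Γ₂ (1 + ψ)`, with `|D²f| ≤ Γ₂ (1 + ψ'')` away from the
origin, and satisfies the Legendre-Hadamard condition beyond `M`. -/
structure IsEllipticIntegrand (ψ : ℝ → ℝ) (M Γ₂ : ℝ) (f : Mat N n → ℝ) : Prop where
  contDiff : ContDiff ℝ 2 f
  nonneg : ∀ z, 0 ≤ f z
  le : ∀ z, f z ≤ Γ₂ * (1 + ψ ‖z‖)
  norm_le : ∀ z, z ≠ 0 → ‖fderiv ℝ (fderiv ℝ f) z‖ ≤ Γ₂ * (1 + deriv (deriv ψ) ‖z‖)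
  rank_one : ∀ z, M < ‖z‖ → ∀ a b, 0 ≤ fderiv ℝ (fderiv ℝ f) z (outer a b) (outer a b)

theorem IsEllipticIntegrand.norm_fderiv_le_of_lt {f : Mat N n → ℝ}
    (hf : IsEllipticIntegrand ψ M Γ₂ f) (hψ : IsRegularYoung ψ) (hd : DerivComparable p q ψ)
    (hM : 0 < M) (hΓ : 0 < Γ₂) {y : Mat N n} (hy : 2 * M < ‖y‖) :
    ‖fderiv ℝ f y‖ ≤ N * n * (Γ₂ / M + 2 * Γ₂ * 2 ^ (q + 1) * rderiv ψ ‖y‖) := by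
  have hy0 : 0 < ‖y‖ := by linarith
  have hmod := hψ.isModular hd
  have hr := hψ.toIsYoung.rderiv_nonneg hy0.le
  have key : ∀ e : Mat N n, ‖e‖ = 1 → (∀ z, M < ‖z‖ → 0 ≤ fderiv ℝ (fderiv ℝ f) z e e) →
      fderiv ℝ f y e ≤ Γ₂ / M + 2 * Γ₂ * 2 ^ (q + 1) * rderiv ψ ‖y‖ := by
    intro e he hz
    have hle : ∀ t, 0 ≤ t → ‖t • e‖ = t := fun t ht => by
      rw [norm_smul, he, mul_one, Real.norm_of_nonneg ht]
    have h1 := mul_fderiv_le_of_convex hf.contDiff (y := y) (e := e) (half_pos hy0)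
      (fun t ht => hz _ (by
        have := norm_sub_le (y + t • e) (t • e)
        rw [add_sub_cancel_right, hle t ht.1.le] at this
        linarith [ht.2])) (hf.nonneg y)
    have h2 : ‖y + (‖y‖ / 2) • e‖ ≤ 2 * ‖y‖ := by
      have := norm_add_le y ((‖y‖ / 2) • e)
      rw [hle _ (half_pos hy0).le] at this
      linarith
    have h3 : ψ ‖y + (‖y‖ / 2) • e‖ ≤ 2 ^ (q + 1) * (‖y‖ * rderiv ψ ‖y‖) := by
      refine (hmod.monotoneOn (norm_nonneg _) (show 0 ≤ 2 * ‖y‖ by positivity) h2).trans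
        ((hmod.map_mul_le 2 _ one_le_two hy0.le).trans ?_)
      gcongr
      exact hψ.toIsYoung.le_mul_rderiv hy0.le
    have h4 := h1.trans ((hf.le _).trans (mul_le_mul_of_nonneg_left
      (add_le_add_right h3 1) hΓ.le))
    have h5 : ‖y‖ / 2 * (Γ₂ / M) ≥ Γ₂ := by
      rw [ge_iff_le, ← mul_div_assoc, le_div_iff₀ hM]
      nlinarith
    refine le_of_mul_le_mul_left (h4.trans ?_) (half_pos hy0)
    rw [mul_add]
    nlinarith
  refine norm_le_of_single_le _ fun i j => ?_
  have hs : ∀ c : ℝ, outer (EuclideanSpace.single i c) (EuclideanSpace.single j (1 : ℝ)) =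
      (EuclideanSpace.single (i, j) c : Mat N n) := fun c => by
    ext ⟨k, l⟩
    by_cases h1 : k = i <;> by_cases h2 : l = j <;> simp [outer_apply, h1, h2]
  rw [abs_le']
  constructor
  · exact key _ (by simp) fun z hz => hs 1 ▸ hf.rank_one z hz _ _
  · have := key (-EuclideanSpace.single (i, j) 1) (by simp) fun z hz => by
      rw [map_neg, map_neg, neg_apply, neg_neg]
      exact hs 1 ▸ hf.rank_one z hz _ _
    rwa [map_neg] at this

/-- The bound `|Df| ≤ C (1 + ψ')`. For large arguments it follows from convexity in rank-one
directions. It extends to the remaining arguments by integrating `D²f` along rays, since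
`ψ''` is the derivative of `ψ'`. -/
theorem exists_norm_fderiv_le (n N : ℕ) (hψ : IsRegularYoung ψ) (hd : DerivComparable p q ψ)
    (hM : 0 < M) (hΓ : 0 < Γ₂) : ∃ C, 0 < C ∧ ∀ f : Mat N n → ℝ, IsEllipticIntegrand ψ M Γ₂ f →
      ∀ y, ‖fderiv ℝ f y‖ ≤ C * (1 + rderiv ψ ‖y‖) := by
  set R := 3 * M with hRdef
  have hR : 0 < R := by positivity
  have hψR := hψ.toIsYoung.rderiv_nonneg hR.le
  set C₁ : ℝ := N * n * (Γ₂ / M + 2 * Γ₂ * 2 ^ (q + 1))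
  set C₂ : ℝ := C₁ * (1 + rderiv ψ R) + Γ₂ * (R + rderiv ψ R)
  have hC₁ : 0 ≤ C₁ := by positivity
  have hC₂ : 0 < C₂ := by positivity
  refine ⟨C₁ + C₂, by positivity, fun f hf => ?_⟩
  have hlarge : ∀ y : Mat N n, 2 * M < ‖y‖ → ‖fderiv ℝ f y‖ ≤ C₁ * (1 + rderiv ψ ‖y‖) := by
    intro y hy
    refine (hf.norm_fderiv_le_of_lt hψ hd hM hΓ hy).trans ?_
    have hr := hψ.toIsYoung.rderiv_nonneg (norm_nonneg y)
    simp only [C₁]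
    rw [mul_assoc (N * n : ℝ) _ (1 + rderiv ψ ‖y‖)]
    refine mul_le_mul_of_nonneg_left ?_ (show (0 : ℝ) ≤ N * n by positivity)
    have h1 : 0 < 2 * Γ₂ * 2 ^ (q + 1) := by positivity
    have h2 : 0 < Γ₂ / M := by positivity
    nlinarith
  have hf1 : ContDiff ℝ 1 (fderiv ℝ f) := hf.contDiff.fderiv_right (by norm_num)
  have hsmall : ∀ y : Mat N n, y ≠ 0 → ‖y‖ ≤ 2 * M → ‖fderiv ℝ f y‖ ≤ C₂ := by
    intro y hy0 hy
    have hny : 0 < ‖y‖ := norm_pos_iff.2 hy0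
    set e := ‖y‖⁻¹ • y
    have hne : ∀ t, 0 ≤ t → ‖t • e‖ = t := fun t ht => by
      rw [norm_smul, norm_smul, norm_inv, norm_norm, inv_mul_cancel₀ hny.ne', mul_one,
        Real.norm_of_nonneg ht]
    have hey : ‖y‖ • e = y := smul_inv_smul₀ hny.ne' y
    have hne1 : ‖e‖ = 1 := by simpa using hne 1 zero_le_one
    have hk : ∀ t, HasDerivAt (fun t : ℝ => fderiv ℝ f (t • e) - fderiv ℝ f y)
        (fderiv ℝ (fderiv ℝ f) (t • e) e) t := fun t => by
      have hl : HasDerivAt (fun t : ℝ => t • e) e t := by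
        simpa using (hasDerivAt_id t).smul_const e
      exact ((hf1.differentiable one_ne_zero _).hasFDerivAt.comp_hasDerivAt t hl).sub_const _
    have hB : ∀ t, 0 < t → HasDerivAt (fun t => Γ₂ * ((t - ‖y‖) + (deriv ψ t - deriv ψ ‖y‖)))
        (Γ₂ * (1 + deriv (deriv ψ) t)) t := fun t ht =>
      (((hasDerivAt_id t).sub_const _).add ((hψ.hasDerivAt_deriv ht).sub_const _)).const_mul _
    have hyR : ‖y‖ ≤ R := by linarith
    have := image_norm_le_of_norm_deriv_right_le_deriv_boundary' (a := ‖y‖) (b := R)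
      (fun t _ => (hk t).continuousAt.continuousWithinAt) (fun t _ => (hk t).hasDerivWithinAt)
      (by simp [hey]) (fun t ht => (hB t (hny.trans_le ht.1)).continuousAt.continuousWithinAt)
      (fun t ht => (hB t (hny.trans_le ht.1)).hasDerivWithinAt) (fun t ht => by
        have ht0 : 0 < t := hny.trans_le ht.1
        have h1 := hf.norm_le (t • e) (by rw [← norm_pos_iff, hne t ht0.le]; exact ht0)
        rw [hne t ht0.le] at h1
        refine (ContinuousLinearMap.le_opNorm _ _).trans ?_
        rwa [hne1, mul_one]) (right_mem_Icc.2 hyR)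
    have h2 := hlarge (R • e) (by rw [hne R hR.le]; linarith)
    rw [hne R hR.le] at h2
    have h3 := norm_le_norm_add_norm_sub' (fderiv ℝ f y) (fderiv ℝ f (R • e))
    rw [norm_sub_rev] at h3
    have h4 : 0 ≤ deriv ψ ‖y‖ := by
      rw [← rderiv_eq_deriv hny]
      exact hψ.toIsYoung.rderiv_nonneg hny.le
    rw [← rderiv_eq_deriv hR] at this
    have h5 : Γ₂ * (R - ‖y‖ + (rderiv ψ R - deriv ψ ‖y‖)) ≤ Γ₂ * (R + rderiv ψ R) :=
      mul_le_mul_of_nonneg_left (by linarith) hΓ.le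
    simp only [C₂]
    linarith
  have hzero : ‖fderiv ℝ f 0‖ ≤ C₂ := by
    rcases subsingleton_or_nontrivial (Mat N n) with h | h
    · rw [Subsingleton.elim (fderiv ℝ f 0) 0, norm_zero]
      exact hC₂.le
    · have hc : Tendsto (fun y => ‖fderiv ℝ f y‖) (𝓝[≠] 0) (𝓝 ‖fderiv ℝ f 0‖) :=
        hf1.continuous.norm.continuousAt.tendsto.mono_left nhdsWithin_le_nhds
      refine le_of_tendsto hc ?_
      filter_upwards [self_mem_nhdsWithin, mem_nhdsWithin_of_mem_nhds
        (Metric.closedBall_mem_nhds (0 : Mat N n) (ε := 2 * M) (by positivity))] with y h1 h2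
      exact hsmall y h1 (mem_closedBall_zero_iff.1 h2)
  intro y
  have hr := hψ.toIsYoung.rderiv_nonneg (norm_nonneg y)
  rcases lt_or_ge (2 * M) ‖y‖ with h | h
  · exact (hlarge y h).trans (by gcongr; linarith)
  · have : ‖fderiv ℝ f y‖ ≤ C₂ := by
      rcases eq_or_ne y 0 with rfl | hy
      · exact hzero
      · exact hsmall y hy h
    nlinarith

end DerivativeBounds

/-! ### Increments of the integrand -/

section MixedDifferences

variable {n N : ℕ} {M Γ₂ p q a β : ℝ} {φ ψ : ℝ → ℝ}

/-- The modulus of continuity of `Df` at points in the annulus `M < |z| ≤ a`. Close to `z` it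
follows from the bound of `D²f`, far from `z` from that of `Df`. -/
theorem exists_norm_fderiv_sub_le (n N : ℕ) (hψ : IsRegularYoung ψ) (hd : DerivComparable p q ψ)
    (hq : 0 < q) (hM : 0 < M) (hΓ : 0 < Γ₂) (ha : M < a) :
    ∃ C, 0 < C ∧ ∀ f : Mat N n → ℝ, IsEllipticIntegrand ψ M Γ₂ f →
      ∀ z, M < ‖z‖ → ‖z‖ ≤ a → ∀ A,
        ‖fderiv ℝ f (z + A) - fderiv ℝ f z‖ ≤ C * shiftDeriv ψ a ‖A‖ := by
  obtain ⟨C₀, hC₀, hb⟩ := exists_norm_fderiv_le n N hψ hd hM hΓ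
  have ha0 : 0 < a := hM.trans ha
  have hY := hψ.toIsYoung
  have hpa := hY.deriv_pos a ha0
  have hp2 := hY.deriv_pos (2 * a) (by positivity)
  set K : ℝ := Γ₂ * (1 + q * (rderiv ψ (2 * a) / (M / 2)))
  have hK : 0 < K := by positivity
  set C₁ : ℝ := K * ((a + M / 2) / rderiv ψ a)
  set C₂ : ℝ := 2 * C₀ * ((rderiv ψ a)⁻¹ + 1) * ((a + M / 2) / (M / 2))
  have hC₁ : 0 < C₁ := by positivity
  have hC₂ : 0 < C₂ := by positivity
  refine ⟨C₁ + C₂, by positivity, fun f hf z hz hza A => ?_⟩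
  have hs := hY.shiftDeriv_nonneg ha0 (norm_nonneg A)
  have hf1 : ContDiff ℝ 1 (fderiv ℝ f) := hf.contDiff.fderiv_right (by norm_num)
  rcases le_or_gt ‖A‖ (M / 2) with hA | hA
  · have h1 : ‖fderiv ℝ f (z + A) - fderiv ℝ f z‖ ≤ K * ‖z + A - z‖ := by
      refine (convex_closedBall z (M / 2)).norm_image_sub_le_of_norm_fderiv_le (𝕜 := ℝ)
        (fun x _ => hf1.differentiable one_ne_zero x) (fun x hx => ?_)
        (Metric.mem_closedBall_self (by positivity)) (by simpa [dist_eq_norm] using hA)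
      rw [Metric.mem_closedBall, dist_eq_norm] at hx
      have l1 : M / 2 ≤ ‖x‖ := by
        have := norm_sub_norm_le z x
        rw [norm_sub_rev] at this
        linarith
      have l2 : ‖x‖ ≤ 2 * a := by
        have := norm_sub_norm_le x z
        linarith
      have hx0 : 0 < ‖x‖ := lt_of_lt_of_le (half_pos hM) l1
      refine (hf.norm_le x (norm_pos_iff.1 hx0)).trans ?_
      have h2 := (hd ‖x‖ hx0).2
      rw [← rderiv_eq_deriv (h := ψ) hx0] at h2
      have h3 : rderiv ψ ‖x‖ / ‖x‖ ≤ rderiv ψ (2 * a) / (M / 2) :=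
        div_le_div₀ hp2.le (hY.deriv_mono (norm_nonneg _) (show 0 ≤ 2 * a by positivity) l2)
          (half_pos hM) l1
      have h4 := mul_le_mul_of_nonneg_left h3 hq.le
      exact mul_le_mul_of_nonneg_left (by linarith) hΓ.le
    rw [add_sub_cancel_left] at h1
    have h2 := hY.mul_le_shiftDeriv ha0 (norm_nonneg A) hA
    have h3 : K * ‖A‖ = C₁ * (rderiv ψ a / (a + M / 2) * ‖A‖) := by
      simp only [C₁]
      field_simp
    rw [h3] at h1
    exact h1.trans (mul_le_mul (by linarith) h2 (by positivity) (by positivity))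
  · have hA0 : 0 < ‖A‖ := (half_pos hM).trans hA
    have haA : 0 ≤ a + ‖A‖ := by positivity
    have h1 := norm_sub_le_of_le (hb f hf (z + A)) (hb f hf z)
    have h2 : rderiv ψ ‖z + A‖ ≤ rderiv ψ (a + ‖A‖) :=
      hY.deriv_mono (norm_nonneg _) haA ((norm_add_le z A).trans (by linarith))
    have h3 : rderiv ψ ‖z‖ ≤ rderiv ψ (a + ‖A‖) :=
      hY.deriv_mono (norm_nonneg _) haA (by linarith)
    have h4 : rderiv ψ a ≤ rderiv ψ (a + ‖A‖) := hY.deriv_mono ha0.le haA (by linarith)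
    set P := rderiv ψ (a + ‖A‖)
    have h5 : 1 ≤ (rderiv ψ a)⁻¹ * P := by
      rw [le_inv_mul_iff₀ hpa]
      linarith
    have h6 : P ≤ (a + M / 2) / (M / 2) * shiftDeriv ψ a ‖A‖ := by
      have hP : 0 < P := hpa.trans_le h4
      have : M / 2 / (a + M / 2) ≤ ‖A‖ / (a + ‖A‖) := by
        rw [div_le_div_iff₀ (by positivity) (by positivity)]
        nlinarith
      have h7 : P * (M / 2 / (a + M / 2)) ≤ shiftDeriv ψ a ‖A‖ :=
        mul_le_mul_of_nonneg_left this hP.le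
      calc P = (a + M / 2) / (M / 2) * (P * (M / 2 / (a + M / 2))) := by field_simp
        _ ≤ _ := by gcongr
    calc ‖fderiv ℝ f (z + A) - fderiv ℝ f z‖
        ≤ C₀ * (1 + rderiv ψ ‖z + A‖) + C₀ * (1 + rderiv ψ ‖z‖) := h1
      _ ≤ C₀ * ((rderiv ψ a)⁻¹ * P + P) + C₀ * ((rderiv ψ a)⁻¹ * P + P) := by gcongr
      _ = 2 * C₀ * ((rderiv ψ a)⁻¹ + 1) * P := by ring
      _ ≤ 2 * C₀ * ((rderiv ψ a)⁻¹ + 1) * ((a + M / 2) / (M / 2) * shiftDeriv ψ a ‖A‖) := by gcongr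
      _ = C₂ * shiftDeriv ψ a ‖A‖ := by simp only [C₂]; ring
      _ ≤ _ := by gcongr; linarith

theorem abs_sub_sub_fderiv_le {E : Type*} [NormedAddCommGroup E] [NormedSpace ℝ E] {f : E → ℝ}
    (hf : Differentiable ℝ f) {z B : E} {g : ℝ → ℝ} (hg : MonotoneOn g (Ici 0))
    (h : ∀ A, ‖fderiv ℝ f (z + A) - fderiv ℝ f z‖ ≤ g ‖A‖) :
    |f (z + B) - f z - fderiv ℝ f z B| ≤ g ‖B‖ * ‖B‖ := by
  have hk : ∀ t, HasDerivAt (fun t : ℝ => f (z + t • B) - t * fderiv ℝ f z B)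
      ((fderiv ℝ f (z + t • B) - fderiv ℝ f z) B) t := fun t => by
    have hl : HasDerivAt (fun t : ℝ => z + t • B) B t := by
      simpa using ((hasDerivAt_id t).smul_const B).const_add z
    exact (((hf _).hasFDerivAt.comp_hasDerivAt t hl).sub
      ((hasDerivAt_id t).mul_const (fderiv ℝ f z B))).congr_deriv (by simp)
  have := norm_image_sub_le_of_norm_deriv_le_segment_01' (C := g ‖B‖ * ‖B‖)
    (fun t _ => (hk t).hasDerivWithinAt) (fun t ht => by
      refine (ContinuousLinearMap.le_opNorm _ _).trans
        (mul_le_mul_of_nonneg_right ((h _).trans (hg (norm_nonneg _) (norm_nonneg _) ?_))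
          (norm_nonneg _))
      rw [norm_smul, Real.norm_of_nonneg ht.1]
      exact mul_le_of_le_one_left (norm_nonneg _) ht.2.le)
  simp only [one_smul, one_mul, zero_smul, add_zero, zero_mul, sub_zero] at this
  rw [Real.norm_eq_abs] at this
  convert this using 2
  ring

theorem abs_mixed_difference_le {E : Type*} [NormedAddCommGroup E] [NormedSpace ℝ E] {f : E → ℝ}
    (hf : Differentiable ℝ f) {z A B : E} {g : ℝ → ℝ} (hg : MonotoneOn g (Ici 0))
    (h : ∀ A, ‖fderiv ℝ f (z + A) - fderiv ℝ f z‖ ≤ g ‖A‖) :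
    |f (z + A - B) - f z - f (z + A) + f (z + B)| ≤ 2 * g (‖A‖ + ‖B‖) * ‖B‖ := by
  have hl : ∀ (y : E) (t : ℝ), HasDerivAt (fun t : ℝ => f (y + t • B)) (fderiv ℝ f (y + t • B) B) t :=
    fun y t => (hf _).hasFDerivAt.comp_hasDerivAt t
      (by simpa using ((hasDerivAt_id t).smul_const B).const_add y)
  have hk := fun t => (hl z t).sub (hl (z + (A - B)) t)
  have := norm_image_sub_le_of_norm_deriv_le_segment_01' (C := 2 * g (‖A‖ + ‖B‖) * ‖B‖)
    (fun t _ => (hk t).hasDerivWithinAt) (fun t ht => by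
      rw [← sub_apply]
      refine (ContinuousLinearMap.le_opNorm _ _).trans
        (mul_le_mul_of_nonneg_right ?_ (norm_nonneg _))
      have hsum : (0 : ℝ) ≤ ‖A‖ + ‖B‖ := by positivity
      have h1 : g ‖t • B‖ ≤ g (‖A‖ + ‖B‖) := by
        refine hg (norm_nonneg _) hsum ?_
        rw [norm_smul, Real.norm_of_nonneg ht.1]
        have := mul_le_of_le_one_left (norm_nonneg B) ht.2.le
        linarith [norm_nonneg A]
      have h2 : g ‖A - B + t • B‖ ≤ g (‖A‖ + ‖B‖) := by
        refine hg (norm_nonneg _) hsum ?_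
        have e : A - B + t • B = A - (1 - t) • B := by
          rw [sub_smul, one_smul]
          abel
        rw [e]
        refine (norm_sub_le _ _).trans ?_
        rw [norm_smul, Real.norm_of_nonneg (by linarith [ht.2])]
        have := mul_le_of_le_one_left (norm_nonneg B) (show 1 - t ≤ 1 by linarith [ht.1])
        linarith
      have h3 := norm_sub_le_of_le (h (t • B)) (h (A - B + t • B))
      rw [sub_sub_sub_cancel_right, ← add_assoc] at h3
      linarith)
  simp only [Pi.sub_apply, one_smul, zero_smul, add_zero] at this
  rw [Real.norm_eq_abs] at this
  convert this using 2
  rw [show z + (A - B) + B = z + A by abel, show z + (A - B) = z + A - B by abel]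
  ring

/-- Increments of the integrand, controlled through the range of anisotropy. -/
theorem exists_mixed_difference_le (n N : ℕ) (hφ : IsRegularYoung φ) (hψ : IsRegularYoung ψ)
    (hdφ : DerivComparable p q φ) (hdψ : DerivComparable p q ψ)
    (hq : 0 < q) (hM : 0 < M) (hanis : AnisotropyRange φ ψ M β) (hΓ : 0 < Γ₂) (ha : M < a) :
    ∃ C, 0 < C ∧ ∀ f : Mat N n → ℝ, IsEllipticIntegrand ψ M Γ₂ f →
      ∀ z, M < ‖z‖ → ‖z‖ ≤ a → (∀ A B,
        |f (z + A - B) - f z - f (z + A) + f (z + B)| ≤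
          C * (shift φ a ‖A‖ + shift φ a ‖B‖ + shift φ a ‖B‖ ^ β)) ∧
        ∀ B, |f (z + B) - f z - fderiv ℝ f z B| ≤
          C * (shift φ a ‖B‖ + shift φ a ‖B‖ ^ β) := by
  have ha0 : 0 < a := hM.trans ha
  obtain ⟨C₀, hC₀, hG⟩ := exists_norm_fderiv_sub_le n N hψ hdψ hq hM hΓ ha
  obtain ⟨hN, hc⟩ := hanis a ha
  obtain ⟨C₁, hC₁, hK⟩ := exists_shiftDeriv_mul_le hφ hψ ha0 hN hc
  have hmod := hφ.isModular_shift hdφ ha0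
  have h2 : (0 : ℝ) < 2 ^ (q + 2) := by positivity
  refine ⟨2 * C₀ * (1 + 2 ^ (q + 2) + C₁), by positivity, fun f hf z hz hza => ?_⟩
  have hdiff := hf.contDiff.differentiable (by norm_num)
  have hg : MonotoneOn (fun t => C₀ * shiftDeriv ψ a t) (Ici 0) := fun s hs t ht hst =>
    mul_le_mul_of_nonneg_left
      ((hψ.toIsYoung.shiftDeriv_strictMono ha0).monotoneOn hs ht hst) hC₀.le
  constructor
  · intro A B
    have nA := hmod.nonneg (norm_nonneg A)
    have nB := hmod.nonneg (norm_nonneg B)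
    have nB' : 0 ≤ shift φ a ‖B‖ ^ β := Real.rpow_nonneg nB _
    refine (abs_mixed_difference_le hdiff hg (hG f hf z hz hza)).trans ?_
    have h1 := hK (‖A‖ + ‖B‖) ‖B‖ (by positivity) (norm_nonneg _)
    have h3 := hmod.map_add_le (norm_nonneg A) (norm_nonneg B)
    calc 2 * (C₀ * shiftDeriv ψ a (‖A‖ + ‖B‖)) * ‖B‖
        = 2 * C₀ * (shiftDeriv ψ a (‖A‖ + ‖B‖) * ‖B‖) := by ring
      _ ≤ 2 * C₀ * (2 ^ (q + 2) * (shift φ a ‖A‖ + shift φ a ‖B‖) +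
          C₁ * (shift φ a ‖B‖ + shift φ a ‖B‖ ^ β)) := by
          gcongr
          linarith
      _ ≤ _ := by
          rw [mul_assoc (2 * C₀)]
          refine mul_le_mul_of_nonneg_left ?_ (by positivity)
          have := mul_nonneg h2.le nB'
          have := mul_nonneg hC₁.le nA
          nlinarith
  · intro B
    have nB := hmod.nonneg (norm_nonneg B)
    have nB' : 0 ≤ shift φ a ‖B‖ ^ β := Real.rpow_nonneg nB _
    refine (abs_sub_sub_fderiv_le hdiff hg (hG f hf z hz hza)).trans ?_
    have h1 := hK ‖B‖ ‖B‖ (norm_nonneg _) (norm_nonneg _)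
    calc C₀ * shiftDeriv ψ a ‖B‖ * ‖B‖ = C₀ * (shiftDeriv ψ a ‖B‖ * ‖B‖) := by ring
      _ ≤ C₀ * (shift φ a ‖B‖ + C₁ * (shift φ a ‖B‖ + shift φ a ‖B‖ ^ β)) := by gcongr
      _ ≤ _ := by
          rw [mul_comm 2, mul_assoc C₀, mul_assoc C₀]
          refine mul_le_mul_of_nonneg_left ?_ hC₀.le
          have := mul_nonneg h2.le nB'
          have := mul_nonneg h2.le nB
          have := mul_nonneg hC₁.le nB
          have := mul_nonneg hC₁.le nB'
          nlinarith

end MixedDifferences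

/-! ### Comparison of energies -/

section EnergyComparison

variable {n N : ℕ} {p q a β γ C₀ r s : ℝ} {φ : ℝ → ℝ}

theorem IsWeakGrad.neg {U : Set (Vec n)} {w : Vec n → Vec N} {Dw : Vec n → Mat N n}
    (h : IsWeakGrad U w Dw) : IsWeakGrad U (fun x => -w x) (fun x => -Dw x) := by
  refine ⟨h.1.neg, h.2.1.neg, fun η h1 h2 h3 i j => ?_⟩
  have := h.2.2 η h1 h2 h3 i j
  simp only [PiLp.neg_apply, neg_mul, integral_neg]
  rw [this]

theorem IsInnerVariation.neg {x₀ : Vec n} {ρ : ℝ} {F : Vec n → Vec N} {DF : Vec n → Mat N n}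
    (h : IsInnerVariation φ x₀ ρ F DF) :
    IsInnerVariation φ x₀ ρ (fun x => -F x) (fun x => -DF x) := by
  obtain ⟨s, hs, hz⟩ := h.eq_zero
  refine ⟨h.isWeakGrad.neg, ⟨s, hs, fun x hx => ?_⟩, h.integrable.neg, h.integrable_grad.neg, ?_, ?_⟩
  · simp [hz x hx]
  · simpa only [norm_neg] using h.integrable_modular
  · simpa only [norm_neg] using h.integrable_modular_grad

theorem IsRegularYoung.integrable_shift (hφ : IsRegularYoung φ) (hd : DerivComparable p q φ)
    (ha : 0 < a) {α E : Type*} [MeasurableSpace α] {μ : Measure α} [IsFiniteMeasure μ]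
    [NormedAddCommGroup E] {f : α → E} (hf : AEStronglyMeasurable f μ)
    (hi : Integrable (fun x => φ ‖f x‖) μ) : Integrable (fun x => shift φ a ‖f x‖) μ := by
  have h1 := hφ.isModular_shift hd ha
  have h2 := hφ.isModular hd
  refine ((hi.const_mul (2 ^ (q + 1))).add (integrable_const (2 ^ (q + 1) * φ a))).mono'
    (h1.continuous_norm.comp_aestronglyMeasurable hf) (Eventually.of_forall fun x => ?_)
  rw [Real.norm_of_nonneg (h1.nonneg (norm_nonneg _))]
  refine (hφ.shift_le ha (norm_nonneg _)).trans ((h2.map_add_le ha.le (norm_nonneg _)).trans_eq ?_)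
  simp only [Pi.add_apply]
  ring

theorem integral_add_indicator_ball {u v : Vec n → ℝ} (hs : s ≤ 1)
    (hu : IntegrableOn u (Metric.ball 0 1)) (hv : IntegrableOn v (Metric.ball 0 s)) :
    IntegrableOn (fun x => u x + (Metric.ball 0 s).indicator v x) (Metric.ball 0 1) ∧
      ∫ x in Metric.ball 0 1, (u x + (Metric.ball 0 s).indicator v x) =
        (∫ x in Metric.ball 0 1, u x) + ∫ x in Metric.ball 0 s, v x := by
  have hi : IntegrableOn ((Metric.ball 0 s).indicator v) (Metric.ball 0 1) :=
    (hv.integrable_indicator Metric.isOpen_ball.measurableSet).integrableOn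
  refine ⟨hu.add hi, ?_⟩
  rw [integral_add hu hi, setIntegral_indicator Metric.isOpen_ball.measurableSet,
    inter_eq_self_of_subset_right (Metric.ball_subset_ball hs)]

/-- If `Φ = (v - T w) 1_{B_s}` has gradient `(G - B) 1_{B_s}`, then quasiconvexity at `z`, tested
with `Φ`, and minimality, tested with `-Φ`, control the energy of `G` on the ball where `B`
vanishes by the energy in the remaining annulus. -/
theorem energy_le_of_comparison (hφ : IsRegularYoung φ) (hd : DerivComparable p q φ) (ha : 0 < a)
    {f : Mat N n → ℝ} (hf : Continuous f) (hf0 : ∀ y, 0 ≤ f y) {z : Mat N n}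
    (hmix : ∀ A B, |f (z + A - B) - f z - f (z + A) + f (z + B)| ≤
      C₀ * (shift φ a ‖A‖ + shift φ a ‖B‖ + shift φ a ‖B‖ ^ β))
    (htay : ∀ B, |f (z + B) - f z - fderiv ℝ f z B| ≤ C₀ * (shift φ a ‖B‖ + shift φ a ‖B‖ ^ β))
    (hγ : 0 ≤ γ) (hqc : StrictQuasiconvexAt φ γ f z)
    {G B : Vec n → Mat N n} (hG : StronglyMeasurable G) (hB : StronglyMeasurable B)
    (hfG : IntegrableOn (fun x => f (z + G x)) (Metric.ball 0 1))
    (hmin : ∀ (F : Vec n → Vec N) (DF : Vec n → Mat N n), IsInnerVariation φ 0 1 F DF →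
      IntegrableOn (fun x => f (z + G x + DF x)) (Metric.ball 0 1) →
        ∫ x in Metric.ball 0 1, f (z + G x) ≤ ∫ x in Metric.ball 0 1, f (z + G x + DF x))
    {F : Vec n → Vec N} (hs : s ≤ 1) (hrs : r ≤ s)
    (hF : IsInnerVariation φ 0 1 F ((Metric.ball 0 s).indicator fun x => G x - B x))
    (iG : IntegrableOn (fun x => shift φ a ‖G x‖) (Metric.ball 0 1))
    (iB : IntegrableOn (fun x => shift φ a ‖B x‖) (Metric.ball 0 s))
    (iBβ : IntegrableOn (fun x => shift φ a ‖B x‖ ^ β) (Metric.ball 0 s))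
    (hB0 : ∀ x ∈ Metric.ball (0 : Vec n) r, B x = 0) :
    γ * ∫ x in Metric.ball 0 r, shift φ (1 + ‖z‖) ‖G x‖ ≤
      C₀ * ∫ x in Metric.ball 0 s \ Metric.ball 0 r,
        (shift φ a ‖G x‖ + shift φ a ‖B x‖ + shift φ a ‖B x‖ ^ β) := by
  set B₁ : Set (Vec n) := Metric.ball 0 1
  set Bs : Set (Vec n) := Metric.ball 0 s
  set Br : Set (Vec n) := Metric.ball 0 r
  have hBr : MeasurableSet Br := Metric.isOpen_ball.measurableSet
  have hsub : Bs ⊆ B₁ := Metric.ball_subset_ball hs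
  have hrsub : Br ⊆ Bs := Metric.ball_subset_ball hrs
  have fin1 : IsFiniteMeasure (volume.restrict B₁) :=
    isFiniteMeasure_restrict.2 measure_ball_lt_top.ne
  have fins : IsFiniteMeasure (volume.restrict Bs) :=
    isFiniteMeasure_restrict.2 measure_ball_lt_top.ne
  have hmod := hφ.isModular_shift hd ha
  have hz1 : 0 < 1 + ‖z‖ := by positivity
  have hmod1 := hφ.isModular_shift hd hz1
  set D : Vec n → ℝ := fun x => shift φ a ‖G x‖ + shift φ a ‖B x‖ + shift φ a ‖B x‖ ^ β
  have iD : IntegrableOn D Bs := ((iG.mono_set hsub).add iB).add iBβ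
  have iB1 : IntegrableOn B Bs := hmod.integrable_of_integrable_comp hB.aestronglyMeasurable iB
  have mf : ∀ {A : Vec n → Mat N n}, StronglyMeasurable A →
      AEStronglyMeasurable (fun x => f (A x)) (volume.restrict Bs) := fun hA =>
    (hf.comp_stronglyMeasurable hA).aestronglyMeasurable
  -- the energy densities of the competitors are integrable
  have i2 : IntegrableOn (fun x => f (z + B x)) Bs := by
    refine ((integrable_const (f z)).add ((iB1.norm.const_mul ‖fderiv ℝ f z‖).add
      ((iB.add iBβ).const_mul C₀))).mono' (mf (stronglyMeasurable_const.add hB))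
      (Eventually.of_forall fun x => ?_)
    rw [Real.norm_of_nonneg (hf0 _)]
    have h1 := (le_abs_self _).trans (htay (B x))
    have h2 := (le_abs_self _).trans (ContinuousLinearMap.le_opNorm (fderiv ℝ f z) (B x))
    simp only [Pi.add_apply]
    linarith
  have i3 : IntegrableOn (fun x => f (z + G x - B x)) Bs := by
    refine ((integrable_const (f z)).add ((hfG.mono_set hsub).add (iD.const_mul C₀))).mono'
      (mf ((stronglyMeasurable_const.add hG).sub hB)) (Eventually.of_forall fun x => ?_)
    rw [Real.norm_of_nonneg (hf0 _)]
    have h1 := (le_abs_self _).trans (hmix (G x) (B x))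
    have h2 := hf0 (z + B x)
    simp only [Pi.add_apply, D]
    linarith
  have cz : IntegrableOn (fun _ => f z) Bs := integrable_const _
  -- quasiconvexity
  have e1 : ∀ x, f (z + Bs.indicator (fun x => G x - B x) x) =
      f z + Bs.indicator (fun x => f (z + G x - B x) - f z) x := fun x => by
    by_cases hx : x ∈ Bs
    · simp only [indicator_of_mem hx, ← add_sub_assoc]
      ring
    · simp [indicator_of_notMem hx]
  obtain ⟨j1, k1⟩ := integral_add_indicator_ball hs (integrable_const (f z)) (i3.sub cz)
  have q1 := hqc F _ (hF.memWZero (hφ.isModular hd)) (by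
    simp only [e1]
    exact j1)
  have hv : 0 < volume.real B₁ :=
    ENNReal.toReal_pos (Metric.measure_ball_pos _ _ one_pos).ne' measure_ball_lt_top.ne
  simp only [e1, setAverage_eq, smul_eq_mul] at q1
  have q2 : γ * ∫ x in B₁, shift φ (1 + ‖z‖) ‖Bs.indicator (fun x => G x - B x) x‖ ≤
      ∫ x in Bs, (f (z + G x - B x) - f z) := by
    have k1' : ∫ x in B₁, (f z + Bs.indicator (fun x => f (z + G x - B x) - f z) x) =
        volume.real B₁ * f z + ∫ x in Bs, (f (z + G x - B x) - f z) := by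
      refine k1.trans ?_
      simp [B₁, Bs]
    rw [k1'] at q1
    have := mul_le_mul_of_nonneg_left q1 hv.le
    rw [mul_inv_cancel_left₀ hv.ne', mul_add, mul_left_comm _ γ, mul_inv_cancel_left₀ hv.ne'] at this
    linarith
  -- minimality
  have e2 : ∀ x, f (z + G x + -Bs.indicator (fun x => G x - B x) x) =
      f (z + G x) + Bs.indicator (fun x => f (z + B x) - f (z + G x)) x := fun x => by
    by_cases hx : x ∈ Bs
    · simp only [indicator_of_mem hx]
      rw [show z + G x + -(G x - B x) = z + B x by abel]
      ring
    · simp [indicator_of_notMem hx]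
  obtain ⟨j2, k2⟩ := integral_add_indicator_ball hs hfG (i2.sub (hfG.mono_set hsub))
  have m1 := hmin _ _ hF.neg (by
    simp only [e2]
    exact j2)
  simp only [e2] at m1
  have m2 : 0 ≤ ∫ x in Bs, (f (z + B x) - f (z + G x)) := by
    have := m1.trans_eq k2
    simp only [Pi.sub_apply] at this
    linarith
  -- the two inequalities together
  have t1 : γ * ∫ x in B₁, shift φ (1 + ‖z‖) ‖Bs.indicator (fun x => G x - B x) x‖ ≤
      ∫ x in Bs, (f (z + G x - B x) - f z - f (z + G x) + f (z + B x)) := by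
    refine (q2.trans (le_add_of_nonneg_right m2)).trans_eq ?_
    rw [← integral_add (f := fun x => f (z + G x - B x) - f z)
      (g := fun x => f (z + B x) - f (z + G x)) (i3.sub cz) (i2.sub (hfG.mono_set hsub))]
    congr 1 with x
    ring
  have t2 : ∫ x in Bs, (f (z + G x - B x) - f z - f (z + G x) + f (z + B x)) ≤
      ∫ x in Bs, (Bs \ Br).indicator (fun x => C₀ * D x) x := by
    refine setIntegral_mono_on (((i3.sub cz).sub (hfG.mono_set hsub)).add i2)
      ((iD.const_mul C₀).indicator (Metric.isOpen_ball.measurableSet.diff hBr))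
      Metric.isOpen_ball.measurableSet fun x hx => ?_
    by_cases hxr : x ∈ Br
    · rw [indicator_of_notMem (fun h => h.2 hxr), hB0 x hxr]
      simp
    · rw [indicator_of_mem (show x ∈ Bs \ Br from ⟨hx, hxr⟩)]
      exact (le_abs_self _).trans (hmix (G x) (B x))
  rw [setIntegral_indicator (Metric.isOpen_ball.measurableSet.diff hBr),
    inter_eq_self_of_subset_right sdiff_subset, integral_const_mul] at t2
  refine le_trans ?_ (t1.trans t2)
  refine mul_le_mul_of_nonneg_left ?_ hγ
  have e3 : ∫ x in Br, shift φ (1 + ‖z‖) ‖G x‖ =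
      ∫ x in Br, shift φ (1 + ‖z‖) ‖Bs.indicator (fun x => G x - B x) x‖ := by
    refine setIntegral_congr_fun hBr fun x hx => ?_
    simp only [indicator_of_mem (hrsub hx), hB0 x hx, sub_zero]
  rw [e3]
  refine setIntegral_mono_set ?_ (Eventually.of_forall fun x => hmod1.nonneg (norm_nonneg _))
    (hrsub.trans hsub).eventuallyLE
  exact hφ.integrable_shift hd hz1 hF.integrable_grad.1.restrict
    hF.integrable_modular_grad.integrableOn

end EnergyComparison

/-! ### Estimates in an annulus -/

section AnnulusEstimate

variable {n N : ℕ} {m β : ℝ}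

theorem cutoffGrad_eq_zero {η : Vec n → ℝ} {b : ℝ} (hη : ∀ x, ‖x‖ ≤ b → η x = 1)
    (v : Vec n → Vec N) (G : Vec n → Mat N n) {x : Vec n} (hx : ‖x‖ < b) :
    cutoffGrad η v G x = 0 := by
  have : η =ᶠ[𝓝 x] fun _ => 1 := by
    have ho : IsOpen {y : Vec n | ‖y‖ < b} := isOpen_lt continuous_norm continuous_const
    filter_upwards [ho.mem_nhds hx] with y hy using hη y (le_of_lt hy)
  have h0 : gradVec η x = 0 := by
    ext j
    simp [gradVec, this.fderiv_eq]
  ext ⟨i, j⟩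
  simp [cutoffGrad, h0, hη x hx.le, outer_apply]

theorem smoothingGrad_eq_zero {s b r : ℝ} {G : Vec n → Mat N n} (hG : ∀ x, ‖x‖ < b → G x = 0)
    (hr : 3 * r + s ≤ 4 * b) (hrs : r ≤ s) (hs : 0 < s) {x : Vec n} (hx : ‖x‖ < r) :
    smoothingGrad s G x = 0 := by
  refine integral_eq_zero_of_ae ?_
  filter_upwards [ae_ballProb_norm_le n] with y hy
  have h1 := add_avgRadius_smul_mem hs (hx.trans_le hrs) hy
  rw [hG _ (by linarith)]
  ext ⟨i, j⟩
  simp [twist]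

/-- In the annulus `r < |x| < s₀`, a radius and a cut-off function can be chosen such that the
modular of the gradient `B` of the smoothed map, and the `L^β` norm of this modular, are
controlled by the data in the annulus. -/
theorem exists_annulus_estimate (n N : ℕ) (hm : 0 ≤ m) (hβ1 : 1 ≤ β) (hβ2 : n * (1 - β⁻¹) < 1) :
    ∃ K : ℝ, 0 < K ∧ ∀ H : ℝ → ℝ, IsModular m H → ∀ r s₀ : ℝ, 1 / 2 ≤ r → r < s₀ → s₀ ≤ 1 →
      ∀ (v : Vec n → Vec N) (G : Vec n → Mat N n), StronglyMeasurable v → StronglyMeasurable G →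
      ∀ A V : ℝ, 0 ≤ A → 0 ≤ V →
      ∫⁻ x in Metric.ball 0 s₀ \ Metric.ball 0 r, ENNReal.ofReal (H ‖G x‖) ≤ ENNReal.ofReal A →
      ∫⁻ x in Metric.ball 0 1, ENNReal.ofReal (H ‖v x‖) ≤ ENNReal.ofReal V →
      ∃ (s : ℝ) (η : Vec n → ℝ) (b C : ℝ), s ∈ Ioo r s₀ ∧ ContDiff ℝ 1 η ∧
        (∀ x, 0 ≤ η x ∧ η x ≤ 1) ∧ (∀ x, ‖gradVec η x‖ ≤ C) ∧ b < s ∧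
        (∀ x, b ≤ ‖x‖ → η x = 0) ∧
        (∀ x ∈ Metric.ball (0 : Vec n) r, smoothingGrad s (cutoffGrad η v G) x = 0) ∧
        ∫⁻ x in Metric.ball 0 s, ENNReal.ofReal (H ‖smoothingGrad s (cutoffGrad η v G) x‖) ≤
          ENNReal.ofReal (K * (A + (s₀ - r) ^ (-m) * V)) ∧
        ∫⁻ x in Metric.ball 0 s, ENNReal.ofReal (H ‖smoothingGrad s (cutoffGrad η v G) x‖) ^ β ≤
          ENNReal.ofReal (K * ((s₀ - r)⁻¹ * (A + (s₀ - r) ^ (-m) * V)) ^ β) := by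
  set α : ℝ := n * (1 - β⁻¹)
  have hα : 0 < 1 - α := by linarith
  have hβ0 : 0 ≤ β := by linarith
  obtain ⟨C, hC, hcut⟩ := exists_cutoff n
  obtain ⟨C₁, hC₁, h1⟩ := exists_lintegral_ballAvg_le' n
  obtain ⟨C₂, hC₂, h2⟩ := exists_lintegral_ballAvg_rpow_le n hβ1
  set K₁ : ℝ := 2 ^ m * (8 * C + 1) ^ m with hK₁
  have hK₁0 : 0 < K₁ := by positivity
  set k₁ : ℝ := 2 ^ m * (C₁.toReal * K₁)
  set k₂ : ℝ := (2 ^ m) ^ β * (C₂.toReal * (2 / (1 - α) * K₁) ^ β)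
  have hk₁ : 0 ≤ k₁ := by positivity
  have hk₂ : 0 ≤ k₂ := by positivity
  refine ⟨k₁ + k₂ + 1, by positivity, fun H hH r s₀ hr hrs hs₀ v G hv hG A V hA hV iA iV => ?_⟩
  set d := s₀ - r with hd
  have hd0 : 0 < d := by linarith
  have hd1 : d ≤ 1 := by linarith
  set E := A + d ^ (-m) * V with hE
  have hE0 : 0 ≤ E := by positivity
  obtain ⟨η, hη, hη01, hη1, hη0, hηg⟩ := hcut ((3 * r + s₀) / 4) ((5 * r + 3 * s₀) / 8)
    (by linarith) (by linarith)
  have hη' : ContDiff ℝ 1 η := hη.of_le (by simp)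
  set g : Vec n → ENNReal := fun x => ENNReal.ofReal (H ‖cutoffGrad η v G x‖)
  have hgm := stronglyMeasurable_cutoffGrad hη' hv hG
  have hg : Measurable g := hH.measurable_ofReal hgm
  obtain ⟨s, hs, hgood⟩ := exists_good_radius (a := (r + s₀) / 2) (b := s₀)
    (show α < 1 from hβ2) (by linarith) hs₀ hg
  have hs0 : 0 < s := by linarith [hs.1]
  have hdiff : (5 * r + 3 * s₀) / 8 - (3 * r + s₀) / 4 = d / 8 := by rw [hd]; ring
  rw [hdiff] at hηg
  have hzero : ∀ x : Vec n, ‖x‖ < (3 * r + s₀) / 4 → cutoffGrad η v G x = 0 := fun x hx =>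
    cutoffGrad_eq_zero hη1 v G hx
  -- the modular of the cut-off gradient
  have hgint : ∫⁻ x in Metric.ball 0 s₀, g x ≤ ENNReal.ofReal (K₁ * E) := by
    have hpt : ∀ x, g x ≤ ENNReal.ofReal (2 ^ m) *
        ((Metric.ball 0 r)ᶜ.indicator (fun x => ENNReal.ofReal (H ‖G x‖)) x +
          ENNReal.ofReal ((8 * C + 1) ^ m * d ^ (-m)) * ENNReal.ofReal (H ‖v x‖)) := by
      intro x
      by_cases hx : x ∈ Metric.ball (0 : Vec n) r
      · have : g x = 0 := by
          simp only [g]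
          rw [hzero x ((mem_ball_zero_iff.1 hx).trans (by linarith)), norm_zero, hH.map_zero,
            ENNReal.ofReal_zero]
        rw [this]
        exact zero_le
      · rw [indicator_of_mem (show x ∈ (Metric.ball (0 : Vec n) r)ᶜ from hx)]
        have n1 := hH.nonneg (norm_nonneg (G x))
        have n2 := hH.nonneg (norm_nonneg (v x))
        rw [← ENNReal.ofReal_mul (by positivity), ← ENNReal.ofReal_add n1 (by positivity),
          ← ENNReal.ofReal_mul (by positivity)]
        have hCd : 0 ≤ C / (d / 8) := by positivity
        refine ENNReal.ofReal_le_ofReal ((hH.monotoneOn (norm_nonneg _)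
          (show 0 ≤ ‖G x‖ + C / (d / 8) * ‖v x‖ by positivity)
          (norm_cutoffGrad_le (hη01 x) (hηg x))).trans
          ((hH.map_add_le (norm_nonneg _) (by positivity)).trans ?_))
        gcongr
        refine (hH.map_mul_le_max (norm_nonneg _) hCd).trans ?_
        gcongr
        have hmax : max (C / (d / 8)) 1 ≤ (8 * C + 1) * d⁻¹ := by
          have : 1 ≤ d⁻¹ := (one_le_inv₀ hd0).2 hd1
          refine max_le ?_ ?_
          · have e : C / (d / 8) = 8 * C * d⁻¹ := by field_simp
            rw [e]
            gcongr
            linarith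
          · nlinarith
        refine (Real.rpow_le_rpow (by positivity) hmax hm).trans_eq ?_
        rw [Real.mul_rpow (by positivity) (by positivity), Real.inv_rpow hd0.le,
          Real.rpow_neg hd0.le]
    have hind : ∫⁻ x in Metric.ball 0 s₀,
        (Metric.ball 0 r)ᶜ.indicator (fun x => ENNReal.ofReal (H ‖G x‖)) x ≤ ENNReal.ofReal A := by
      rw [setLIntegral_indicator Metric.isOpen_ball.measurableSet.compl, inter_comm, ← sdiff_eq]
      exact iA
    have hVs : ∫⁻ x in Metric.ball 0 s₀, ENNReal.ofReal (H ‖v x‖) ≤ ENNReal.ofReal V :=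
      (lintegral_mono_set (Metric.ball_subset_ball hs₀)).trans iV
    refine (lintegral_mono hpt).trans ?_
    rw [lintegral_const_mul' _ _ ENNReal.ofReal_ne_top, lintegral_add_left
      ((hH.measurable_ofReal hG).indicator Metric.isOpen_ball.measurableSet.compl),
      lintegral_const_mul' _ _ ENNReal.ofReal_ne_top]
    calc _ ≤ ENNReal.ofReal (2 ^ m) * (ENNReal.ofReal A +
          ENNReal.ofReal ((8 * C + 1) ^ m * d ^ (-m)) * ENNReal.ofReal V) := by gcongr
      _ = ENNReal.ofReal (2 ^ m * (A + (8 * C + 1) ^ m * d ^ (-m) * V)) := by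
        rw [← ENNReal.ofReal_mul (by positivity), ← ENNReal.ofReal_add hA (by positivity),
          ← ENNReal.ofReal_mul (by positivity)]
      _ ≤ _ := by
        refine ENNReal.ofReal_le_ofReal ?_
        rw [hK₁, hE, mul_assoc (2 ^ m : ℝ)]
        refine mul_le_mul_of_nonneg_left ?_ (show (0 : ℝ) ≤ 2 ^ m by positivity)
        have : 1 ≤ (8 * C + 1) ^ m := Real.one_le_rpow (by linarith) hm
        rw [mul_add, mul_assoc]
        gcongr
        exact le_mul_of_one_le_left hA this
  set B := smoothingGrad s (cutoffGrad η v G)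
  have hBle : ∀ x ∈ Metric.ball (0 : Vec n) s,
      ENNReal.ofReal (H ‖B x‖) ≤ ENNReal.ofReal (2 ^ m) * ballAvg s g x := fun x hx =>
    hH.ofReal_smoothingGrad_le hgm hs0 (mem_ball_zero_iff.1 hx)
  refine ⟨s, η, (5 * r + 3 * s₀) / 8, C / (d / 8), ⟨by linarith [hs.1], hs.2⟩, hη', hη01, hηg,
    by linarith [hs.1], hη0, fun x hx => ?_, ?_, ?_⟩
  · exact smoothingGrad_eq_zero hzero (by linarith [hs.2]) (by linarith [hs.1]) hs0
      (mem_ball_zero_iff.1 hx)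
  · have e1 : ENNReal.ofReal (2 ^ m) * (C₁ * ENNReal.ofReal (K₁ * E)) = ENNReal.ofReal (k₁ * E) := by
      rw [← ENNReal.ofReal_toReal hC₁, ← ENNReal.ofReal_mul (by positivity),
        ← ENNReal.ofReal_mul (by positivity)]
      congr 1
      simp only [k₁]
      ring
    calc ∫⁻ x in Metric.ball 0 s, ENNReal.ofReal (H ‖B x‖)
        ≤ ∫⁻ x in Metric.ball 0 s, ENNReal.ofReal (2 ^ m) * ballAvg s g x :=
          setLIntegral_mono' Metric.isOpen_ball.measurableSet hBle
      _ = ENNReal.ofReal (2 ^ m) * ∫⁻ x in Metric.ball 0 s, ballAvg s g x :=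
          lintegral_const_mul' _ _ ENNReal.ofReal_ne_top
      _ ≤ ENNReal.ofReal (2 ^ m) * (C₁ * ∫⁻ x in Metric.ball 0 s₀, g x) := by
          gcongr
          exact (h1 s g hs0 hg).trans
            (mul_le_mul_right (lintegral_mono_set (Metric.ball_subset_ball hs.2.le)) _)
      _ ≤ ENNReal.ofReal (2 ^ m) * (C₁ * ENNReal.ofReal (K₁ * E)) := by gcongr
      _ = ENNReal.ofReal (k₁ * E) := e1
      _ ≤ _ := ENNReal.ofReal_le_ofReal (mul_le_mul_of_nonneg_right (by linarith) hE0)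
  · have hw : ∫⁻ x in Metric.ball 0 s, ENNReal.ofReal ((s - ‖x‖) ^ (-α)) * g x ≤
        ENNReal.ofReal (2 / (1 - α) * K₁ * (d⁻¹ * E)) := by
      refine hgood.trans ((mul_le_mul_right hgint _).trans_eq ?_)
      rw [← ENNReal.ofReal_mul (by
        have : 0 < s₀ - (r + s₀) / 2 := by linarith
        positivity)]
      congr 1
      have : s₀ - (r + s₀) / 2 = d / 2 := by rw [hd]; ring
      rw [this]
      field_simp
    have e1 : ENNReal.ofReal (2 ^ m) ^ β *
        (C₂ * ENNReal.ofReal (2 / (1 - α) * K₁ * (d⁻¹ * E)) ^ β) =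
          ENNReal.ofReal (k₂ * (d⁻¹ * E) ^ β) := by
      rw [← ENNReal.ofReal_toReal hC₂, ENNReal.ofReal_rpow_of_nonneg (by positivity) hβ0,
        ENNReal.ofReal_rpow_of_nonneg (by positivity) hβ0, ← ENNReal.ofReal_mul (by positivity),
        ← ENNReal.ofReal_mul (by positivity), Real.mul_rpow (by positivity) (by positivity)]
      congr 1
      simp only [k₂]
      ring
    calc ∫⁻ x in Metric.ball 0 s, ENNReal.ofReal (H ‖B x‖) ^ β
        ≤ ∫⁻ x in Metric.ball 0 s, ENNReal.ofReal (2 ^ m) ^ β * ballAvg s g x ^ β :=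
          setLIntegral_mono' Metric.isOpen_ball.measurableSet fun x hx => by
            rw [← ENNReal.mul_rpow_of_nonneg _ _ hβ0]
            exact ENNReal.rpow_le_rpow (hBle x hx) hβ0
      _ = ENNReal.ofReal (2 ^ m) ^ β * ∫⁻ x in Metric.ball 0 s, ballAvg s g x ^ β :=
          lintegral_const_mul' _ _ (ENNReal.rpow_ne_top_of_nonneg hβ0 ENNReal.ofReal_ne_top)
      _ ≤ ENNReal.ofReal (2 ^ m) ^ β *
          (C₂ * ENNReal.ofReal (2 / (1 - α) * K₁ * (d⁻¹ * E)) ^ β) := by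
          gcongr
          refine (h2 s g hs0 hg).trans ?_
          gcongr
      _ = ENNReal.ofReal (k₂ * (d⁻¹ * E) ^ β) := e1
      _ ≤ _ := ENNReal.ofReal_le_ofReal
          (mul_le_mul_of_nonneg_right (by linarith) (by positivity))

end AnnulusEstimate

/-! ### The inequality on the unit ball -/

section UnitBall

variable {n N : ℕ} {M Γ₂ p q a β γ : ℝ} {φ ψ : ℝ → ℝ}

/-- The iteration that absorbs the term `θ F(s)`: the supremum of `(1 - r)^k F(r)` is estimated by
comparing `r` with the radius `s` for which `1 - s = l (1 - r)`, where `θ l^(-k) < 1`. -/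
theorem exists_iteration {θ k : ℝ} (hθ : 0 ≤ θ) (hθ1 : θ < 1) (hk : 0 ≤ k) :
    ∃ C, 0 < C ∧ ∀ (F : ℝ → ℝ) (P X : ℝ), (∀ r, 1 / 2 ≤ r → r < 1 → 0 ≤ F r ∧ F r ≤ X) →
      (∀ r s, 1 / 2 ≤ r → r < s → s < 1 → F r ≤ θ * F s + P * (s - r) ^ (-k)) →
      F (1 / 2) ≤ C * P := by
  set τ : ℝ := (1 + θ) / 2
  have hτ : 0 < τ := by positivity
  have hτ1 : τ < 1 := by simp only [τ]; linarith
  set l : ℝ := τ ^ (1 / (k + 1))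
  have hl : 0 < l := Real.rpow_pos_of_pos hτ _
  have hl1 : l < 1 := Real.rpow_lt_one hτ.le hτ1 (by positivity)
  set μ : ℝ := θ * τ⁻¹
  have hμ : μ < 1 := by
    simp only [μ]
    rw [← div_eq_mul_inv, div_lt_one hτ]
    simp only [τ]
    linarith
  have hlk : θ * l ^ (-k) ≤ μ := by
    refine mul_le_mul_of_nonneg_left ?_ hθ
    rw [← Real.rpow_neg_one, ← Real.rpow_mul hτ.le]
    refine Real.rpow_le_rpow_of_exponent_ge hτ hτ1.le ?_
    rw [mul_neg, neg_le_neg_iff, one_div, inv_mul_le_iff₀ (by positivity)]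
    linarith
  have hC : 0 < (1 - l) ^ (-k) / (1 - μ) :=
    div_pos (Real.rpow_pos_of_pos (by linarith) _) (by linarith)
  refine ⟨2 ^ k * ((1 - l) ^ (-k) / (1 - μ)), by positivity, fun F P X hF hstep => ?_⟩
  set g : ℝ → ℝ := fun r => (1 - r) ^ k * F r
  have hbdd : BddAbove (g '' Ico (1 / 2) 1) := by
    refine ⟨X, ?_⟩
    rintro _ ⟨r, hr, rfl⟩
    obtain ⟨h0, h1⟩ := hF r hr.1 hr.2
    exact (mul_le_of_le_one_left h0 (Real.rpow_le_one (by linarith [hr.2]) (by linarith [hr.1])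
      hk)).trans h1
  have hmem : (1 / 2 : ℝ) ∈ Ico (1 / 2 : ℝ) 1 := ⟨le_rfl, by norm_num⟩
  set S := sSup (g '' Ico (1 / 2) 1)
  have hle : ∀ r ∈ Ico (1 / 2 : ℝ) 1, g r ≤ S := fun r hr => le_csSup hbdd (mem_image_of_mem g hr)
  have hS0 : 0 ≤ S := le_trans (mul_nonneg (by positivity) (hF _ hmem.1 hmem.2).1) (hle _ hmem)
  have hS : S ≤ μ * S + (1 - l) ^ (-k) * P := by
    refine csSup_le ⟨_, mem_image_of_mem g hmem⟩ ?_
    rintro _ ⟨r, hr, rfl⟩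
    have hr1 : 0 < 1 - r := by linarith [hr.2]
    set s := 1 - l * (1 - r) with hs
    have hlr : l * (1 - r) < 1 - r := mul_lt_of_lt_one_left hr1 hl1
    have hs1 : s < 1 := by
      have := mul_pos hl hr1
      linarith
    have hsr : s - r = (1 - l) * (1 - r) := by rw [hs]; ring
    have h1 := hstep r s hr.1 (by linarith) hs1
    rw [hsr, Real.mul_rpow (by linarith) hr1.le] at h1
    have h2 := hle s ⟨by linarith [hr.1], hs1⟩
    have h3 : (1 - r) ^ k * F s = l ^ (-k) * g s := by
      simp only [g]
      rw [show 1 - s = l * (1 - r) by rw [hs]; ring, Real.mul_rpow hl.le hr1.le, ← mul_assoc,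
        ← mul_assoc, ← Real.rpow_add hl, neg_add_cancel, Real.rpow_zero, one_mul]
    have h4 : (1 - r) ^ k * (1 - r) ^ (-k) = 1 := by
      rw [← Real.rpow_add hr1, add_neg_cancel, Real.rpow_zero]
    calc g r ≤ (1 - r) ^ k * (θ * F s + P * ((1 - l) ^ (-k) * (1 - r) ^ (-k))) :=
          mul_le_mul_of_nonneg_left h1 (by positivity)
      _ = θ * ((1 - r) ^ k * F s) + (1 - l) ^ (-k) * P * ((1 - r) ^ k * (1 - r) ^ (-k)) := by ring
      _ = θ * l ^ (-k) * g s + (1 - l) ^ (-k) * P := by rw [h3, h4]; ring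
      _ ≤ θ * l ^ (-k) * S + (1 - l) ^ (-k) * P := by gcongr
      _ ≤ _ := by gcongr
  have h5 : S ≤ (1 - l) ^ (-k) / (1 - μ) * P := by
    rw [div_mul_eq_mul_div, le_div_iff₀ (by linarith)]
    linarith
  have h6 := hle _ hmem
  have h7 : F (1 / 2) = 2 ^ k * g (1 / 2) := by
    simp only [g]
    rw [← mul_assoc, ← Real.mul_rpow (by norm_num) (by norm_num)]
    norm_num
  rw [h7, mul_assoc]
  exact mul_le_mul_of_nonneg_left (h6.trans h5) (by positivity)

theorem integral_le_of_lintegral_ofReal_le {α : Type*} [MeasurableSpace α] {μ : Measure α}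
    {f : α → ℝ} (hf : AEStronglyMeasurable f μ) (h0 : ∀ x, 0 ≤ f x) {c : ℝ} (hc : 0 ≤ c)
    (h : ∫⁻ x, ENNReal.ofReal (f x) ∂μ ≤ ENNReal.ofReal c) : Integrable f μ ∧ ∫ x, f x ∂μ ≤ c := by
  refine ⟨(lintegral_ofReal_ne_top_iff_integrable hf (Eventually.of_forall h0)).1
    (h.trans_lt ENNReal.ofReal_lt_top).ne, ?_⟩
  rw [integral_eq_lintegral_of_nonneg_ae (Eventually.of_forall h0) hf]
  exact ENNReal.toReal_le_of_le_ofReal hc h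

/-- The Caccioppoli inequality for a map `v` on the unit ball with gradient `G`, such that `z + G`
minimizes the energy among its inner variations. -/
theorem exists_caccioppoli_unit_ball (n N : ℕ) (hφ : IsRegularYoung φ) (hψ : IsRegularYoung ψ)
    (hdφ : DerivComparable p q φ) (hdψ : DerivComparable p q ψ)
    (hq : 0 < q) (hM : 0 < M) (hβ1 : 1 ≤ β) (hβ2 : n * (1 - β⁻¹) < 1)
    (hanis : AnisotropyRange φ ψ M β) (hγ : 0 < γ) (hΓ : 0 < Γ₂) (ha : M < a) :
    ∃ c, 0 < c ∧ ∀ f : Mat N n → ℝ, IsEllipticIntegrand ψ M Γ₂ f →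
      ∀ z, M < ‖z‖ → ‖z‖ ≤ a → StrictQuasiconvexAt φ γ f z →
      ∀ (v : Vec n → Vec N) (G : Vec n → Mat N n), StronglyMeasurable v → StronglyMeasurable G →
      IsWeakGrad (Metric.ball 0 1) v G →
      IntegrableOn (fun x => φ ‖v x‖) (Metric.ball 0 1) →
      IntegrableOn (fun x => φ ‖G x‖) (Metric.ball 0 1) →
      IntegrableOn (fun x => f (z + G x)) (Metric.ball 0 1) →
      (∀ (F : Vec n → Vec N) (DF : Vec n → Mat N n), IsInnerVariation φ 0 1 F DF →
        IntegrableOn (fun x => f (z + G x + DF x)) (Metric.ball 0 1) →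
          ∫ x in Metric.ball 0 1, f (z + G x) ≤ ∫ x in Metric.ball 0 1, f (z + G x + DF x)) →
      ∫ x in Metric.ball 0 (1 / 2), shift φ a ‖G x‖ ≤
        c * ((∫ x in Metric.ball 0 1, shift φ a ‖v x‖) +
          (∫ x in Metric.ball 0 1, (shift φ a ‖G x‖ + shift φ a ‖v x‖)) ^ β) := by
  have ha0 : 0 < a := hM.trans ha
  set m : ℝ := q + 2
  have hm : 0 ≤ m := by positivity
  have hβ0 : 0 < β := by linarith
  have hmod : IsModular m (shift φ a) := hφ.isModular_shift hdφ ha0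
  obtain ⟨C₀, hC₀, hmix⟩ := exists_mixed_difference_le n N hφ hψ hdφ hdψ hq hM hanis hΓ ha
  obtain ⟨K, hK, hann⟩ := exists_annulus_estimate n N hm hβ1 hβ2
  set κ : ℝ := ((1 + a) / M) ^ (q + 1)
  have hκ : 0 < κ := by positivity
  set c₂ : ℝ := κ / γ * C₀ * (1 + K)
  have hc₂ : 0 < c₂ := by positivity
  set θ : ℝ := c₂ / (1 + c₂)
  have hθ : 0 < θ := by positivity
  have hθ1 : θ < 1 := (div_lt_one (by positivity)).2 (by linarith)
  set k : ℝ := (m + 1) * β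
  have hmk : m ≤ k := by
    simp only [k]
    nlinarith
  obtain ⟨C, hC, hit⟩ := exists_iteration hθ.le hθ1 (hm.trans hmk)
  refine ⟨C * θ, by positivity,
    fun f hf z hz hza hqc v G hv hG hweak iv iG hfG hmin => ?_⟩
  obtain ⟨hmixz, htay⟩ := hmix f hf z hz hza
  have fin1 : IsFiniteMeasure (volume.restrict (Metric.ball (0 : Vec n) 1)) :=
    isFiniteMeasure_restrict.2 measure_ball_lt_top.ne
  have iHv : IntegrableOn (fun x => shift φ a ‖v x‖) (Metric.ball 0 1) :=
    hφ.integrable_shift hdφ ha0 hv.aestronglyMeasurable iv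
  have iHG : IntegrableOn (fun x => shift φ a ‖G x‖) (Metric.ball 0 1) :=
    hφ.integrable_shift hdφ ha0 hG.aestronglyMeasurable iG
  have hnG : ∀ x, 0 ≤ shift φ a ‖G x‖ := fun x => hmod.nonneg (norm_nonneg _)
  have hnv : ∀ x, 0 ≤ shift φ a ‖v x‖ := fun x => hmod.nonneg (norm_nonneg _)
  set V := ∫ x in Metric.ball 0 1, shift φ a ‖v x‖ with hVdef
  set X := ∫ x in Metric.ball 0 1, shift φ a ‖G x‖ with hXdef
  have hV : 0 ≤ V := integral_nonneg hnv
  have hX : 0 ≤ X := integral_nonneg hnG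
  have hXV : ∫ x in Metric.ball 0 1, (shift φ a ‖G x‖ + shift φ a ‖v x‖) = X + V :=
    integral_add iHG iHv
  rw [hXV]
  set Q : ℝ := V + (X + V) ^ β
  set F : ℝ → ℝ := fun r => ∫ x in Metric.ball 0 r, shift φ a ‖G x‖ with hFdef
  have hF0 : ∀ r, 0 ≤ F r := fun r => integral_nonneg hnG
  have hFX : ∀ r, r ≤ 1 → F r ≤ X := fun r hr =>
    setIntegral_mono_set iHG (Eventually.of_forall hnG) (Metric.ball_subset_ball hr).eventuallyLE
  refine (hit F (θ * Q) X (fun r _ hr => ⟨hF0 r, hFX r hr.le⟩) fun r s₀ hr hrs hs₀ => ?_).trans_eq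
    (by ring)
  set d := s₀ - r with hd
  have hd0 : 0 < d := by linarith
  have hd1 : d ≤ 1 := by linarith
  have hsubs : Metric.ball (0 : Vec n) s₀ ⊆ Metric.ball 0 1 := Metric.ball_subset_ball hs₀.le
  set A := F s₀ - F r with hA
  have hAint : ∫ x in Metric.ball 0 s₀ \ Metric.ball 0 r, shift φ a ‖G x‖ = A :=
    setIntegral_sdiff Metric.isOpen_ball.measurableSet (iHG.mono_set hsubs)
      (Metric.ball_subset_ball hrs.le)
  have hA0 : 0 ≤ A := hAint ▸ integral_nonneg hnG
  have hAX : A ≤ X := by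
    have := hFX s₀ hs₀.le
    have := hF0 r
    linarith
  obtain ⟨s, η, b, Cη, hs, hη, hη01, hηg, hbs, hηb, hB0, hB1, hB2⟩ := hann _ hmod r s₀ hr hrs
    hs₀.le v G hv hG A V hA0 hV
    (by
      rw [← hAint, ofReal_integral_eq_lintegral_ofReal
        (iHG.mono_set (sdiff_subset.trans hsubs)) (Eventually.of_forall hnG)])
    (by rw [hVdef, ofReal_integral_eq_lintegral_ofReal iHv (Eventually.of_forall hnv)])
  set B := smoothingGrad s (cutoffGrad η v G)
  have hs0 : 0 < s := by linarith [hs.1]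
  have hs1 : s < 1 := hs.2.trans hs₀
  have hBm : StronglyMeasurable B :=
    stronglyMeasurable_smoothingGrad (stronglyMeasurable_cutoffGrad hη hv hG)
  have hnB : ∀ x, 0 ≤ shift φ a ‖B x‖ := fun x => hmod.nonneg (norm_nonneg _)
  set E := A + d ^ (-m) * V with hE
  have hE0 : 0 ≤ E := by positivity
  have hmB : StronglyMeasurable fun x => shift φ a ‖B x‖ :=
    hmod.continuous_norm.comp_stronglyMeasurable hBm
  obtain ⟨iB, jB⟩ := integral_le_of_lintegral_ofReal_le
    hmB.aestronglyMeasurable hnB (by positivity) hB1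
  have hB2' : ∫⁻ x in Metric.ball 0 s, ENNReal.ofReal (shift φ a ‖B x‖ ^ β) ≤
      ENNReal.ofReal (K * (d⁻¹ * E) ^ β) := by
    refine le_trans (le_of_eq ?_) hB2
    congr 1 with x
    exact (ENNReal.ofReal_rpow_of_nonneg (hnB x) hβ0.le).symm
  obtain ⟨iBβ, jBβ⟩ := integral_le_of_lintegral_ofReal_le
    (hmB.measurable.pow_const β).aestronglyMeasurable
    (fun x => Real.rpow_nonneg (hnB x) _) (by positivity) hB2'
  have hcomp := isInnerVariation_comparison (hφ.isModular hdφ) hη hη01 hηg hbs hηb hs0 hs1 hv hG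
    hweak iv iG
  have hen := energy_le_of_comparison hφ hdφ ha0 hf.contDiff.continuous hf.nonneg hmixz htay hγ.le
    hqc hG hBm hfG hmin hs1.le hs.1.le hcomp iHG iB iBβ hB0
  -- the energy in the annulus
  have hsub' : Metric.ball (0 : Vec n) s \ Metric.ball 0 r ⊆
      Metric.ball 0 s₀ \ Metric.ball 0 r :=
    sdiff_subset_sdiff_left (Metric.ball_subset_ball hs.2.le)
  have hsd : Metric.ball (0 : Vec n) s \ Metric.ball 0 r ⊆ Metric.ball 0 s := sdiff_subset
  have hann2 : ∫ x in Metric.ball 0 s \ Metric.ball 0 r,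
      (shift φ a ‖G x‖ + shift φ a ‖B x‖ + shift φ a ‖B x‖ ^ β) ≤
        A + K * E + K * (d⁻¹ * E) ^ β := by
    have iG' : IntegrableOn (fun x => shift φ a ‖G x‖) (Metric.ball 0 s \ Metric.ball 0 r) :=
      iHG.mono_set (hsd.trans (Metric.ball_subset_ball hs1.le))
    have iB' : IntegrableOn (fun x => shift φ a ‖B x‖) (Metric.ball 0 s \ Metric.ball 0 r) :=
      IntegrableOn.mono_set iB hsd
    have iBβ' : IntegrableOn (fun x => shift φ a ‖B x‖ ^ β) (Metric.ball 0 s \ Metric.ball 0 r) :=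
      IntegrableOn.mono_set iBβ hsd
    rw [integral_add (f := fun x => shift φ a ‖G x‖ + shift φ a ‖B x‖) (iG'.add iB') iBβ',
      integral_add iG' iB']
    refine add_le_add (add_le_add ?_ ?_) ?_
    · rw [← hAint]
      exact setIntegral_mono_set (iHG.mono_set (sdiff_subset.trans hsubs))
        (Eventually.of_forall hnG) hsub'.eventuallyLE
    · exact (setIntegral_mono_set iB (Eventually.of_forall hnB) hsd.eventuallyLE).trans jB
    · exact (setIntegral_mono_set iBβ (Eventually.of_forall fun x => Real.rpow_nonneg (hnB x) _)
        hsd.eventuallyLE).trans jBβ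
  have hpow : d ^ (-m) ≤ d ^ (-k) :=
    Real.rpow_le_rpow_of_exponent_ge hd0 hd1 (neg_le_neg hmk)
  have hone : 1 ≤ d ^ (-m) := Real.one_le_rpow_of_pos_of_le_one_of_nonpos hd0 hd1 (by linarith)
  have hEβ : (d⁻¹ * E) ^ β ≤ d ^ (-k) * (X + V) ^ β := by
    have h1 : d⁻¹ * E ≤ d ^ (-(m + 1)) * (X + V) := by
      have e : d ^ (-(m + 1)) = d⁻¹ * d ^ (-m) := by
        rw [neg_add, Real.rpow_add hd0, Real.rpow_neg_one, mul_comm]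
      rw [e, mul_assoc]
      refine mul_le_mul_of_nonneg_left ?_ (by positivity)
      rw [hE, mul_add]
      have : X ≤ d ^ (-m) * X := le_mul_of_one_le_left hX hone
      linarith
    refine (Real.rpow_le_rpow (by positivity) h1 hβ0.le).trans_eq ?_
    rw [Real.mul_rpow (by positivity) (by positivity), ← Real.rpow_mul hd0.le]
    congr 2
    simp only [k]
    ring
  have hXVβ : 0 ≤ (X + V) ^ β := by positivity
  have hF1 : F r ≤ κ * ∫ x in Metric.ball 0 r, shift φ (1 + ‖z‖) ‖G x‖ := by
    have hz1 : 0 < 1 + ‖z‖ := by positivity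
    have hrs1 : Metric.ball (0 : Vec n) r ⊆ Metric.ball 0 1 :=
      Metric.ball_subset_ball (by linarith)
    rw [← integral_const_mul]
    refine setIntegral_mono_on (iHG.mono_set hrs1)
      (((hφ.integrable_shift hdφ hz1 hG.aestronglyMeasurable iG).const_mul κ).mono_measure
        (Measure.restrict_mono hrs1 le_rfl))
      Metric.isOpen_ball.measurableSet fun x _ => ?_
    exact hφ.shift_le_shift hdφ hM (by linarith) ha.le (by linarith) (by linarith) (norm_nonneg _)
  have hF2 : F r ≤ c₂ * A + c₂ * (d ^ (-k) * Q) := by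
    have h1 := hen.trans (mul_le_mul_of_nonneg_left hann2 hC₀.le)
    have h2 : κ * ∫ x in Metric.ball 0 r, shift φ (1 + ‖z‖) ‖G x‖ ≤
        κ / γ * (C₀ * (A + K * E + K * (d⁻¹ * E) ^ β)) := by
      rw [div_mul_eq_mul_div, mul_div_assoc]
      refine mul_le_mul_of_nonneg_left ?_ hκ.le
      rw [le_div_iff₀ hγ]
      linarith
    refine hF1.trans (h2.trans ?_)
    have h3 : A + K * E + K * (d⁻¹ * E) ^ β ≤ (1 + K) * A + (1 + K) * (d ^ (-k) * Q) := by
      have h4 : d ^ (-m) * V ≤ d ^ (-k) * V := mul_le_mul_of_nonneg_right hpow hV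
      have h5 := mul_le_mul_of_nonneg_left h4 hK.le
      have h6 := mul_le_mul_of_nonneg_left hEβ hK.le
      have h7 : 0 ≤ d ^ (-k) * Q := by positivity
      have h8 : d ^ (-k) * Q = d ^ (-k) * V + d ^ (-k) * (X + V) ^ β := by
        simp only [Q]
        ring
      rw [hE]
      rw [h8] at h7 ⊢
      linarith
    calc κ / γ * (C₀ * (A + K * E + K * (d⁻¹ * E) ^ β))
        ≤ κ / γ * (C₀ * ((1 + K) * A + (1 + K) * (d ^ (-k) * Q))) := by gcongr
      _ = _ := by simp only [c₂]; ring
  -- filling the hole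
  have hfill : (1 + c₂) * F r ≤ c₂ * F s₀ + c₂ * (d ^ (-k) * Q) := by
    rw [hA] at hF2
    linarith
  have : F r ≤ (c₂ * F s₀ + c₂ * (d ^ (-k) * Q)) / (1 + c₂) := by
    rw [le_div_iff₀ (by positivity)]
    linarith
  refine this.trans_eq ?_
  simp only [θ]
  ring

end UnitBall

/-! ### Averages and measurable representatives -/

section Scaling

variable {n N : ℕ} {M Γ₂ p q a β γ : ℝ} {φ ψ : ℝ → ℝ}

theorem IsWeakGrad.congr_ae {U : Set (Vec n)} {w w' : Vec n → Vec N} {Dw Dw' : Vec n → Mat N n}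
    (h : IsWeakGrad U w Dw) (hw : w =ᵐ[volume.restrict U] w')
    (hD : Dw =ᵐ[volume.restrict U] Dw') : IsWeakGrad U w' Dw' := by
  have key : ∀ {E : Type} [NormedAddCommGroup E] {g g' : Vec n → E},
      LocallyIntegrableOn g U → g =ᵐ[volume.restrict U] g' → LocallyIntegrableOn g' U := by
    intro E _ g g' hg he x hx
    obtain ⟨t, ht, hi⟩ := hg x hx
    refine ⟨t ∩ U, inter_mem ht self_mem_nhdsWithin, (hi.mono_set inter_subset_left).congr ?_⟩
    exact ae_restrict_of_ae_restrict_of_subset inter_subset_right he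
  refine ⟨key h.1 hw, key h.2.1 hD, fun η h1 h2 h3 i j => ?_⟩
  have e1 : ∫ x in U, w' x i * fderiv ℝ η x (EuclideanSpace.single j 1) =
      ∫ x in U, w x i * fderiv ℝ η x (EuclideanSpace.single j 1) :=
    integral_congr_ae (hw.mono fun x hx => by simp only [hx])
  have e2 : ∫ x in U, Dw' x (i, j) * η x = ∫ x in U, Dw x (i, j) * η x :=
    integral_congr_ae (hD.mono fun x hx => by simp only [hx])
  rw [e1, e2]
  exact h.2.2 η h1 h2 h3 i j

/-- The inequality on the unit ball for averages, with the shift `|z|`, and for maps which are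
measurable up to null sets. -/
theorem exists_caccioppoli_average (n N : ℕ) (hφ : IsRegularYoung φ) (hψ : IsRegularYoung ψ)
    (hdφ : DerivComparable p q φ) (hdψ : DerivComparable p q ψ)
    (hq : 0 < q) (hM : 0 < M) (hβ1 : 1 ≤ β) (hβ2 : n * (1 - β⁻¹) < 1)
    (hanis : AnisotropyRange φ ψ M β) (hγ : 0 < γ) (hΓ : 0 < Γ₂) (ha : M < a) :
    ∃ c, 0 < c ∧ ∀ f : Mat N n → ℝ, IsEllipticIntegrand ψ M Γ₂ f →
      ∀ z, M < ‖z‖ → ‖z‖ ≤ a → StrictQuasiconvexAt φ γ f z →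
      ∀ (v : Vec n → Vec N) (G : Vec n → Mat N n), IsWeakGrad (Metric.ball 0 1) v G →
      IntegrableOn (fun x => φ ‖v x‖) (Metric.ball 0 1) →
      IntegrableOn (fun x => φ ‖G x‖) (Metric.ball 0 1) →
      IntegrableOn (fun x => f (z + G x)) (Metric.ball 0 1) →
      (∀ (F : Vec n → Vec N) (DF : Vec n → Mat N n), IsInnerVariation φ 0 1 F DF →
        IntegrableOn (fun x => f (z + G x + DF x)) (Metric.ball 0 1) →
          ∫ x in Metric.ball 0 1, f (z + G x) ≤ ∫ x in Metric.ball 0 1, f (z + G x + DF x)) →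
      IntegrableOn (fun x => shift φ ‖z‖ ‖G x‖) (Metric.ball 0 1) ∧
      IntegrableOn (fun x => shift φ ‖z‖ ‖v x‖) (Metric.ball 0 1) ∧
      ⨍ x in Metric.ball 0 (1 / 2), shift φ ‖z‖ ‖G x‖ ≤
        c * (⨍ x in Metric.ball 0 1, shift φ ‖z‖ ‖v x‖) +
          c * (⨍ x in Metric.ball 0 1, (shift φ ‖z‖ ‖G x‖ + shift φ ‖z‖ ‖v x‖)) ^ β := by
  obtain ⟨c, hc, hmain⟩ := exists_caccioppoli_unit_ball n N hφ hψ hdφ hdψ hq hM hβ1 hβ2 hanis hγ hΓ ha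
  have ha0 : 0 < a := hM.trans ha
  set κ : ℝ := (a / M) ^ (q + 1)
  have hκ : 0 < κ := by positivity
  set V₁ : ℝ := volume.real (Metric.ball (0 : Vec n) 1)
  set V₂ : ℝ := volume.real (Metric.ball (0 : Vec n) (1 / 2))
  have hV₁ : 0 < V₁ :=
    ENNReal.toReal_pos (Metric.measure_ball_pos _ _ one_pos).ne' measure_ball_lt_top.ne
  have hV₂ : 0 < V₂ :=
    ENNReal.toReal_pos (Metric.measure_ball_pos _ _ (by norm_num)).ne' measure_ball_lt_top.ne
  set c₁ : ℝ := V₂⁻¹ * κ * c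
  refine ⟨c₁ * (κ * V₁) + c₁ * (κ * V₁) ^ β, by positivity,
    fun f hf z hz hza hqc v₀ G₀ hweak iv₀ iG₀ hfG₀ hmin₀ => ?_⟩
  have hz0 : 0 < ‖z‖ := hM.trans hz
  have hβ0 : 0 < β := by linarith
  have fin1 : IsFiniteMeasure (volume.restrict (Metric.ball (0 : Vec n) 1)) :=
    isFiniteMeasure_restrict.2 measure_ball_lt_top.ne
  have av : AEStronglyMeasurable v₀ (volume.restrict (Metric.ball 0 1)) :=
    hweak.1.aestronglyMeasurable
  have aG : AEStronglyMeasurable G₀ (volume.restrict (Metric.ball 0 1)) :=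
    hweak.2.1.aestronglyMeasurable
  obtain ⟨v, hv, ev⟩ := av
  obtain ⟨G, hG, eG⟩ := aG
  have hhalf : Metric.ball (0 : Vec n) (1 / 2) ⊆ Metric.ball 0 1 :=
    Metric.ball_subset_ball (by norm_num)
  have iv : IntegrableOn (fun x => φ ‖v x‖) (Metric.ball 0 1) :=
    iv₀.congr (ev.mono fun x hx => by simp only [hx])
  have iG : IntegrableOn (fun x => φ ‖G x‖) (Metric.ball 0 1) :=
    iG₀.congr (eG.mono fun x hx => by simp only [hx])
  have key := hmain f hf z hz hza hqc v G hv hG (hweak.congr_ae ev eG) iv iG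
    (hfG₀.congr (eG.mono fun x hx => by simp only [hx])) (fun F DF hF hi => by
      have e : ∀ D : Vec n → Mat N n, (fun x => f (z + G₀ x + D x)) =ᵐ[volume.restrict
          (Metric.ball 0 1)] fun x => f (z + G x + D x) :=
        fun D => eG.mono fun x hx => by simp only [hx]
      have h0 := integral_congr_ae (e fun _ => 0)
      simp only [add_zero] at h0
      rw [← h0, ← integral_congr_ae (e DF)]
      exact hmin₀ F DF hF (hi.congr (e DF).symm))
  -- back to the shift `|z|`
  have iz : ∀ {E : Type} [NormedAddCommGroup E] {g : Vec n → E}, StronglyMeasurable g →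
      IntegrableOn (fun x => φ ‖g x‖) (Metric.ball 0 1) → ∀ b, 0 < b →
      IntegrableOn (fun x => shift φ b ‖g x‖) (Metric.ball 0 1) := fun hg hi b hb =>
    hφ.integrable_shift hdφ hb hg.aestronglyMeasurable hi
  have izG := iz hG iG _ hz0
  have izv := iz hv iv _ hz0
  have hza' : ∀ t, 0 ≤ t → shift φ ‖z‖ t ≤ κ * shift φ a t := fun t ht =>
    hφ.shift_le_shift hdφ hM ha.le hz.le le_rfl hza ht
  have haz : ∀ t, 0 ≤ t → shift φ a t ≤ κ * shift φ ‖z‖ t := fun t ht =>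
    hφ.shift_le_shift hdφ hM hz.le ha.le hza le_rfl ht
  have hnn : ∀ t, 0 ≤ t → 0 ≤ shift φ ‖z‖ t := fun t ht => (hφ.isModular_shift hdφ hz0).nonneg ht
  have hnna : ∀ t, 0 ≤ t → 0 ≤ shift φ a t := fun t ht => (hφ.isModular_shift hdφ ha0).nonneg ht
  have eGz : (fun x => shift φ ‖z‖ ‖G₀ x‖) =ᵐ[volume.restrict (Metric.ball 0 1)]
      fun x => shift φ ‖z‖ ‖G x‖ := eG.mono fun x hx => by simp only [hx]
  have evz : (fun x => shift φ ‖z‖ ‖v₀ x‖) =ᵐ[volume.restrict (Metric.ball 0 1)]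
      fun x => shift φ ‖z‖ ‖v x‖ := ev.mono fun x hx => by simp only [hx]
  refine ⟨izG.congr eGz.symm, izv.congr evz.symm, ?_⟩
  simp only [setAverage_eq, smul_eq_mul]
  rw [integral_congr_ae (ae_restrict_of_ae_restrict_of_subset hhalf eGz), integral_congr_ae evz]
  set I := ∫ x in Metric.ball 0 1, shift φ ‖z‖ ‖v x‖
  have hJ : ∫ x in Metric.ball 0 1, (shift φ ‖z‖ ‖G₀ x‖ + shift φ ‖z‖ ‖v₀ x‖) =
      ∫ x in Metric.ball 0 1, (shift φ ‖z‖ ‖G x‖ + shift φ ‖z‖ ‖v x‖) :=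
    integral_congr_ae (eGz.add evz)
  rw [hJ]
  set J := ∫ x in Metric.ball 0 1, (shift φ ‖z‖ ‖G x‖ + shift φ ‖z‖ ‖v x‖)
  have hI0 : 0 ≤ I := integral_nonneg fun x => hnn _ (norm_nonneg _)
  have hJ0 : 0 ≤ J := integral_nonneg fun x =>
    add_nonneg (hnn _ (norm_nonneg _)) (hnn _ (norm_nonneg _))
  have b1 : ∫ x in Metric.ball 0 (1 / 2), shift φ ‖z‖ ‖G x‖ ≤
      κ * ∫ x in Metric.ball 0 (1 / 2), shift φ a ‖G x‖ := by
    rw [← integral_const_mul]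
    exact integral_mono (IntegrableOn.mono_set izG hhalf)
      ((IntegrableOn.mono_set (iz hG iG a ha0) hhalf).const_mul κ) fun x => hza' _ (norm_nonneg _)
  have b2 : ∫ x in Metric.ball 0 1, shift φ a ‖v x‖ ≤ κ * I := by
    rw [← integral_const_mul]
    exact integral_mono (iz hv iv a ha0) (izv.const_mul κ) fun x => haz _ (norm_nonneg _)
  have b3 : ∫ x in Metric.ball 0 1, (shift φ a ‖G x‖ + shift φ a ‖v x‖) ≤ κ * J := by
    rw [← integral_const_mul]
    refine integral_mono ((iz hG iG a ha0).add (iz hv iv a ha0)) ((izG.add izv).const_mul κ)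
      fun x => ?_
    have h1 := haz _ (norm_nonneg (G x))
    have h2 := haz _ (norm_nonneg (v x))
    simp only
    linarith
  have b4 : (∫ x in Metric.ball 0 1, (shift φ a ‖G x‖ + shift φ a ‖v x‖)) ^ β ≤
      (κ * V₁) ^ β * (V₁⁻¹ * J) ^ β := by
    rw [← Real.mul_rpow (by positivity) (by positivity)]
    refine Real.rpow_le_rpow (integral_nonneg fun x =>
      add_nonneg (hnna _ (norm_nonneg _)) (hnna _ (norm_nonneg _))) (b3.trans_eq ?_) hβ0.le
    field_simp
  have b5 : κ * I = κ * V₁ * (V₁⁻¹ * I) := by field_simp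
  rw [b5] at b2
  set I' := V₁⁻¹ * I
  have hI' : 0 ≤ I' := by positivity
  set J' := (V₁⁻¹ * J) ^ β
  have hJ' : 0 ≤ J' := by positivity
  calc V₂⁻¹ * ∫ x in Metric.ball 0 (1 / 2), shift φ ‖z‖ ‖G x‖
      ≤ V₂⁻¹ * (κ * (c * (κ * V₁ * I' + (κ * V₁) ^ β * J'))) := by
        refine mul_le_mul_of_nonneg_left (b1.trans (mul_le_mul_of_nonneg_left (key.trans
          (mul_le_mul_of_nonneg_left (add_le_add b2 b4) hc.le)) hκ.le)) (by positivity)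
    _ = c₁ * (κ * V₁) * I' + c₁ * (κ * V₁) ^ β * J' := by
        simp only [c₁]
        ring
    _ ≤ _ := by
        have h1 : 0 ≤ c₁ * (κ * V₁) ^ β := by positivity
        have h2 : 0 ≤ c₁ * (κ * V₁) := by positivity
        gcongr <;> linarith

end Scaling

/-! ### Minimizers on arbitrary balls -/

section Minimizers

variable {n N : ℕ} {M Γ₁ Γ₂ p q a β γ : ℝ} {φ ψ : ℝ → ℝ}

theorem AffineMap.contDiff_of_vec (l : Vec n →ᵃ[ℝ] Vec N) {k : WithTop ℕ∞} : ContDiff ℝ k l := by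
  have e : ⇑l = fun x => LinearMap.toContinuousLinearMap l.linear x + l 0 := by
    ext1 x
    simpa using congrFun l.decomp x
  rw [e]
  exact (ContinuousLinearMap.contDiff _).add contDiff_const

/-- Rescaling `u - l` from `B_ρ(x₀)` to the unit ball. -/
theorem exists_caccioppoli_of_isMinimizer (n N : ℕ) (hφ : IsRegularYoung φ) (hψ : IsRegularYoung ψ)
    (hdφ : DerivComparable p q φ) (hdψ : DerivComparable p q ψ)
    (hq : 0 < q) (hM : 0 < M) (hβ1 : 1 ≤ β) (hβ2 : n * (1 - β⁻¹) < 1)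
    (hanis : AnisotropyRange φ ψ M β) (hγ : 0 < γ) (hΓ : 0 < Γ₂) (ha : M < a) :
    ∃ c, 0 < c ∧ ∀ f : Mat N n → ℝ, IsEllipticIntegrand ψ M Γ₂ f →
      ∀ (x₀ : Vec n) (ρ : ℝ), 0 < ρ → ∀ (u : Vec n → Vec N) (Du : Vec n → Mat N n),
      IsMinimizer φ f (Metric.ball x₀ ρ) u Du →
      ∀ z, M < ‖z‖ → ‖z‖ ≤ a → StrictQuasiconvexAt φ γ f z →
      ∀ l : Vec n →ᵃ[ℝ] Vec N, (∀ x, gradMat (⇑l) x = z) →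
        IntegrableOn (fun x => shift φ ‖z‖ ‖Du x - z‖) (Metric.ball x₀ ρ) ∧
        IntegrableOn (fun x => shift φ ‖z‖ (‖u x - l x‖ / ρ)) (Metric.ball x₀ ρ) ∧
        (⨍ x in Metric.ball x₀ (ρ / 2), shift φ ‖z‖ ‖Du x - z‖) ≤
          c * (⨍ x in Metric.ball x₀ ρ, shift φ ‖z‖ (‖u x - l x‖ / ρ)) +
          c * (⨍ x in Metric.ball x₀ ρ,
            (shift φ ‖z‖ ‖Du x - z‖ + shift φ ‖z‖ (‖u x - l x‖ / ρ))) ^ β := by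
  obtain ⟨c, hc, hmain⟩ := exists_caccioppoli_average n N hφ hψ hdφ hdψ hq hM hβ1 hβ2 hanis hγ hΓ ha
  refine ⟨c, hc, fun f hf x₀ ρ hρ u Du hu z hz hza hqc l hl => ?_⟩
  obtain ⟨⟨hweak, ⟨mu, iu⟩, ⟨mD, iD⟩⟩, hfin, hmin⟩ := hu
  set U : Set (Vec n) := Metric.ball x₀ ρ
  have hU : MeasurableSet U := Metric.isOpen_ball.measurableSet
  have finU : IsFiniteMeasure (volume.restrict U) :=
    isFiniteMeasure_restrict.2 measure_ball_lt_top.ne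
  have hmod := hφ.isModular hdφ
  have hpre : (fun x => x₀ + ρ • x) ⁻¹' U = Metric.ball 0 1 := by
    have := preimage_affine_ball x₀ hρ 1
    rwa [mul_one] at this
  have hpre' : (fun y => -(ρ⁻¹ • x₀) + ρ⁻¹ • y) ⁻¹' Metric.ball 0 1 = U := by
    rw [← hpre, ← preimage_comp]
    convert preimage_id
    ext1 y
    simp [smul_add, hρ.ne']
  have hls : ContDiff ℝ 1 l := l.contDiff_of_vec
  have il : IntegrableOn (fun x => φ ‖l x‖) U :=
    ((hmod.continuous_norm.comp hls.continuous).continuousOn.integrableOn_compact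
      (isCompact_closedBall x₀ ρ)).mono_set Metric.ball_subset_closedBall
  have hw : IsWeakGrad U (fun x => u x - l x) fun x => Du x - z := by
    have h := isWeakGrad_of_contDiff (U := U) hls
    rw [show gradMat (⇑l) = fun _ => z from funext hl] at h
    exact hweak.sub h
  have isub : ∀ {E : Type} [NormedAddCommGroup E] {g h : Vec n → E},
      AEStronglyMeasurable g (volume.restrict U) → AEStronglyMeasurable h (volume.restrict U) →
      IntegrableOn (fun x => φ ‖g x‖) U → IntegrableOn (fun x => φ ‖h x‖) U →
      IntegrableOn (fun x => φ ‖g x - h x‖) U := fun hg hh ig ih => by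
    refine ((ig.add ih).const_mul (2 ^ (q + 1))).mono'
      (hmod.continuous_norm.comp_aestronglyMeasurable (hg.sub hh)) (Eventually.of_forall fun x => ?_)
    rw [Real.norm_of_nonneg (hmod.nonneg (norm_nonneg _))]
    exact (hmod.monotoneOn (norm_nonneg _) (add_nonneg (norm_nonneg _) (norm_nonneg _))
      (norm_sub_le _ _)).trans (hmod.map_add_le (norm_nonneg _) (norm_nonneg _))
  have ml : AEStronglyMeasurable (⇑l) (volume.restrict U) := hls.continuous.aestronglyMeasurable
  have iw := isub mu ml iu il
  have iG := isub mD aestronglyMeasurable_const iD (integrable_const (φ ‖z‖))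
  have iw1 := hmod.integrable_of_integrable_comp (mu.sub ml) iw
  have iG1 := hmod.integrable_of_integrable_comp (mD.sub aestronglyMeasurable_const) iG
  set v : Vec n → Vec N := fun x => ρ⁻¹ • (u (x₀ + ρ • x) - l (x₀ + ρ • x))
  set G : Vec n → Mat N n := fun x => Du (x₀ + ρ • x) - z
  have hvn : ∀ x, ‖v x‖ = ‖u (x₀ + ρ • x) - l (x₀ + ρ • x)‖ / ρ := fun x => by
    simp only [v]
    rw [norm_smul, norm_inv, Real.norm_of_nonneg hρ.le, inv_mul_eq_div]
  have hvG : IsWeakGrad (Metric.ball 0 1) v G := by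
    have := hw.comp_affine hU iw1 iG1 x₀ hρ
    rwa [hpre] at this
  have comp1 : ∀ {g : Vec n → ℝ}, IntegrableOn g U →
      IntegrableOn (fun x => g (x₀ + ρ • x)) (Metric.ball 0 1) := fun hg => by
    have := integrableOn_comp_affine hU hg x₀ hρ.ne'
    rwa [hpre] at this
  have comp2 : ∀ {g : Vec n → ℝ}, IntegrableOn g (Metric.ball 0 1) →
      IntegrableOn (fun y => g (-(ρ⁻¹ • x₀) + ρ⁻¹ • y)) U := fun hg => by
    have := integrableOn_comp_affine Metric.isOpen_ball.measurableSet hg (-(ρ⁻¹ • x₀))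
      (inv_pos.2 hρ).ne'
    rwa [hpre'] at this
  have hinv : ∀ y : Vec n, x₀ + ρ • (-(ρ⁻¹ • x₀) + ρ⁻¹ • y) = y := fun y => by
    simp [smul_add, hρ.ne']
  have iv : IntegrableOn (fun x => φ ‖v x‖) (Metric.ball 0 1) := by
    refine ((comp1 iw).const_mul (max ρ⁻¹ 1 ^ (q + 1))).mono'
      (hmod.continuous_norm.comp_aestronglyMeasurable hvG.1.aestronglyMeasurable)
      (Eventually.of_forall fun x => ?_)
    rw [Real.norm_of_nonneg (hmod.nonneg (norm_nonneg _)), hvn, div_eq_inv_mul]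
    exact hmod.map_mul_le_max (norm_nonneg _) (inv_pos.2 hρ).le
  have hzG : ∀ x, z + G x = Du (x₀ + ρ • x) := fun x => by simp [G]
  obtain ⟨r1, r2, r3⟩ := hmain f hf z hz hza hqc v G hvG iv (comp1 iG)
    (by simpa only [hzG] using comp1 hfin) (fun F DF hF hi => by
      simp only [hzG] at hi ⊢
      have hd := (hF.dilate hmod x₀ hρ).memWZero hmod
      have e0 : ∀ x : Vec n, ρ⁻¹ • (x₀ + ρ • x - x₀) = x := fun x => by simp [hρ.ne']
      have hi' := comp2 hi
      simp only [hinv] at hi'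
      have e1 : ∀ y, ρ⁻¹ • (y - x₀) = -(ρ⁻¹ • x₀) + ρ⁻¹ • y := fun y => by
        rw [smul_sub]
        abel
      have h1 := hmin _ _ hd (by simpa only [e1] using hi')
      have h2 := setIntegral_comp_affine (fun y => f (Du y)) hU x₀ hρ
      have h3 := setIntegral_comp_affine (fun y => f (Du y + DF (ρ⁻¹ • (y - x₀)))) hU x₀ hρ
      rw [hpre] at h2 h3
      simp only [e0] at h3
      rw [h2, h3]
      exact mul_le_mul_of_nonneg_left h1 (by positivity))
  simp only [hvn] at r2 r3
  have s1 := comp2 r1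
  have s2 := comp2 r2
  simp only [G, hinv] at s1 s2
  refine ⟨s1, s2, ?_⟩
  have a1 := setAverage_comp_affine (fun y => shift φ ‖z‖ ‖Du y - z‖) x₀ hρ (1 / 2)
  have a2 := setAverage_comp_affine (fun y => shift φ ‖z‖ (‖u y - l y‖ / ρ)) x₀ hρ 1
  have a3 := setAverage_comp_affine (fun y => shift φ ‖z‖ ‖Du y - z‖ +
    shift φ ‖z‖ (‖u y - l y‖ / ρ)) x₀ hρ 1
  rw [mul_one] at a2 a3
  rw [mul_one_div] at a1
  rwa [a1, a2, a3] at r3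

theorem isEllipticIntegrand_of_quasiconvexBeyond {f : Mat N n → ℝ} (hφ : IsRegularYoung φ)
    (hdφ : DerivComparable p q φ) (hγ : 0 < γ) (hΓ₁ : 0 < Γ₁)
    (hf : ContDiff ℝ 2 f) (hqc : QuasiconvexBeyond φ M γ f)
    (hg : GrowthConditions φ ψ Γ₁ Γ₂ f) : IsEllipticIntegrand ψ M Γ₂ f where
  contDiff := hf
  nonneg z := le_trans (mul_nonneg hΓ₁.le ((hφ.isModular hdφ).nonneg (norm_nonneg _))) (hg.1 z).1
  le z := (hg.1 z).2
  norm_le z hz := by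
    rw [norm_fderiv_fderiv]
    exact hg.2 z hz
  rank_one z hz a b := (hqc z hz).rank_one_nonneg (hφ.isModular hdφ) hf hγ.le
    (fun _ ht => (hφ.isModular_shift hdφ (by positivity)).nonneg ht) a b

end Minimizers

/-! ### Asymptotic quasiconvexity -/

section Asymptotic

variable {n N : ℕ} {M p q γ : ℝ} {φ : ℝ → ℝ}

/-- If `f` agrees for `|z| > M` with a strictly quasiconvex function `g`, then `f` is strictly
quasiconvex at all large `z`: where `f(z + Dw)` and `g(z + Dw)` differ, `|Dw| ≥ |z| / 2`, and
the difference is absorbed by half of the strictness term since `φ_{1 + |z|}(|z| / 2) → ∞`. -/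
theorem AsymptoticallyQuasiconvex.exists_quasiconvexBeyond {f : Mat N n → ℝ}
    (hφ : IsRegularYoung φ) (hdφ : DerivComparable p q φ) (hγ : 0 < γ)
    (hf : Continuous f) (h : AsymptoticallyQuasiconvex φ M γ f) :
    ∃ M' γ' : ℝ, M ≤ M' ∧ 0 < γ' ∧ QuasiconvexBeyond φ M' γ' f := by
  obtain ⟨g, hg, hfg, hqc⟩ := h
  obtain ⟨K₀, hK₀⟩ := (isCompact_closedBall (0 : Mat N n) M).exists_bound_of_continuousOn
    (hf.sub hg).continuousOn
  set K := max K₀ 0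
  have hK : ∀ y, |f y - g y| ≤ K := fun y => by
    rcases le_or_gt ‖y‖ M with hy | hy
    · exact (hK₀ y (mem_closedBall_zero_iff.2 hy)).trans (le_max_left _ _)
    · rw [hfg y hy, sub_self, abs_zero]
      exact le_max_right _ _
  have hφ1 := hφ.toIsYoung.deriv_pos 1 one_pos
  set M' := max M (max (2 * M) (max 1 (40 * K / (γ * rderiv φ 1))))
  refine ⟨M', γ / 2, le_max_left _ _, half_pos hγ, fun z hz w Dw hw hint => ?_⟩
  have hzM : M < ‖z‖ := (le_max_left _ _).trans_lt hz
  have hz' := (le_max_right _ _).trans_lt hz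
  have hz2M : 2 * M < ‖z‖ := (le_max_left _ _).trans_lt hz'
  have hz'' := (le_max_right _ _).trans_lt hz'
  have hz1 : 1 < ‖z‖ := (le_max_left _ _).trans_lt hz''
  have hzK : 40 * K / (γ * rderiv φ 1) < ‖z‖ := (le_max_right _ _).trans_lt hz''
  have hz0 : 0 < 1 + ‖z‖ := by positivity
  have hmod := hφ.isModular_shift hdφ hz0
  have hlarge : K ≤ γ / 2 * shift φ (1 + ‖z‖) (‖z‖ / 2) := by
    have h1 := hφ.sq_le_shift hz0 (show 0 ≤ ‖z‖ / 2 by positivity) le_rfl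
    have h2 : rderiv φ 1 ≤ rderiv φ (1 + ‖z‖) :=
      hφ.deriv_mono (show (0 : ℝ) ≤ 1 from zero_le_one) hz0.le (by linarith)
    have h3 : rderiv φ 1 * (‖z‖ / 20) ≤
        rderiv φ (1 + ‖z‖) / (1 + ‖z‖ + ‖z‖ / 2) * ((‖z‖ / 2) ^ 2 / 2) := by
      rw [div_mul_eq_mul_div, mul_div_assoc]
      refine mul_le_mul h2 ?_ (by positivity) (hφ1.le.trans h2)
      rw [le_div_iff₀ (by positivity)]
      nlinarith
    rw [div_lt_iff₀ (by positivity)] at hzK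
    have h4 := mul_le_mul_of_nonneg_left (h3.trans h1) (half_pos hγ).le
    linarith
  have hdiff : ∀ A, |f (z + A) - g (z + A)| ≤ γ / 2 * shift φ (1 + ‖z‖) ‖A‖ := by
    intro A
    rcases le_or_gt ‖z + A‖ M with hA | hA
    · have h1 : ‖z‖ / 2 ≤ ‖A‖ := by
        have := norm_sub_le (z + A) A
        rw [add_sub_cancel_right] at this
        linarith
      refine (hK _).trans (hlarge.trans (mul_le_mul_of_nonneg_left ?_ (half_pos hγ).le))
      exact hmod.monotoneOn (show 0 ≤ ‖z‖ / 2 by positivity) (norm_nonneg _) h1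
    · rw [hfg _ hA, sub_self, abs_zero]
      exact mul_nonneg (half_pos hγ).le (hmod.nonneg (norm_nonneg _))
  set B : Set (Vec n) := Metric.ball 0 1
  have fin1 : IsFiniteMeasure (volume.restrict B) :=
    isFiniteMeasure_restrict.2 measure_ball_lt_top.ne
  obtain ⟨mD, iD⟩ := hw.1.2.2
  have is : IntegrableOn (fun x => shift φ (1 + ‖z‖) ‖Dw x‖) B := hφ.integrable_shift hdφ hz0 mD iD
  have ig : IntegrableOn (fun x => g (z + Dw x)) B := by
    have h1 : IntegrableOn (fun x => f (z + Dw x) - g (z + Dw x)) B :=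
      (integrable_const K).mono' ((hf.sub hg).comp_aestronglyMeasurable
        (aestronglyMeasurable_const.add mD)) (Eventually.of_forall fun x => hK _)
    refine (hint.sub h1).congr (Eventually.of_forall fun x => ?_)
    simp
  have h1 := hqc z w Dw hw ig
  have hv : 0 < volume.real B :=
    ENNReal.toReal_pos (Metric.measure_ball_pos _ _ one_pos).ne' measure_ball_lt_top.ne
  simp only [setAverage_eq, smul_eq_mul] at h1 ⊢
  have h2 : ∫ x in B, g (z + Dw x) ≤
      (∫ x in B, f (z + Dw x)) + γ / 2 * ∫ x in B, shift φ (1 + ‖z‖) ‖Dw x‖ := by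
    rw [← integral_const_mul, ← integral_add hint (is.const_mul _)]
    refine integral_mono ig (hint.add (is.const_mul _)) fun x => ?_
    have := (abs_le.1 (hdiff (Dw x))).1
    simp only
    linarith
  have h3 := mul_le_mul_of_nonneg_left h2 (inv_nonneg.2 hv.le)
  rw [mul_add, mul_left_comm] at h3
  rw [hfg z hzM]
  simp only [B] at h1 h3 ⊢
  linarith

end Asymptotic

theorem mainTheorem5 (n N : ℕ) (hn : 2 ≤ n) (hN : 1 ≤ N)
    (φ ψ : ℝ → ℝ) (hφ : IsRegularYoung φ) (hψ : IsRegularYoung ψ)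
    (p₁ q₁ : ℝ) (hp₁ : 0 < p₁) (hq₁ : 0 < q₁)
    (hφ₀ : DerivComparable p₁ q₁ φ) (hψ₀ : DerivComparable p₁ q₁ ψ)
    (M β : ℝ) (hM : 0 < M) (hβ₁ : 1 ≤ β) (hβ₂ : β < (n : ℝ) / ((n : ℝ) - 1))
    (hanis : AnisotropyRange φ ψ M β)
    (γ Γ₁ Γ₂ : ℝ) (hγ : 0 < γ) (hΓ₁ : 0 < Γ₁) (hΓ₂ : 0 < Γ₂) :
    (∀ L : ℝ, M < L → ∃ c : ℝ, 0 < c ∧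
      ∀ f : Mat N n → ℝ, ContDiff ℝ 2 f → QuasiconvexBeyond φ M γ f →
        GrowthConditions φ ψ Γ₁ Γ₂ f →
      ∀ (x₀ : Vec n) (ρ : ℝ), 0 < ρ →
      ∀ (u : Vec n → Vec N) (Du : Vec n → Mat N n),
        IsMinimizer φ f (Metric.ball x₀ ρ) u Du →
      ∀ z : Mat N n, M < ‖z‖ → ‖z‖ < L + 1 →
      ∀ q : Vec n →ᵃ[ℝ] Vec N, (∀ x, gradMat (⇑q) x = z) →
        IntegrableOn (fun x => shift φ ‖z‖ ‖Du x - z‖) (Metric.ball x₀ ρ) ∧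
        IntegrableOn (fun x => shift φ ‖z‖ (‖u x - q x‖ / ρ)) (Metric.ball x₀ ρ) ∧
        (⨍ x in Metric.ball x₀ (ρ / 2), shift φ ‖z‖ ‖Du x - z‖) ≤
          c * (⨍ x in Metric.ball x₀ ρ, shift φ ‖z‖ (‖u x - q x‖ / ρ)) +
          c * (⨍ x in Metric.ball x₀ ρ,
            (shift φ ‖z‖ ‖Du x - z‖ + shift φ ‖z‖ (‖u x - q x‖ / ρ))) ^ β) ∧
    (∀ f : Mat N n → ℝ, ContDiff ℝ 2 f → AsymptoticallyQuasiconvex φ M γ f →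
      GrowthConditions φ ψ Γ₁ Γ₂ f →
      ∃ M' γ' : ℝ, M ≤ M' ∧ 0 < γ' ∧ QuasiconvexBeyond φ M' γ' f) := by
  have hn1 : (0 : ℝ) < (n : ℝ) - 1 := by
    have : (2 : ℝ) ≤ n := by exact_mod_cast hn
    linarith
  have hβ : n * (1 - β⁻¹) < 1 := by
    rw [lt_div_iff₀ hn1] at hβ₂
    have hβ0 : 0 < β := by linarith
    rw [← mul_lt_mul_iff_left₀ hβ0]
    have : n * (1 - β⁻¹) * β = n * β - n := by field_simp
    rw [this]
    linarith
  refine ⟨fun L hL => ?_, fun f hf hA _ => hA.exists_quasiconvexBeyond hφ hφ₀ hγ hf.continuous⟩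
  obtain ⟨c, hc, h⟩ := exists_caccioppoli_of_isMinimizer n N hφ hψ hφ₀ hψ₀ hq₁ hM hβ₁ hβ hanis hγ
    hΓ₂ (show M < L + 1 by linarith)
  exact ⟨c, hc, fun f hf hqc hg x₀ ρ hρ u Du hu z hz hzL q hq =>
    h f (isEllipticIntegrand_of_quasiconvexBeyond hφ hφ₀ hγ hΓ₁ hf hqc hg) x₀ ρ hρ u Du hu z hz
      hzL.le (hqc z hz) q hq⟩
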